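/- Fix an integer $n\ge 1$. Let $v$ be an indeterminate and $\mathcal A=\mathbb Z[v,v^{-1}]$. \emph{Setting.} Let $\tilde\Xi$ be the set of pairs $(A,\Delta)$, where $A=(a_{ij})\in \mathrm{Mat}_{n\times n}(\mathbb Z)$ has $a_{ij}\ge 0$ for $i\ne j$, and $\Delta=\{(i_1,j_1),\dots,(i_k,j_k)\}$ with $1\le i_1<\dots<i_k\le n$, $1\le j_k<\dots<j_1\le n$, and $a_{ij}>0$ for every $(i,j)\in\Delta$ with $i\neq j$. Let $\Xi_{n|n,d}\subset\tilde\Xi$ consist of those $(A,\Delta)$ with all $a_{ij}\ge0$, $a_{ij}>0$ for all $(i,j)\in\Delta$, and $\sum_{i,j} a_{ij}=d$. For a finite field $\mathbb F_q$ and $V=\mathbb F_q^d$, let $\mathscr X$ be the set of flags $0=V_0\subseteq V_1\subseteq\dots\subseteq V_n=V$. For $(A,\Delta)\in\Xi_{n|n,d}$ let $\mathcal O_{A,\Delta}\subset\mathscr X\times\mathscr X\times V$ be the $GL(V)$-orbit of triples $(f,f',w)$ such that $a_{ij}=\dim\frac{V_i\cap V'_j}{V_{i-1}\cap V'_j+V_i\cap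 V'_{j-1}}$ for all $i,j$ and $w=\sum_{(i,j)\in\Delta}w_{ij}$ with $w_{ij}\in (V_i\cap V'_j)\setminus(V_{i-1}\cap V'_j+V_i\cap V'_{j-1})$; let $e_{A,\Delta}$ be its characteristic function. Convolution is $(g*h)(f,f',w)=\sum_{f''\in\mathscr X,\ \mu\in V}g(f,f'',\mu)\,h(f'',f',w-\mu)$. The structure constants of convolution in the basis $\{e_{A,\Delta}\}$ are given by polynomials in $q$ with integer coefficients which do not depend on the finite field. Setting $q=v^2$ in them gives the mirabolic quantum Schur algebra $\mathcal{MS}_{n,d}$ over $\mathcal A$ with basis $\{e_{A,\Delta}\mid (A,\Delta)\in\Xi_{n|n,d}\}$; its product is again written $*$. Put $[A]_\Delta=v^{-d(A,\Delta)+r(A,\Delta)}e_{A,\Delta}$, where $d(A,\Delta)=\sum_{i<k\text{ or }j<l}a_{ij}a_{kl}+\sum a_{ij}$, the last sum being over those $(i,j)$ for which some $(k,l)\in\Delta$ has $i\le k$ and $j\le l$, and $r(A,\Delta)=\sum_{i<k}a_{ij}a_{kl}$. Let $\mathrm{ro}(A)$ and $\mathrm{co}(A)$ be the vectors of row and column sums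 of $A$. For an integer $p$ put ${}_pA=A+pI$. Let $v'$ be another indeterminate and $\mathfrak R=\mathbb Q(v)[v',v'^{-1}]$. \textbf{Proposition.} (1) Let $k\ge2$ and $(A_1,\Delta_1),\dots,(A_k,\Delta_k)\in\tilde\Xi$ satisfy $\mathrm{co}(A_i)=\mathrm{ro}(A_{i+1})$ for $1\le i\le k-1$. Then there are $(Z_1,\Delta'_1),\dots,(Z_m,\Delta'_m)\in\tilde\Xi$, elements $G_1,\dots,G_m\in\mathfrak R$ and an integer $p_0\ge0$ such that, for every $p\ge p_0$, all $({}_pA_i,\Delta_i)$ and $({}_pZ_i,\Delta'_i)$ lie in $\Xi_{n|n,d}$ for one and the same $d=d(p)$, and in $\mathbb Q(v)\otimes_{\mathcal A}\mathcal{MS}_{n,d}$ $$[{}_pA_1]_{\Delta_1}*\cdots*[{}_pA_k]_{\Delta_k}=\sum_{i=1}^m G_i(v,v^{-p})\,[{}_pZ_i]_{\Delta'_i}.$$ (2) Let $\mathcal K$ be the free $\mathcal A$-module with basis $\{[A]_\Delta\mid(A,\Delta)\in\tilde\Xi\}$. There is exactly one $\mathcal A$-bilinear product on $\mathcal K$ such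 that, for all $k\ge2$ and all $(A_1,\Delta_1),\dots,(A_k,\Delta_k)\in\tilde\Xi$, the product $[A_1]_{\Delta_1}\cdots[A_k]_{\Delta_k}$ equals $\sum_{i=1}^m G_i(v,1)[Z_i]_{\Delta'_i}$ for any $(Z_i,\Delta_i')$, $G_i$ as in (1) if $\mathrm{co}(A_i)=\mathrm{ro}(A_{i+1})$ for $1\le i\le k-1$, and equals $0$ otherwise (products of more than two factors being nested to the left). This product is associative (there need not be a unit). -/

import Mathlib

open scoped BigOperators LaurentPolynomial

noncomputable section

namespace Mirabolic

/-! ### Flags, relative positions and convolution over a finite field -/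

/-- `n`-step partial flags `0 = V_0 ⊆ V_1 ⊆ ⋯ ⊆ V_n = V` (inclusions need not be strict). -/
@[ext]
structure Flag (K : Type) [Field K] (n : ℕ) (V : Type) [AddCommGroup V] [Module K V] where
  /-- the `i`-th step of the flag -/
  sub : Fin (n + 1) → Submodule K V
  mono : Monotone sub
  first : sub 0 = ⊥
  last : sub (Fin.last n) = ⊤

instance Flag.finite (K : Type) [Field K] (n : ℕ) (V : Type) [AddCommGroup V] [Module K V]
    [Finite V] : Finite (Flag K n V) := by
  have : Finite (Submodule K V) :=
    Finite.of_injective (fun S : Submodule K V => (S : Set V)) SetLike.coe_injective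
  exact Finite.of_injective Flag.sub (fun _ _ h => Flag.ext h)

/-- An integer matrix `A` with non-negative off-diagonal entries, together with a set
`Δ = {(i_1, j_1), …, (i_k, j_k)}` with `i_1 < ⋯ < i_k` and `j_k < ⋯ < j_1`, whose off-diagonal
members sit at positive entries of `A` (no condition on `a_ii` when `(i, i) ∈ Δ`).
This is the set written `Ξ̃`. -/
@[ext]
structure DecMat (n : ℕ) where
  /-- the matrix -/
  A : Matrix (Fin n) (Fin n) ℤ
  /-- the decoration -/
  Δ : Finset (Fin n × Fin n)
  offDiag_nonneg : ∀ i j, i ≠ j → 0 ≤ A i j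
  chain : ∀ x ∈ Δ, ∀ y ∈ Δ, x ≠ y → (x.1 < y.1 ∧ y.2 < x.2) ∨ (y.1 < x.1 ∧ x.2 < y.2)
  offDiag_pos : ∀ x ∈ Δ, x.1 ≠ x.2 → 0 < A x.1 x.2

namespace DecMat

variable {n : ℕ}

/-- The vector of row sums. -/
def ro (M : DecMat n) : Fin n → ℤ := fun i => ∑ j, M.A i j

/-- The vector of column sums. -/
def co (M : DecMat n) : Fin n → ℤ := fun j => ∑ i, M.A i j

/-- `(A, Δ) ↦ (A + p I, Δ)`. -/
def shift (p : ℕ) (M : DecMat n) : DecMat n where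
  A := M.A + Matrix.diagonal (fun _ => (p : ℤ))
  Δ := M.Δ
  offDiag_nonneg := fun i j h => by
    simpa [Matrix.diagonal_apply_ne _ h] using M.offDiag_nonneg i j h
  chain := M.chain
  offDiag_pos := fun x hx h => by
    simpa [Matrix.diagonal_apply_ne _ h] using M.offDiag_pos x hx h

/-- Being a genuine decorated matrix of total `d`: all entries are non-negative, the entries at
the positions in `Δ` are positive, and the entries sum to `d`. -/
structure IsXi (d : ℕ) (M : DecMat n) : Prop where
  nonneg : ∀ i j, 0 ≤ M.A i j
  pos : ∀ x ∈ M.Δ, 0 < M.A x.1 x.2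
  total : ∑ i, ∑ j, M.A i j = (d : ℤ)

/-- `d(A, Δ)`, the dimension of the orbit attached to `(A, Δ)`:
`∑_{i < k or j < l} a_ij a_kl + ∑_{{(i,j)} ≤ Δ} a_ij`. -/
def dimOrbit (M : DecMat n) : ℤ :=
  (∑ x : Fin n × Fin n, ∑ y : Fin n × Fin n,
    if x.1 < y.1 ∨ x.2 < y.2 then M.A x.1 x.2 * M.A y.1 y.2 else 0) +
  ∑ x : Fin n × Fin n, if ∃ y ∈ M.Δ, x.1 ≤ y.1 ∧ x.2 ≤ y.2 then M.A x.1 x.2 else 0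

/-- `r(A, Δ)`, the dimension of the image of that orbit under the first projection:
`∑_{i < k} a_ij a_kl`. -/
def dimProj (M : DecMat n) : ℤ :=
  ∑ x : Fin n × Fin n, ∑ y : Fin n × Fin n,
    if x.1 < y.1 then M.A x.1 x.2 * M.A y.1 y.2 else 0

end DecMat

/-- The set `Ξ_{n|n,d}` of `n × n` decorated matrices of total `d`. -/
abbrev Xi (n d : ℕ) : Type := {M : DecMat n // M.IsXi d}

instance Xi.finite (n d : ℕ) : Finite (Xi n d) := by
  have hle : ∀ (M : Xi n d) (i j : Fin n), M.1.A i j ≤ d := fun M i j => by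
    rw [← M.2.total]
    exact (Finset.single_le_sum (f := fun j => M.1.A i j) (fun j _ => M.2.nonneg i j)
      (Finset.mem_univ j)).trans
      (Finset.single_le_sum (f := fun i => ∑ j, M.1.A i j)
        (fun i _ => Finset.sum_nonneg fun j _ => M.2.nonneg i j) (Finset.mem_univ i))
  let f : Xi n d → (Fin n → Fin n → Set.Icc (0 : ℤ) d) × Finset (Fin n × Fin n) :=
    fun M => (fun i j => ⟨M.1.A i j, M.2.nonneg i j, hle M i j⟩, M.1.Δ)
  refine Finite.of_injective f fun M N h => ?_
  have h1 := congrArg Prod.fst h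
  refine Subtype.ext (DecMat.ext ?_ (congrArg Prod.snd h))
  ext i j
  exact congrArg Subtype.val (congrFun (congrFun h1 i) j)

instance Xi.fintype (n d : ℕ) : Fintype (Xi n d) := Fintype.ofFinite _

section Convolution

variable {K : Type} [Field K] {n : ℕ} {V : Type} [AddCommGroup V] [Module K V]

/-- `V_i ∩ V'_j`, for `i, j` in `[1, n]` (indexed from `0` by `Fin n`). -/
def cell (F F' : Flag K n V) (x : Fin n × Fin n) : Submodule K V :=
  F.sub x.1.succ ⊓ F'.sub x.2.succ

/-- `V_{i-1} ∩ V'_j + V_i ∩ V'_{j-1}`. -/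
def cellBelow (F F' : Flag K n V) (x : Fin n × Fin n) : Submodule K V :=
  (F.sub x.1.castSucc ⊓ F'.sub x.2.succ) ⊔ (F.sub x.1.succ ⊓ F'.sub x.2.castSucc)

/-- `(f, f', w)` lies in the `GL(V)`-orbit `O_{A, Δ}`:
`a_ij = dim (V_i ∩ V'_j) / (V_{i-1} ∩ V'_j + V_i ∩ V'_{j-1})` for all `i, j`, and
`w = ∑_{(i,j) ∈ Δ} w_ij` with `w_ij ∈ V_i ∩ V'_j` not in `V_{i-1} ∩ V'_j + V_i ∩ V'_{j-1}`. -/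
def InOrbit (M : DecMat n) (F F' : Flag K n V) (w : V) : Prop :=
  (∀ x : Fin n × Fin n, (Module.finrank K (cell F F' x) : ℤ) =
    Module.finrank K (cellBelow F F' x) + M.A x.1 x.2) ∧
  ∃ ω : Fin n × Fin n → V,
    (∀ x ∈ M.Δ, ω x ∈ cell F F' x ∧ ω x ∉ cellBelow F F' x) ∧ w = ∑ x ∈ M.Δ, ω x

open Classical in
/-- The characteristic function of the orbit `O_{A, Δ}`. -/
def charFun (M : DecMat n) (F F' : Flag K n V) (w : V) : ℤ :=
  if InOrbit M F F' w then 1 else 0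

/-- Convolution: `(g * h)(f, f', w) = ∑_{f'', μ} g(f, f'', μ) h(f'', f', w - μ)`
(for finite `V` the sum is finite). -/
def conv (g h : Flag K n V → Flag K n V → V → ℤ) (F F' : Flag K n V) (w : V) : ℤ :=
  ∑ᶠ x : Flag K n V × V, g F x.1 x.2 * h x.1 F' (w - x.2)

end Convolution

/-! ### The mirabolic quantum Schur algebra -/

variable {n : ℕ}

/-- `f ∈ ℤ[X]` computes the coefficient of `e_P` in `e_M * e_N`: over every finite field `K`,
the function `e_M * e_N` takes the value `f(|K|)` at all points of the orbit of `P`. -/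
def IsStructurePoly {d : ℕ} (M N P : Xi n d) (f : Polynomial ℤ) : Prop :=
  ∀ (K : Type) [Field K] [Finite K] (F F' : Flag K n (Fin d → K)) (w : Fin d → K),
    InOrbit P.1 F F' w →
      conv (charFun M.1) (charFun N.1) F F' w = f.eval (Nat.card K : ℤ)

open Classical in
/-- The structure polynomial of the generic convolution algebra. -/
def structPoly {d : ℕ} (M N P : Xi n d) : Polynomial ℤ :=
  if h : ∃ f, IsStructurePoly M N P f then h.choose else 0

/-- The field `ℚ(v)`. -/
abbrev Qv : Type := RatFunc ℚ

/-- The indeterminate `v`. -/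
abbrev v : Qv := RatFunc.X

/-- `v` as a unit of `ℚ(v)`. -/
def vUnit : Qvˣ := Units.mk0 v RatFunc.X_ne_zero

/-- The ring `𝒜 = ℤ[v, v⁻¹]`. -/
abbrev 𝒜 : Type := ℤ[T;T⁻¹]

/-- The inclusion `𝒜 ⊂ ℚ(v)`. -/
def toQv : 𝒜 →+* Qv := LaurentPolynomial.eval₂ (Int.castRingHom Qv) vUnit

/-- The ring `ℜ = ℚ(v)[v', v'⁻¹]`. -/
abbrev 𝔑 : Type := Qv[T;T⁻¹]

/-- `G(v, v') ↦ G(v, v^a)`, for `a : ℤ`. -/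
def evalPow (a : ℤ) : 𝔑 →+* Qv := LaurentPolynomial.eval₂ (RingHom.id Qv) (vUnit ^ a)

/-- The mirabolic quantum Schur algebra with scalars extended to `ℚ(v)`: the vector space with
basis `e_M`, `M ∈ Ξ_{n|n,d}`. -/
abbrev MS (n d : ℕ) : Type := Xi n d →₀ Qv

/-- The product of the mirabolic quantum Schur algebra: bilinear, with the coefficient of `e_P`
in `e_M * e_N` the structure polynomial at `q = v²`. -/
def MS.mul {d : ℕ} (x y : MS n d) : MS n d :=
  x.sum fun M a => y.sum fun N b => ∑ P : Xi n d,
    Finsupp.single P (a * b * (structPoly M N P).eval₂ (Int.castRingHom Qv) (v ^ 2))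

/-- `[A]_Δ = v^{-d(A,Δ) + r(A,Δ)} e_{A,Δ}`. -/
def br {d : ℕ} (M : Xi n d) : MS n d :=
  Finsupp.single M (v ^ (-M.1.dimOrbit + M.1.dimProj))

/-- The product `x_0 x_1 ⋯ x_k` (nested to the left) with respect to `mul`. -/
def iterMul {α : Type} (mul : α → α → α) : (k : ℕ) → (Fin (k + 1) → α) → α
  | 0, x => x 0
  | k + 1, x => mul (iterMul mul k fun i => x i.castSucc) (x (Fin.last (k + 1)))

/-! ### Stabilization -/

/-- `co(A_i) = ro(A_{i+1})` for consecutive members of the sequence. -/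
def Matching {k : ℕ} (A : Fin (k + 1) → DecMat n) : Prop :=
  ∀ i : Fin k, (A i.castSucc).co = (A i.succ).ro

/-- For all `p ≥ p₀` all `{}_pA_i` and `{}_pZ_i` are decorated matrices of one common total `d`
and, in the mirabolic quantum Schur algebra for `d`,
`[_pA_0] * ⋯ * [_pA_k] = ∑_i G_i(v, v^{-p}) [_pZ_i]`. -/
def StableForm {k m : ℕ} (A : Fin (k + 1) → DecMat n) (Z : Fin m → DecMat n) (G : Fin m → 𝔑)
    (p₀ : ℕ) : Prop :=
  ∀ p : ℕ, p₀ ≤ p → ∃ (d : ℕ) (hA : ∀ i, ((A i).shift p).IsXi d)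
    (hZ : ∀ i, ((Z i).shift p).IsXi d),
    iterMul MS.mul k (fun i => br ⟨(A i).shift p, hA i⟩) =
      ∑ i, evalPow (-(p : ℤ)) (G i) • br ⟨(Z i).shift p, hZ i⟩

/-- The free `𝒜`-module with basis `{[A]_Δ | (A, Δ) ∈ Ξ̃}`. -/
abbrev KMod (n : ℕ) : Type := DecMat n →₀ 𝒜

/-- The basis element `[A]_Δ` of `KMod n`. -/
def KMod.br (M : DecMat n) : KMod n := Finsupp.single M 1

/-- `KMod n ⊂ ℚ(v) ⊗ KMod n`. -/
def KMod.toQv (x : KMod n) : DecMat n →₀ Qv :=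
  x.mapRange Mirabolic.toQv (map_zero Mirabolic.toQv)

/-- `mul` is obtained from the stable products at `v' = 1`: for every sequence of at least two
elements of `Ξ̃`, the product of the `[A_i]` is `∑_i G_i(v, 1) [Z_i]` for every stable form of it
if the row and column sums match, and `0` otherwise. -/
def IsStabilized (mul : KMod n →ₗ[𝒜] KMod n →ₗ[𝒜] KMod n) : Prop :=
  ∀ (k : ℕ) (A : Fin (k + 2) → DecMat n),
    (Matching A → ∀ (m : ℕ) (Z : Fin m → DecMat n) (G : Fin m → 𝔑) (p₀ : ℕ),
      StableForm A Z G p₀ →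
        KMod.toQv (iterMul (fun x y => mul x y) (k + 1) fun i => KMod.br (A i)) =
          ∑ i, Finsupp.single (Z i) (evalPow 0 (G i))) ∧
    (¬ Matching A → iterMul (fun x y => mul x y) (k + 1) (fun i => KMod.br (A i)) = 0)

end Mirabolic

end

/-! The coefficients of a product are point counts, and the heart of the matter is that for matrices
shifted by pI these counts are tame (`Tm`): rational functions of q and q^p, Laurent in q^p, with
denominators monic in q and without zeros at integers q ≥ 2.

Multiplying by an orbit on the left means summing over the flags F'' in a prescribed position to a
flag F, and over vectors. Refine F so that each unit of an off-diagonal entry becomes a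
one-dimensional step and each diagonal entry a single step, the only kind whose dimension depends on
p. Relative to the refined chain, F'' is described by the column at which it jumps on each step.
When a step with a larger column precedes one with a smaller column, exchanging the two amounts to
summing over complements of the middle subspace (`fsum_adapted_swapAt`). Two diagonal steps are
never exchanged, so one of the two is one-dimensional and the complements are lines or hyperplanes.
Once the columns are sorted, exactly one flag is left. Lines and hyperplanes of a given position
relative to the second flag and the vector are counted by numbers (q^e - 1)/(q - 1) with e affine in
p (`fsum_hypers`, `fsum_lines`). Returning from the refined chain to F costs a division by the
number of refinements (`fsum_posSet_insert`). For the vector, inclusion-exclusion (`charFun_eq_sum`)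
replaces the indicator of an orbit by indicators of subspaces, and sorting turns these subspaces
into members of the chain (`FTame.flagSumI`). The outcome is `FTame.leftMult`.

A tame function with integral values at primes is, for fixed p, a polynomial in q
(`TmBy.exists_poly`). This gives the structure polynomials and their dependence on p. The
normalizing exponents are affine in p (`exists_expo_shift`), and only finitely many matrices can
occur in a product (`finite_candidates`), so the products of two basis elements are given by
finitely many elements of ℚ(v)[v', v'⁻¹].

A Laurent polynomial in v' that vanishes at v^(-p) for all large p is zero. Hence associativity
passes from convolution to the stable product, and the coefficients do not depend on the stable form
chosen. Setting v' = 1 corresponds to p = 0; integrality there follows from integrality for all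
large p by a downward recursion (`sum_zpow_mem_range`). -/

noncomputable section

set_option linter.unusedSectionVars false

/-! ### Tame functions of q and p -/

namespace Mirabolic

open Polynomial in
/-- Evaluation of an integer polynomial at `q = v²`. -/
def evSq : ℤ[X] →+* Qv := Polynomial.eval₂RingHom (Int.castRingHom Qv) (v ^ 2)

lemma v_ne_zero : (v : Qv) ≠ 0 := RatFunc.X_ne_zero

lemma evSq_X : evSq Polynomial.X = (v : Qv) ^ 2 := by simp [evSq]

lemma evSq_injective : Function.Injective evSq := by
  rw [injective_iff_map_eq_zero]
  intro f hf
  have h1 : evSq f = algebraMap (Polynomial ℚ) Qv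
      (Polynomial.expand ℚ 2 (f.map (Int.castRingHom ℚ))) := by
    have : evSq = ((algebraMap (Polynomial ℚ) Qv).comp
        ((Polynomial.expand ℚ 2 : Polynomial ℚ →+* Polynomial ℚ).comp
          (Polynomial.mapRingHom (Int.castRingHom ℚ)))) := by
      apply Polynomial.ringHom_ext
      · intro a; simp [evSq]
      · simp [evSq, RatFunc.algebraMap_X]
    rw [this]; rfl
  rw [h1] at hf
  have h2 := (map_eq_zero_iff _ (RatFunc.algebraMap_injective ℚ)).1 hf
  have h3 := (Polynomial.expand_eq_zero (by norm_num : 0 < 2)).1 h2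
  exact (Polynomial.map_eq_zero_iff (RingHom.injective_int _)).1 h3

lemma evalPow_C (a : ℤ) (c : Qv) : evalPow a (LaurentPolynomial.C c) = c := by
  simp [evalPow]

lemma evalPow_T (a k : ℤ) : evalPow a (LaurentPolynomial.T k) = v ^ (a * k) := by
  simp [evalPow, vUnit, zpow_mul]

open Polynomial in
/-- `φ q p` is a rational function of `q` and `q ^ p`, Laurent polynomial in `q ^ p`,
with denominator monic and without roots `q ≥ 2`; `G` is the result of setting `q = v²` and
`q ^ p = v' ^ (-2)`. -/
def TmBy (φ : ℕ → ℕ → ℚ) (G : 𝔑) : Prop :=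
  ∀ p : ℕ, ∃ a b : ℤ[X], b.Monic ∧ (∀ q : ℕ, 2 ≤ q → b.eval (q : ℤ) ≠ 0) ∧
    (∀ q : ℕ, 2 ≤ q → φ q p * (b.eval (q : ℤ) : ℤ) = (a.eval (q : ℤ) : ℤ)) ∧
    evalPow (-(p : ℤ)) G * evSq b = evSq a

/-- Functions of `q` and `p` that are tame in the sense of `TmBy`. -/
def Tm (φ : ℕ → ℕ → ℚ) : Prop := ∃ G, TmBy φ G

namespace Tm

lemma congr {φ ψ : ℕ → ℕ → ℚ} (h : Tm φ) (hq : ∀ q p, 2 ≤ q → ψ q p = φ q p) : Tm ψ := by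
  obtain ⟨G, h⟩ := h
  refine ⟨G, fun p => ?_⟩
  obtain ⟨a, b, h1, h2, h3, h4⟩ := h p
  exact ⟨a, b, h1, h2, fun q hq' => by rw [hq q p hq', h3 q hq'], h4⟩

lemma const (c : ℤ) : Tm fun _ _ => c := by
  refine ⟨LaurentPolynomial.C (c : Qv), fun p => ⟨Polynomial.C c, 1, Polynomial.monic_one, by simp, by simp, ?_⟩⟩
  rw [evalPow_C]; simp [evSq]

lemma zero : Tm fun _ _ => 0 := by simpa using const 0

lemma one : Tm fun _ _ => 1 := by simpa using const 1

lemma add {φ ψ : ℕ → ℕ → ℚ} (h : Tm φ) (h' : Tm ψ) : Tm fun q p => φ q p + ψ q p := by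
  obtain ⟨G, h⟩ := h
  obtain ⟨G', h'⟩ := h'
  refine ⟨G + G', fun p => ?_⟩
  obtain ⟨a, b, h1, h2, h3, h4⟩ := h p
  obtain ⟨a', b', h1', h2', h3', h4'⟩ := h' p
  refine ⟨a * b' + a' * b, b * b', h1.mul h1', fun q hq => ?_, fun q hq => ?_, ?_⟩
  · rw [Polynomial.eval_mul]; exact mul_ne_zero (h2 q hq) (h2' q hq)
  · simp only [Polynomial.eval_mul, Polynomial.eval_add]
    push_cast
    rw [← h3 q hq, ← h3' q hq]; ring
  · simp only [map_add, map_mul, ← h4, ← h4']; ring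

lemma mul {φ ψ : ℕ → ℕ → ℚ} (h : Tm φ) (h' : Tm ψ) : Tm fun q p => φ q p * ψ q p := by
  obtain ⟨G, h⟩ := h
  obtain ⟨G', h'⟩ := h'
  refine ⟨G * G', fun p => ?_⟩
  obtain ⟨a, b, h1, h2, h3, h4⟩ := h p
  obtain ⟨a', b', h1', h2', h3', h4'⟩ := h' p
  refine ⟨a * a', b * b', h1.mul h1', fun q hq => ?_, fun q hq => ?_, ?_⟩
  · rw [Polynomial.eval_mul]; exact mul_ne_zero (h2 q hq) (h2' q hq)
  · simp only [Polynomial.eval_mul]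
    push_cast
    rw [← h3 q hq, ← h3' q hq]; ring
  · simp only [map_mul, ← h4, ← h4']; ring

lemma neg {φ : ℕ → ℕ → ℚ} (h : Tm φ) : Tm fun q p => -φ q p :=
  ((const (-1)).mul h).congr fun q p _ => by push_cast; ring

lemma sub {φ ψ : ℕ → ℕ → ℚ} (h : Tm φ) (h' : Tm ψ) : Tm fun q p => φ q p - ψ q p :=
  (h.add h'.neg).congr fun q p _ => by ring

lemma sum {ι : Type*} (s : Finset ι) {φ : ι → ℕ → ℕ → ℚ} (h : ∀ i ∈ s, Tm (φ i)) :
    Tm fun q p => ∑ i ∈ s, φ i q p := by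
  classical
  induction s using Finset.induction_on with
  | empty => simpa using zero
  | insert i s hi ih =>
    simp only [Finset.sum_insert hi]
    exact (h i (Finset.mem_insert_self _ _)).add
      (ih fun j hj => h j (Finset.mem_insert_of_mem hj))

lemma ite (P : Prop) [Decidable P] {φ ψ : ℕ → ℕ → ℚ} (h : Tm φ) (h' : Tm ψ) :
    Tm fun q p => if P then φ q p else ψ q p := by
  by_cases hP : P <;> simpa [hP]

lemma zpow (α β : ℤ) : Tm fun q p => (q : ℚ) ^ (β + p * α) := by
  -- At v' = v^(-p) the monomial v'^(-2α) becomes v^(2pα), which is q^(pα) for q = v².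
  refine ⟨LaurentPolynomial.C (v ^ (2 * β)) * LaurentPolynomial.T (-2 * α), fun p => ?_⟩
  set e : ℤ := β + p * α with he
  -- The exponent e may be negative, so numerator and denominator are both multiplied by X^|e|.
  refine ⟨Polynomial.X ^ (e + e.natAbs).toNat, Polynomial.X ^ e.natAbs,
    Polynomial.monic_X_pow _, fun q hq => ?_, fun q hq => ?_, ?_⟩
  · simp; omega
  · have hq0 : (q : ℚ) ≠ 0 := by positivity
    simp only [Polynomial.eval_pow, Polynomial.eval_X]
    push_cast
    rw [← zpow_natCast, ← zpow_natCast, ← zpow_add₀ hq0]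
    congr 1
    have := Int.natCast_natAbs e
    omega
  · rw [map_mul, evalPow_C, evalPow_T, map_pow, map_pow, evSq_X, ← pow_mul, ← pow_mul,
      ← zpow_natCast, ← zpow_natCast, ← zpow_add₀ v_ne_zero, ← zpow_add₀ v_ne_zero]
    congr 1
    push_cast
    have : ((e + (e.natAbs : ℤ)).toNat : ℤ) = e + e.natAbs := by omega
    push_cast at this
    rw [this, he]
    ring

open Polynomial in
lemma inv_poly (b : ℤ[X]) (hb : b.Monic) (hb' : ∀ q : ℕ, 2 ≤ q → b.eval (q : ℤ) ≠ 0) :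
    Tm fun q _ => ((b.eval (q : ℤ) : ℤ) : ℚ)⁻¹ := by
  refine ⟨LaurentPolynomial.C (evSq b)⁻¹, fun p => ⟨1, b, hb, hb', fun q hq => ?_, ?_⟩⟩
  · have : ((b.eval (q : ℤ) : ℤ) : ℚ) ≠ 0 := by exact_mod_cast hb' q hq
    simp [this]
  · rw [evalPow_C, inv_mul_cancel₀, map_one]
    exact (map_ne_zero_iff _ evSq_injective).2 hb.ne_zero

end Tm

/-- The number `(q ^ e - 1) / (q - 1)` of points of projective space. -/
def projCard (q : ℕ) (e : ℤ) : ℚ := ((q : ℚ) ^ e - 1) / (q - 1)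

lemma Tm.projCard (α β : ℤ) : Tm fun q p => projCard q (β + p * α) := by
  have h := ((Tm.zpow α β).sub Tm.one).mul (Tm.inv_poly (Polynomial.X - 1)
    (by simpa using Polynomial.monic_X_sub_C (1 : ℤ)) (fun q hq => by simp; omega))
  refine h.congr fun q p _ => ?_
  simp [Mirabolic.projCard, div_eq_mul_inv]

lemma projCard_natCast {q k : ℕ} (hq : 2 ≤ q) :
    projCard q k = (((∑ l ∈ Finset.range k, (Polynomial.X : Polynomial ℤ) ^ l).eval (q : ℤ) : ℤ) : ℚ) := by
  have h1 : (q : ℚ) - 1 ≠ 0 := by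
    have : (2 : ℚ) ≤ q := by exact_mod_cast hq
    linarith
  rw [Polynomial.eval_finsetSum]
  simp only [Polynomial.eval_pow, Polynomial.eval_X]
  push_cast
  rw [geom_sum_eq (by intro h; apply h1; rw [h]; ring), projCard, zpow_natCast]

lemma projCard_pos {q k : ℕ} (hq : 2 ≤ q) (hk : 0 < k) : 0 < projCard q k := by
  rw [projCard_natCast hq, Polynomial.eval_finsetSum]
  simp only [Polynomial.eval_pow, Polynomial.eval_X]
  push_cast
  apply Finset.sum_pos
  · intro i _; positivity
  · simpa using hk.ne'

/-- These are the denominators produced by averaging over the refinements of a flag. They are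
admissible because k does not depend on p: the number is then a monic geometric sum, positive at
every q ≥ 2. -/
lemma Tm.inv_projCard {k : ℕ} (hk : 0 < k) : Tm fun q _ => (Mirabolic.projCard q k)⁻¹ := by
  have h := Tm.inv_poly (∑ l ∈ Finset.range k, (Polynomial.X : Polynomial ℤ) ^ l)
    (Polynomial.monic_geom_sum_X hk.ne') (fun q hq => by
      have := projCard_pos hq hk
      rw [projCard_natCast hq] at this
      exact_mod_cast this.ne')
  refine h.congr fun q p hq => ?_
  rw [projCard_natCast hq]

end Mirabolic

/-! ### Counting lines and hyperplanes between two subspaces -/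

namespace Mirabolic

open Module

section Count

variable {K : Type*} [Field K] [Finite K] {V : Type*} [AddCommGroup V] [Module K V] [Finite V]

instance submoduleFinite : Finite (Submodule K V) :=
  Finite.of_injective (fun S : Submodule K V => (S : Set V)) SetLike.coe_injective

lemma card_submodule (S : Submodule K V) : Nat.card S = Nat.card K ^ finrank K S := by
  have : Module.Finite K V := Module.Finite.of_finite
  exact Module.natCard_eq_pow_finrank

lemma two_le_card : 2 ≤ Nat.card K := Finite.one_lt_card

lemma finrank_sup_span_singleton {Z : Submodule K V} {y : V} (hy : y ∉ Z) :
    finrank K ↥(Z ⊔ Submodule.span K {y}) = finrank K Z + 1 := by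
  have : Module.Finite K V := Module.Finite.of_finite
  have h := Submodule.finrank_sup_add_finrank_inf_eq Z (Submodule.span K {y})
  have hy0 : y ≠ 0 := fun h0 => hy (h0 ▸ Z.zero_mem)
  rw [finrank_span_singleton hy0] at h
  have h2 : Z ⊓ Submodule.span K {y} = ⊥ := by
    rw [← disjoint_iff]
    exact (Submodule.disjoint_span_singleton' hy0).2 hy
  rw [h2, finrank_bot] at h
  omega

/-- The subspaces between `Z` and `Y` of dimension one more than `Z`. -/
def lines (Z Y : Submodule K V) : Set (Submodule K V) :=
  {U | Z ≤ U ∧ U ≤ Y ∧ finrank K U = finrank K Z + 1}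

/-- The subspaces between `Z` and `Y` of dimension one less than `Y`. -/
def hypers (Z Y : Submodule K V) : Set (Submodule K V) :=
  {U | Z ≤ U ∧ U ≤ Y ∧ finrank K U + 1 = finrank K Y}

/-- Every vector y of Y outside Z spans together with Z exactly one such subspace, and each subspace
U arises from the |U| - |Z| vectors of U outside Z. -/
lemma ncard_lines {Z Y : Submodule K V} (h : Z ≤ Y) :
    ((lines Z Y).ncard : ℚ) = projCard (Nat.card K) ((finrank K Y : ℤ) - finrank K Z) := by
  classical
  have : Module.Finite K V := Module.Finite.of_finite
  have hq := two_le_card (K := K)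
  set q := Nat.card K
  have := Fintype.ofFinite V
  have := Fintype.ofFinite (Submodule K V)
  have hcard : ∀ S : Submodule K V,
      (Finset.univ.filter (· ∈ S)).card = q ^ finrank K S := fun S => by
    rw [← card_submodule, ← Fintype.card_subtype, Nat.card_eq_fintype_card]
  have hdiff : ∀ S T : Submodule K V, S ≤ T →
      (Finset.univ.filter fun y => y ∈ T ∧ y ∉ S).card + q ^ finrank K S
        = q ^ finrank K T := fun S T hST => by
    rw [← hcard, ← hcard, Finset.filter_and_not,
      Finset.card_sdiff_add_card_eq_card]
    intro x; simp only [Finset.mem_filter, Finset.mem_univ, true_and]; exact fun hx => hST hx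
  have key := Finset.card_eq_sum_card_fiberwise (s := Finset.univ.filter fun y => y ∈ Y ∧ y ∉ Z)
    (t := (lines Z Y).toFinset) (f := fun y => Z ⊔ Submodule.span K {y}) (by
      intro y hy
      simp only [Finset.coe_filter, Finset.mem_univ, true_and, Set.mem_ofPred_eq] at hy
      simp only [Set.coe_toFinset]
      exact ⟨le_sup_left, sup_le h ((Submodule.span_singleton_le_iff_mem _ _).2 hy.1),
        finrank_sup_span_singleton hy.2⟩)
  have hfib : ∀ U ∈ (lines Z Y).toFinset,
      ((Finset.univ.filter fun y => y ∈ Y ∧ y ∉ Z).filter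
        fun y => Z ⊔ Submodule.span K {y} = U).card + q ^ finrank K Z
        = q ^ (finrank K Z + 1) := by
    intro U hU
    simp only [Set.mem_toFinset] at hU
    obtain ⟨h1, h2, h3⟩ := hU
    rw [← h3, ← hdiff Z U h1]
    congr 2
    ext y
    simp only [Finset.mem_filter, Finset.mem_univ, true_and]
    constructor
    · rintro ⟨⟨_, hy⟩, rfl⟩
      exact ⟨Submodule.mem_sup_right (Submodule.mem_span_singleton_self y), hy⟩
    · rintro ⟨hyU, hy⟩
      refine ⟨⟨h2 hyU, hy⟩, Submodule.eq_of_le_of_finrank_eq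
        (sup_le h1 ((Submodule.span_singleton_le_iff_mem _ _).2 hyU)) ?_⟩
      rw [finrank_sup_span_singleton hy, h3]
  have h1 := hdiff Z Y h
  have h2 : ∑ U ∈ (lines Z Y).toFinset,
      ((Finset.univ.filter fun y => y ∈ Y ∧ y ∉ Z).filter
        fun y => Z ⊔ Submodule.span K {y} = U).card + (lines Z Y).ncard * q ^ finrank K Z
        = (lines Z Y).ncard * q ^ (finrank K Z + 1) := by
    rw [Set.ncard_eq_toFinset_card', ← smul_eq_mul, ← smul_eq_mul, ← Finset.sum_const,
      ← Finset.sum_const, ← Finset.sum_add_distrib]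
    exact Finset.sum_congr rfl hfib
  rw [← key] at h2
  have hqq : (2 : ℚ) ≤ q := by exact_mod_cast hq
  have hq0 : (q : ℚ) ≠ 0 := by positivity
  have hq1 : (q : ℚ) - 1 ≠ 0 := by linarith
  rw [projCard, zpow_sub₀ hq0, zpow_natCast, zpow_natCast, eq_div_iff hq1]
  have h1' := congrArg (Nat.cast : ℕ → ℚ) h1
  have h2' := congrArg (Nat.cast : ℕ → ℚ) h2
  push_cast at h1' h2'
  have hz : (q : ℚ) ^ finrank K Z ≠ 0 := by positivity
  field_simp
  rw [pow_succ] at h2'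
  linear_combination h1' - h2'

/-- Passing to annihilators in the dual space exchanges hyperplanes with lines and reverses the
interval. -/
lemma ncard_hypers {Z Y : Submodule K V} (h : Z ≤ Y) :
    ((hypers Z Y).ncard : ℚ) = projCard (Nat.card K) ((finrank K Y : ℤ) - finrank K Z) := by
  have : Module.Finite K V := Module.Finite.of_finite
  have : Finite (Dual K V) := Module.finite_of_finite K
  have hr : ∀ S : Submodule K V,
      finrank K S + finrank K S.dualAnnihilator = finrank K V := fun S =>
    Subspace.finrank_add_finrank_dualAnnihilator_eq S
  have h1 : (hypers Z Y).ncard = (lines Y.dualAnnihilator Z.dualAnnihilator).ncard := by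
    refine Set.ncard_congr (fun U _ => U.dualAnnihilator) ?_ ?_ ?_
    · rintro U ⟨h1, h2, h3⟩
      refine ⟨Submodule.dualAnnihilator_anti h2, Submodule.dualAnnihilator_anti h1, ?_⟩
      have := hr U; have := hr Y; omega
    · intro U U' _ _ h; exact Subspace.dualAnnihilator_inj.1 h
    · rintro W ⟨h1, h2, h3⟩
      have hW : (W.dualCoannihilator).dualAnnihilator = W :=
        Subspace.dualCoannihilator_dualAnnihilator_eq
      refine ⟨W.dualCoannihilator, ⟨?_, ?_, ?_⟩, hW⟩
      · rwa [← Subspace.dualAnnihilator_le_dualAnnihilator_iff, hW]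
      · rwa [← Subspace.dualAnnihilator_le_dualAnnihilator_iff, hW]
      · have h4 := hr W.dualCoannihilator
        rw [hW] at h4
        have := hr Y; omega
  rw [h1, ncard_lines (Submodule.dualAnnihilator_anti h)]
  congr 1
  have := hr Z; have := hr Y; omega

end Count

end Mirabolic

/-! ### Finite sums over sets, and hyperplanes sorted by relative position -/

namespace Mirabolic

open Module

/-- The sum of `f` over a set `s` in a finite type. -/
def fsum {α : Type*} [Finite α] (s : Set α) (f : α → ℚ) : ℚ := ∑ a ∈ (Set.toFinite s).toFinset, f a

section fsum

variable {α : Type*} [Finite α] {β : Type*} [Finite β]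

lemma fsum_congr {s t : Set α} {f g : α → ℚ} (h : s = t) (hfg : ∀ a ∈ t, f a = g a) :
    fsum s f = fsum t g := by
  subst h
  exact Finset.sum_congr rfl fun a ha => hfg a (by simpa using ha)

lemma fsum_const (s : Set α) {f : α → ℚ} {c : ℚ} (h : ∀ a ∈ s, f a = c) :
    fsum s f = s.ncard * c := by
  rw [fsum_congr rfl h, fsum, Finset.sum_const, nsmul_eq_mul, ← Set.ncard_eq_toFinset_card]

lemma fsum_empty (f : α → ℚ) : fsum ∅ f = 0 := by simp [fsum]

lemma fsum_singleton (a : α) (f : α → ℚ) : fsum {a} f = f a := by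
  simp [fsum]

lemma fsum_diff {s t : Set α} (h : s ⊆ t) (f : α → ℚ) : fsum (t \ s) f = fsum t f - fsum s f := by
  classical
  have : (Set.toFinite (t \ s)).toFinset = (Set.toFinite t).toFinset \ (Set.toFinite s).toFinset := by
    ext; simp
  rw [fsum, this, Finset.sum_sdiff_eq_sub]
  · rfl
  · intro x; simpa using fun hx => h hx

lemma ncard_diff {s t : Set α} (h : s ⊆ t) : ((t \ s).ncard : ℚ) = t.ncard - s.ncard := by
  have := fsum_diff h (fun _ => 1)
  rwa [fsum_const _ fun _ _ => rfl, fsum_const _ fun _ _ => rfl, fsum_const _ fun _ _ => rfl,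
    mul_one, mul_one, mul_one] at this

lemma fsum_mul_left (s : Set α) (c : ℚ) (f : α → ℚ) : fsum s (fun a => c * f a) = c * fsum s f := by
  rw [fsum, fsum, Finset.mul_sum]

/-- Sums are cut into the layers of an increasing family of sets. When the summand is constant on
layers, only the cardinalities of the members of the family are needed. -/
lemma fsum_telescope (A : ℕ → Set α) (hA : ∀ i, A i ⊆ A (i + 1)) (f : α → ℚ) (n : ℕ) :
    fsum (A n) f = fsum (A 0) f + ∑ t ∈ Finset.range n, fsum (A (t + 1) \ A t) f := by
  rw [Finset.sum_congr rfl fun t _ => fsum_diff (hA t) f, Finset.sum_range_sub (fun t => fsum (A t) f)]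
  ring

lemma fsum_telescope' (A : ℕ → Set α) (hA : ∀ i, A (i + 1) ⊆ A i) (f : α → ℚ) (n : ℕ) :
    fsum (A 0) f = fsum (A n) f + ∑ t ∈ Finset.range n, fsum (A t \ A (t + 1)) f := by
  rw [Finset.sum_congr rfl fun t _ => fsum_diff (hA t) f, Finset.sum_range_sub' (fun t => fsum (A t) f)]
  ring

/-- Interchange of summation over a relation. -/
lemma fsum_comm (s : Set α) (S : α → Set β) (t : Set β) (T : β → Set α) (f : α → β → ℚ)
    (h : ∀ a b, a ∈ s ∧ b ∈ S a ↔ b ∈ t ∧ a ∈ T b) :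
    fsum s (fun a => fsum (S a) (f a)) = fsum t fun b => fsum (T b) fun a => f a b := by
  refine Finset.sum_comm' ?_
  intro a b
  simpa [and_comm] using (h a b).trans and_comm

end fsum

/-! ### Relative position of a subspace and a flag with a vector -/

section Types

variable {K : Type*} [Field K] {V : Type*} [AddCommGroup V] [Module K V]

/-- `ρ j = dim (S ∩ E_j)` for all `j`, and `m` is the least `j` with `w ∈ S + E_j`. -/
def HasType (E : ℕ → Submodule K V) (w : V) (S : Submodule K V) (ρ : ℕ → ℤ) (m : ℕ) : Prop :=
  (∀ j, (finrank K ↥(S ⊓ E j) : ℤ) = ρ j) ∧ ∀ j, w ∈ S ⊔ E j ↔ m ≤ j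

lemma HasType.finrank_eq {E : ℕ → Submodule K V} {w : V} {S : Submodule K V} {ρ : ℕ → ℤ} {m : ℕ}
    (h : HasType E w S ρ m) {n : ℕ} (hn : E n = ⊤) : (finrank K S : ℤ) = ρ n := by
  rw [← h.1 n, hn, inf_top_eq]

lemma exchange {S : Submodule K V} {w u : V} (h : w ∈ S ⊔ Submodule.span K {u}) (hw : w ∉ S) :
    u ∈ S ⊔ Submodule.span K {w} := by
  obtain ⟨s, hs, y, hy, rfl⟩ := Submodule.mem_sup.1 h
  obtain ⟨c, rfl⟩ := Submodule.mem_span_singleton.1 hy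
  have hc : c ≠ 0 := by
    rintro rfl
    exact hw (by simpa using hs)
  have : u = c⁻¹ • (-s) + c⁻¹ • (s + c • u) := by
    rw [← smul_add, neg_add_cancel_left, smul_smul, inv_mul_cancel₀ hc, one_smul]
  have h2 : c⁻¹ • (s + c • u) ∈ Submodule.span K {s + c • u} :=
    Submodule.smul_mem _ _ (Submodule.mem_span_singleton_self _)
  have h3 := Submodule.add_mem_sup (S.smul_mem c⁻¹ (S.neg_mem hs)) h2
  rwa [← this] at h3

variable [Finite V]

lemma finrank_sup_inf {B Y : Submodule K V} (h : B ≤ Y) (W : Submodule K V) :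
    (finrank K ↥(B ⊔ Y ⊓ W) : ℤ) = finrank K B + finrank K ↥(Y ⊓ W) - finrank K ↥(B ⊓ W) := by
  have : Module.Finite K V := Module.Finite.of_finite
  have h1 := Submodule.finrank_sup_add_finrank_inf_eq B (Y ⊓ W)
  rw [← inf_assoc, inf_eq_left.2 h] at h1
  omega

variable {E : ℕ → Submodule K V} {n : ℕ} {w : V} {B Y : Submodule K V} {ρB ρY : ℕ → ℤ} {mB mY : ℕ}

lemma sup_eq_of_hyper {U : Submodule K V} (hU : U ∈ hypers B Y) {W : Submodule K V}
    (hW : W ≤ Y) (h : ¬ W ≤ U) : U ⊔ W = Y := by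
  have : Module.Finite K V := Module.Finite.of_finite
  refine Submodule.eq_of_le_of_finrank_le (sup_le hU.2.1 hW) ?_
  have h1 : finrank K U < finrank K ↥(U ⊔ W) :=
    Submodule.finrank_lt_finrank_of_lt (left_lt_sup.2 h)
  have := hU.2.2
  omega

lemma sup_eq_of_line {U : Submodule K V} (hU : U ∈ lines B Y) {W : Submodule K V}
    (hW : W ≤ U) (h : ¬ W ≤ B) : B ⊔ W = U := by
  have : Module.Finite K V := Module.Finite.of_finite
  refine Submodule.eq_of_le_of_finrank_le (sup_le hU.1 hW) ?_
  have h1 : finrank K B < finrank K ↥(B ⊔ W) :=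
    Submodule.finrank_lt_finrank_of_lt (left_lt_sup.2 h)
  have := hU.2.2
  omega

variable [Finite K]

/-- The sum over the hyperplanes of `Y` containing `B`, in terms of their types. -/
lemma fsum_hypers (hE : Monotone E) (hE0 : E 0 = ⊥) (hEn : E n = ⊤) (hBY : B ≤ Y)
    (hB : HasType E w B ρB mB) (hY : HasType E w Y ρY mY) (Φ : Submodule K V → ℚ)
    (φ₁ φ₂ : ℕ → ℚ)
    (h₁ : ∀ U ∈ hypers B Y, ∀ t < n,
      HasType E w U (fun j => ρY j - if t + 1 ≤ j then 1 else 0) mY → Φ U = φ₁ t)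
    (h₂ : ∀ U ∈ hypers B Y, ∀ t < n,
      HasType E w U (fun j => ρY j - if t + 1 ≤ j then 1 else 0) (t + 1) → Φ U = φ₂ t) :
    fsum (hypers B Y) Φ = ∑ t ∈ Finset.range n,
      let P := projCard (Nat.card K)
      let e : ℕ → ℤ := fun j => ρB n + ρY j - ρB j
      let ex : ℕ → ℤ := fun j => e j + if mB ≤ j then 0 else 1
      if mY ≤ t then
        (P (ρY n - ex t) - P (ρY n - ex (t + 1))) * φ₁ t +
          ((P (ρY n - e t) - P (ρY n - e (t + 1))) -
            (P (ρY n - ex t) - P (ρY n - ex (t + 1)))) * φ₂ t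
      else (P (ρY n - e t) - P (ρY n - e (t + 1))) * φ₁ t := by
  have : Module.Finite K V := Module.Finite.of_finite
  -- The hyperplanes are layered by the last t with Y ⊓ E t ≤ U. On the layer of t, the dimension of
  -- the intersection with E j drops by one exactly for j > t.
  set A : ℕ → Set (Submodule K V) := fun j => hypers (B ⊔ Y ⊓ E j) Y with hA
  have hAanti : ∀ j, A (j + 1) ⊆ A j := fun j U hU =>
    ⟨le_trans (sup_le_sup_left (inf_le_inf_left _ (hE (Nat.le_succ j))) _) hU.1, hU.2⟩
  have hA0 : A 0 = hypers B Y := by simp [hA, hE0]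
  have hAn : A n = ∅ := by
    rw [Set.eq_empty_iff_forall_notMem]
    rintro U ⟨h1, h2, h3⟩
    have h4 : Y ≤ U := le_trans (by simp [hEn]) h1
    rw [le_antisymm h2 h4] at h3
    omega
  have hAsub : ∀ j, A j ⊆ hypers B Y := fun j U hU => ⟨le_sup_left.trans hU.1, hU.2⟩
  have hmem : ∀ t, ∀ U, U ∈ A t \ A (t + 1) ↔ U ∈ hypers B Y ∧ Y ⊓ E t ≤ U ∧ ¬ Y ⊓ E (t + 1) ≤ U := by
    intro t U
    simp only [hA, Set.mem_sdiff, hypers, Set.mem_ofPred_eq, sup_le_iff]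
    tauto
  have htype : ∀ t, ∀ U ∈ A t \ A (t + 1), ∀ j,
      (finrank K ↥(U ⊓ E j) : ℤ) = ρY j - if t + 1 ≤ j then 1 else 0 := by
    intro t U hU j
    obtain ⟨hU, hU1, hU2⟩ := (hmem t U).1 hU
    rw [← hY.1 j]
    have hinf : U ⊓ (Y ⊓ E j) = U ⊓ E j := by rw [← inf_assoc, inf_eq_left.2 hU.2.1]
    split_ifs with hj
    · have h1 := sup_eq_of_hyper hU (W := Y ⊓ E j) inf_le_left
        (fun h => hU2 (le_trans (inf_le_inf_left _ (hE hj)) h))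
      have h2 := Submodule.finrank_sup_add_finrank_inf_eq U (Y ⊓ E j)
      rw [h1, hinf] at h2
      have := hU.2.2
      omega
    · have : U ⊓ E j = Y ⊓ E j := by
        rw [← hinf]
        exact inf_eq_right.2 (le_trans (inf_le_inf_left _ (hE (by omega))) hU1)
      rw [this, sub_zero]
  have hcard : ∀ Z, Z ≤ Y → ((hypers Z Y).ncard : ℚ)
      = projCard (Nat.card K) (ρY n - finrank K Z) := fun Z hZ => by
    rw [ncard_hypers hZ, hY.finrank_eq hEn]
  have he : ∀ j, (finrank K ↥(B ⊔ Y ⊓ E j) : ℤ) = ρB n + ρY j - ρB j := fun j => by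
    rw [finrank_sup_inf hBY, hB.finrank_eq hEn, hY.1, hB.1]
  have hle : ∀ j, B ⊔ Y ⊓ E j ≤ Y := fun j => sup_le hBY inf_le_left
  have hYle : ∀ t, ∀ U ∈ A t \ A (t + 1), ∀ j, t + 1 ≤ j → Y ≤ U ⊔ E j := by
    intro t U hU j hj
    obtain ⟨hU, hU1, hU2⟩ := (hmem t U).1 hU
    rw [← sup_eq_of_hyper hU (W := Y ⊓ E (t + 1)) inf_le_left hU2]
    exact sup_le_sup_left (inf_le_right.trans (hE hj)) _
  rw [← hA0, fsum_telescope' A hAanti Φ n, hAn, fsum_empty, zero_add]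
  refine Finset.sum_congr rfl fun t ht => ?_
  have ht := Finset.mem_range.1 ht
  have hN : ((A t \ A (t + 1)).ncard : ℚ) = projCard (Nat.card K) (ρY n - (ρB n + ρY t - ρB t))
      - projCard (Nat.card K) (ρY n - (ρB n + ρY (t + 1) - ρB (t + 1))) := by
    rw [ncard_diff (hAanti t), hcard _ (hle _), hcard _ (hle _), he, he]
  dsimp only
  by_cases hm : mY ≤ t
  · rw [if_pos hm]
    -- From the index mY on, w may be replaced by a vector x of Y. In a layer t ≥ mY the threshold
    -- stays mY if x lies in U, and rises to t + 1 otherwise; in the layers t < mY it cannot change.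
    obtain ⟨x, hx, e, he', hxe⟩ := Submodule.mem_sup.1 ((hY.2 mY).2 le_rfl)
    have hEm : ∀ j, mY ≤ j → e ∈ E j := fun j hj => hE hj he'
    have hxw : ∀ (S : Submodule K V) j, mY ≤ j → (x ∈ S ⊔ E j ↔ w ∈ S ⊔ E j) := by
      intro S j hj
      have hes : e ∈ S ⊔ E j := Submodule.mem_sup_right (hEm j hj)
      rw [← hxe]
      exact ((S ⊔ E j).add_mem_iff_left hes).symm
    set Bx := B ⊔ Submodule.span K {x} with hBx
    set Ax : ℕ → Set (Submodule K V) := fun j => hypers (Bx ⊔ Y ⊓ E j) Y with hAx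
    have hBxY : Bx ≤ Y := sup_le hBY ((Submodule.span_singleton_le_iff_mem _ _).2 hx)
    have hAxanti : ∀ j, Ax (j + 1) ⊆ Ax j := fun j U hU =>
      ⟨le_trans (sup_le_sup_left (inf_le_inf_left _ (hE (Nat.le_succ j))) _) hU.1, hU.2⟩
    have hAxA : Ax t \ Ax (t + 1) = {U ∈ A t \ A (t + 1) | x ∈ U} := by
      ext U
      simp only [hAx, hBx, hA, Set.mem_sdiff, hypers, Set.mem_ofPred_eq, sup_le_iff,
        Submodule.span_singleton_le_iff_mem]
      tauto
    have hxdim : ∀ j, mY ≤ j → (finrank K ↥(Bx ⊔ Y ⊓ E j) : ℤ) =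
        ρB n + ρY j - ρB j + if mB ≤ j then 0 else 1 := by
      intro j hj
      have h0 : Bx ⊔ Y ⊓ E j = (B ⊔ Y ⊓ E j) ⊔ Submodule.span K {x} := by
        rw [hBx, sup_right_comm]
      have h1 : x ∈ B ⊔ Y ⊓ E j ↔ mB ≤ j := by
        rw [← hB.2 j, ← hxw B j hj, inf_comm, ← sup_inf_assoc_of_le _ hBY]
        exact ⟨fun h => h.1, fun h => ⟨h, hx⟩⟩
      split_ifs with hmB
      · have : Submodule.span K {x} ≤ B ⊔ Y ⊓ E j :=
          (Submodule.span_singleton_le_iff_mem _ _).2 (h1.2 hmB)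
        rw [h0, sup_eq_left.2 this, he, add_zero]
      · rw [h0, finrank_sup_span_singleton fun h => hmB (h1.1 h)]
        push_cast
        rw [he]
    have hNx : ((Ax t \ Ax (t + 1)).ncard : ℚ) =
        projCard (Nat.card K) (ρY n - (ρB n + ρY t - ρB t + if mB ≤ t then 0 else 1))
        - projCard (Nat.card K) (ρY n - (ρB n + ρY (t + 1) - ρB (t + 1) + if mB ≤ t + 1 then 0 else 1)) := by
      rw [ncard_diff (hAxanti t), hcard _ (sup_le hBxY inf_le_left),
        hcard _ (sup_le hBxY inf_le_left), hxdim _ hm, hxdim _ (by omega)]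
    have hsub : Ax t \ Ax (t + 1) ⊆ A t \ A (t + 1) := by rw [hAxA]; exact fun U hU => hU.1
    have hsplit := fsum_diff hsub Φ
    rw [eq_sub_iff_add_eq] at hsplit
    rw [← hsplit, add_comm]
    congr 1
    · rw [fsum_const (c := φ₁ t), hNx]
      intro U hU
      rw [hAxA] at hU
      obtain ⟨hU, hxU⟩ := hU
      refine h₁ U (hAsub _ hU.1) t ht ⟨htype t U hU, fun j => ⟨fun h => ?_, fun h => ?_⟩⟩
      · exact (hY.2 j).1 (sup_le_sup_right (hAsub _ hU.1).2.1 _ h)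
      · exact (hxw U j h).1 (Submodule.mem_sup_left hxU)
    · rw [fsum_const (c := φ₂ t), ncard_diff hsub, hNx, hN]
      rintro U ⟨hU, hxU⟩
      have hxU : x ∉ U := fun h => hxU (by rw [hAxA]; exact ⟨hU, h⟩)
      refine h₂ U (hAsub _ hU.1) t ht ⟨htype t U hU, fun j => ⟨fun h => ?_, fun h => ?_⟩⟩
      · by_contra hj
        have h1 := (hY.2 j).1 (sup_le_sup_right (hAsub _ hU.1).2.1 _ h)
        have h2 := (hxw U j h1).2 h
        apply hxU
        have h3 : x ∈ (U ⊔ E j) ⊓ Y := ⟨h2, hx⟩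
        rw [sup_inf_assoc_of_le _ (hAsub _ hU.1).2.1] at h3
        refine (sup_le le_rfl ?_ : U ⊔ E j ⊓ Y ≤ U) h3
        rw [inf_comm]
        exact (inf_le_inf_left _ (hE (by omega))).trans ((hmem t U).1 hU).2.1
      · have := hYle t U hU j h
        refine (sup_le this le_sup_right : Y ⊔ E j ≤ U ⊔ E j) ((hY.2 j).2 (by omega))
  · rw [if_neg hm, fsum_const (c := φ₁ t), hN]
    intro U hU
    refine h₁ U (hAsub _ hU.1) t ht ⟨htype t U hU, fun j => ⟨fun h => ?_, fun h => ?_⟩⟩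
    · exact (hY.2 j).1 (sup_le_sup_right (hAsub _ hU.1).2.1 _ h)
    · have := hYle t U hU j (by omega)
      exact (sup_le this le_sup_right : Y ⊔ E j ≤ U ⊔ E j) ((hY.2 j).2 h)

end Types

end Mirabolic

/-! ### Lines sorted by relative position -/

namespace Mirabolic

open Module

section Types

variable {K : Type*} [Field K] {V : Type*} [AddCommGroup V] [Module K V] [Finite V] [Finite K]
  {E : ℕ → Submodule K V} {n : ℕ} {w : V} {B Y : Submodule K V} {ρB ρY : ℕ → ℤ} {mB mY : ℕ}

/-- Write U as B plus the line of u. Since w is not in B + E j, the exchange property turns w ∈ U +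
E j into the two conditions u ∈ B + E j + ⟨w⟩ and u ∉ B + E j, so the set becomes a difference of
two sets of lines of known size. -/
lemma lines_diff (E : ℕ → Submodule K V) {s j : ℕ} 
    (hB : HasType E w B ρB s) (hj : j < s) :
    {U ∈ lines B Y | w ∈ U ⊔ E j} =
      lines B (Y ⊓ (B ⊔ E j ⊔ Submodule.span K {w})) \ lines B (Y ⊓ (B ⊔ E j)) := by
  have hw : w ∉ B ⊔ E j := fun h => by have := (hB.2 j).1 h; omega
  ext U
  simp only [lines, Set.mem_ofPred_eq, Set.mem_sdiff, le_inf_iff]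
  constructor
  · rintro ⟨⟨h1, h2, h3⟩, h4⟩
    have h5 : ¬ U ≤ B ⊔ E j := fun h => hw ((sup_le h le_sup_right : U ⊔ E j ≤ B ⊔ E j) h4)
    refine ⟨⟨h1, ⟨h2, ?_⟩, h3⟩, fun h => h5 h.2.1.2⟩
    obtain ⟨u, hu, hu'⟩ := SetLike.not_le_iff_exists.1 h5
    have huB : ¬ Submodule.span K {u} ≤ B := fun h =>
      hu' (Submodule.mem_sup_left (h (Submodule.mem_span_singleton_self u)))
    have h6 := sup_eq_of_line (Y := Y) ⟨h1, h2, h3⟩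
      ((Submodule.span_singleton_le_iff_mem _ _).2 hu) huB
    rw [← h6, sup_right_comm] at h4
    have h7 := exchange h4 hw
    rw [← h6]
    exact sup_le (le_sup_left.trans le_sup_left)
      ((Submodule.span_singleton_le_iff_mem _ _).2 h7)
  · rintro ⟨⟨h1, ⟨h2, h4⟩, h3⟩, h5⟩
    refine ⟨⟨h1, h2, h3⟩, ?_⟩
    have h6 : ¬ U ≤ B ⊔ E j := fun h => h5 ⟨h1, ⟨h2, h⟩, h3⟩
    obtain ⟨u, hu, hu'⟩ := SetLike.not_le_iff_exists.1 h6
    have h7 := exchange (h4 hu) hu'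
    refine (sup_le (sup_le_sup_right h1 _) ?_ : B ⊔ E j ⊔ Submodule.span K {u} ≤ U ⊔ E j) h7
    exact (Submodule.span_singleton_le_iff_mem _ _).2 (Submodule.mem_sup_left hu)

/-- The sum over the subspaces of `Y` containing `B` as a hyperplane, in terms of their types. -/
lemma fsum_lines (hE : Monotone E) (hE0 : E 0 = ⊥) (hEn : E n = ⊤) (hBY : B ≤ Y)
    (hB : HasType E w B ρB mB) (hY : HasType E w Y ρY mY) (Φ : Submodule K V → ℚ)
    (φ₁ φ₂ : ℕ → ℚ)
    (h₁ : ∀ U ∈ lines B Y, ∀ t < n,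
      HasType E w U (fun j => ρB j + if t + 1 ≤ j then 1 else 0) mB → Φ U = φ₁ t)
    (h₂ : ∀ U ∈ lines B Y, ∀ j < n,
      HasType E w U (fun j => ρB j + if mB ≤ j then 1 else 0) j → Φ U = φ₂ j) :
    fsum (lines B Y) Φ = ∑ t ∈ Finset.range n,
      let P := projCard (Nat.card K)
      let e : ℕ → ℤ := fun j => ρY j - ρB j
      let D : ℕ → ℚ := fun j => if mY ≤ j then P (e j + 1) - P (e j) else 0
      if t + 1 = mB ∧ mY < mB then
        (P (e (t + 1)) - P (e t) - D t) * φ₁ t +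
          (D 0 * φ₂ 0 + ∑ j ∈ Finset.range t, (D (j + 1) - D j) * φ₂ (j + 1))
      else (P (e (t + 1)) - P (e t)) * φ₁ t := by
  have : Module.Finite K V := Module.Finite.of_finite
  have hdle : mY ≤ mB := (hY.2 mB).1 (sup_le_sup_right hBY _ ((hB.2 mB).2 le_rfl))
  -- Here the layers are given by the first t + 1 with U ≤ B + E (t + 1); from that index on, the
  -- intersection with E j is one dimension larger than that of B.
  set A : ℕ → Set (Submodule K V) := fun j => lines B (Y ⊓ (B ⊔ E j)) with hA
  have hAmono : ∀ j, A j ⊆ A (j + 1) := fun j U hU =>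
    ⟨hU.1, hU.2.1.trans (inf_le_inf_left _ (sup_le_sup_left (hE (Nat.le_succ j)) _)), hU.2.2⟩
  have hA0 : A 0 = ∅ := by
    rw [Set.eq_empty_iff_forall_notMem]
    rintro U ⟨h1, h2, h3⟩
    have h4 : U ≤ B := by simpa [hE0] using h2.trans inf_le_right
    rw [le_antisymm h4 h1] at h3
    omega
  have hAn : A n = lines B Y := by simp [hA, hEn]
  have hAsub : ∀ j, A j ⊆ lines B Y := fun j U hU => ⟨hU.1, hU.2.1.trans inf_le_left, hU.2.2⟩
  have hmem : ∀ t U, U ∈ A (t + 1) \ A t ↔ U ∈ lines B Y ∧ U ≤ B ⊔ E (t + 1) ∧ ¬ U ≤ B ⊔ E t := by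
    intro t U
    simp only [hA, Set.mem_sdiff, lines, Set.mem_ofPred_eq, le_inf_iff]
    tauto
  have htype : ∀ t, ∀ U ∈ A (t + 1) \ A t, ∀ j,
      (finrank K ↥(U ⊓ E j) : ℤ) = ρB j + if t + 1 ≤ j then 1 else 0 := by
    intro t U hU j
    obtain ⟨hU, hU1, hU2⟩ := (hmem t U).1 hU
    rw [← hB.1 j]
    split_ifs with hj
    · have h1 : B ⊔ U ⊓ E j = U := by
        rw [inf_comm, ← sup_inf_assoc_of_le _ hU.1]
        exact inf_eq_right.2 (hU1.trans (sup_le_sup_left (hE hj) _))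
      have h2 := finrank_sup_inf hU.1 (E j)
      rw [h1] at h2
      have := hU.2.2
      omega
    · have h1 : U ⊓ E j ≤ B := by
        by_contra h
        apply hU2
        rw [← sup_eq_of_line hU inf_le_left h]
        exact sup_le_sup_left (inf_le_right.trans (hE (by omega))) _
      rw [le_antisymm (le_inf h1 inf_le_right) (inf_le_inf_right _ hU.1), add_zero]
  have hcard : ∀ Z, B ≤ Z → ((lines B Z).ncard : ℚ)
      = projCard (Nat.card K) (finrank K Z - finrank K B) := fun Z hZ => ncard_lines hZ
  have he : ∀ j, (finrank K ↥(Y ⊓ (B ⊔ E j)) : ℤ) = finrank K B + ρY j - ρB j := fun j => by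
    rw [inf_comm, sup_inf_assoc_of_le _ hBY, inf_comm, finrank_sup_inf hBY, hY.1, hB.1]
  have hBle : ∀ j, B ≤ Y ⊓ (B ⊔ E j) := fun j => le_inf hBY le_sup_left
  have hAcard : ∀ j, ((A j).ncard : ℚ) = projCard (Nat.card K) (ρY j - ρB j) := fun j => by
    rw [hcard _ (hBle j), he]; congr 1; ring
  have hmle : ∀ U ∈ lines B Y, ∀ j, (w ∈ U ⊔ E j → mY ≤ j) ∧ (mB ≤ j → w ∈ U ⊔ E j) :=
    fun U hU j => ⟨fun h => (hY.2 j).1 (sup_le_sup_right hU.2.1 _ h),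
      fun h => sup_le_sup_right hU.1 _ ((hB.2 j).2 h)⟩
  rw [← hAn, fsum_telescope A hAmono Φ n, hA0, fsum_empty, zero_add]
  refine Finset.sum_congr rfl fun t ht => ?_
  have ht := Finset.mem_range.1 ht
  have hN : ((A (t + 1) \ A t).ncard : ℚ) = projCard (Nat.card K) (ρY (t + 1) - ρB (t + 1))
      - projCard (Nat.card K) (ρY t - ρB t) := by
    rw [ncard_diff (hAmono t), hAcard, hAcard]
  dsimp only
  -- A line can lower the threshold below mB only if it lies in the layer ending at mB: from w ∈ U +
  -- E j with j < mB it follows that U ≤ B + E j + ⟨w⟩ but not U ≤ B + E j. In that layer the lines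
  -- are sorted further, by the new threshold.
  by_cases hc : t + 1 = mB ∧ mY < mB
  · rw [if_pos hc]
    obtain ⟨hts, hd⟩ := hc
    set D : ℕ → Set (Submodule K V) := fun j => {U ∈ lines B Y | w ∈ U ⊔ E j} with hD
    have hDmono : ∀ j, D j ⊆ D (j + 1) := fun j U hU =>
      ⟨hU.1, sup_le_sup_left (hE (Nat.le_succ j)) _ hU.2⟩
    have hDcard : ∀ j, j < mB → ((D j).ncard : ℚ) = if mY ≤ j then
        projCard (Nat.card K) (ρY j - ρB j + 1) - projCard (Nat.card K) (ρY j - ρB j) else 0 := by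
      intro j hj
      split_ifs with hmj
      · obtain ⟨x, hx, e, he', hxe⟩ := Submodule.mem_sup.1 ((hY.2 mY).2 le_rfl)
        have heS : ∀ S, e ∈ S ⊔ E j := fun S => Submodule.mem_sup_right (hE hmj he')
        have hwS : ∀ S, x ∈ S ⊔ E j ↔ w ∈ S ⊔ E j := fun S => by
          rw [← hxe]; exact ((S ⊔ E j).add_mem_iff_left (heS S)).symm
        have hspan : B ⊔ E j ⊔ Submodule.span K {w} = B ⊔ E j ⊔ Submodule.span K {x} := by
          apply le_antisymm
          · refine sup_le le_sup_left ((Submodule.span_singleton_le_iff_mem _ _).2 ?_)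
            rw [← hxe]
            exact add_mem (Submodule.mem_sup_right (Submodule.mem_span_singleton_self x))
              (Submodule.mem_sup_left (heS B))
          · refine sup_le le_sup_left ((Submodule.span_singleton_le_iff_mem _ _).2 ?_)
            have : x = w - e := by rw [← hxe]; abel
            rw [this]
            exact sub_mem (Submodule.mem_sup_right (Submodule.mem_span_singleton_self w))
              (Submodule.mem_sup_left (heS B))
        have hxn : x ∉ B ⊔ E j := fun h => by
          have := (hB.2 j).1 ((hwS B).1 h); omega
        have hmod : Y ⊓ (B ⊔ E j ⊔ Submodule.span K {w})
            = Y ⊓ (B ⊔ E j) ⊔ Submodule.span K {x} := by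
          rw [hspan, sup_comm (B ⊔ E j), inf_comm,
            sup_inf_assoc_of_le _ ((Submodule.span_singleton_le_iff_mem _ _).2 hx), sup_comm,
            inf_comm Y]
        rw [hD]
        dsimp only
        rw [lines_diff E hB hj, ncard_diff, hcard _ (hBle j), hmod,
          hcard _ ((hBle j).trans le_sup_left),
          finrank_sup_span_singleton (fun h : x ∈ Y ⊓ (B ⊔ E j) => hxn h.2)]
        · push_cast
          rw [he]
          congr 2 <;> ring
        · rw [hmod]
          exact fun U hU => ⟨hU.1, hU.2.1.trans le_sup_left, hU.2.2⟩
      · have : D j = ∅ := by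
          rw [Set.eq_empty_iff_forall_notMem]
          exact fun U hU => hmj ((hmle U hU.1 j).1 hU.2)
        simp [this]
    have hDA : D t ⊆ A (t + 1) \ A t := by
      rintro U ⟨hU, hUw⟩
      have hd := lines_diff (Y := Y) E hB (show t < mB by omega)
      have hU' : U ∈ {U ∈ lines B Y | w ∈ U ⊔ E t} := ⟨hU, hUw⟩
      rw [hd] at hU'
      refine (hmem t U).2 ⟨hU, ?_, fun h => hU'.2 ⟨hU.1, le_inf hU.2.1 h, hU.2.2⟩⟩
      refine (hU'.1.2.1.trans inf_le_right).trans (sup_le (sup_le_sup_left (hE (Nat.le_succ t)) _) ?_)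
      exact (Submodule.span_singleton_le_iff_mem _ _).2 ((hB.2 _).2 hts.ge)
    have hsplit := fsum_diff hDA Φ
    rw [eq_sub_iff_add_eq] at hsplit
    rw [← hsplit]
    congr 1
    · rw [fsum_const (c := φ₁ t), ncard_diff hDA, hN, hDcard t (by omega)]
      rintro U ⟨hU, hUD⟩
      refine h₁ U (hAsub _ hU.1) t ht ⟨htype t U hU, fun j => ⟨fun h => ?_,
        (hmle U (hAsub _ hU.1) j).2⟩⟩
      by_contra hj
      exact hUD ⟨hAsub _ hU.1, sup_le_sup_left (hE (by omega)) _ h⟩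
    · have hDtype : ∀ U ∈ D t, ∀ j, (finrank K ↥(U ⊓ E j) : ℤ) = ρB j + if mB ≤ j then 1 else 0 := by
        intro U hU j
        rw [htype t U (hDA hU) j, hts]
      have hDsub : ∀ j ≤ t, D j ⊆ D t := fun j hj U hU => ⟨hU.1, sup_le_sup_left (hE hj) _ hU.2⟩
      rw [fsum_telescope D hDmono Φ t]
      congr 1
      · rw [fsum_const (c := φ₂ 0), hDcard 0 (by omega)]
        intro U hU
        refine h₂ U hU.1 0 (by omega) ⟨hDtype U (hDsub 0 (by omega) hU), fun j => ⟨fun _ => by omega,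
          fun _ => sup_le_sup_left (hE (by omega)) _ hU.2⟩⟩
      · refine Finset.sum_congr rfl fun j hj => ?_
        have hj := Finset.mem_range.1 hj
        rw [fsum_const (c := φ₂ (j + 1)), ncard_diff (hDmono j), hDcard _ (by omega),
          hDcard _ (by omega)]
        rintro U ⟨hU, hU'⟩
        refine h₂ U hU.1 (j + 1) (by omega) ⟨hDtype U (hDsub (j + 1) (by omega) hU), fun i => ⟨fun h => ?_,
          fun h => sup_le_sup_left (hE h) _ hU.2⟩⟩
        by_contra hi
        exact hU' ⟨hU.1, sup_le_sup_left (hE (by omega)) _ h⟩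
  · rw [if_neg hc, fsum_const (c := φ₁ t), hN]
    intro U hU
    obtain ⟨hU0, hU1, hU2⟩ := (hmem t U).1 hU
    refine h₁ U hU0 t ht ⟨htype t U hU, fun j => ⟨fun h => ?_, (hmle U hU0 j).2⟩⟩
    by_contra hj
    push Not at hj
    have hmY := (hmle U hU0 j).1 h
    have hU' : U ∈ {U ∈ lines B Y | w ∈ U ⊔ E j} := ⟨hU0, h⟩
    rw [lines_diff E hB hj] at hU'
    have hjt : j ≤ t := by
      by_contra hjt
      exact hU'.2 ⟨hU0.1, le_inf hU0.2.1 (hU1.trans (sup_le_sup_left (hE (by omega)) _)), hU0.2.2⟩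
    have h1 : mB ≤ t + 1 := by
      rw [← hB.2]
      exact (sup_le hU1 le_sup_right : U ⊔ E (t + 1) ≤ B ⊔ E (t + 1))
        (sup_le_sup_left (hE (by omega)) _ h)
    have h2 : ¬ mB ≤ t := by
      intro hmt
      apply hU2
      refine (hU'.1.2.1.trans inf_le_right).trans (sup_le (sup_le_sup_left (hE hjt) _) ?_)
      exact (Submodule.span_singleton_le_iff_mem _ _).2 ((hB.2 _).2 hmt)
    exact hc ⟨by omega, by omega⟩

end Types

end Mirabolic

/-! ### Tame functions of chains of subspaces -/

namespace Mirabolic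

open Module

/-- A finite vector space over a finite field with a filtration. -/
structure FiltSpace (n : ℕ) where
  /-- the field -/
  K : Type
  /-- the vector space -/
  V : Type
  [field : Field K]
  [finK : Finite K]
  [grp : AddCommGroup V]
  [mod : Module K V]
  [finV : Finite V]
  /-- the filtration -/
  E : ℕ → Submodule K V
  mono : Monotone E
  zero : E 0 = ⊥
  top : E n = ⊤

attribute [instance] FiltSpace.field FiltSpace.finK FiltSpace.grp FiltSpace.mod FiltSpace.finV

variable {n : ℕ}

/-- The number of elements of the ground field. -/
def FiltSpace.q (c : FiltSpace n) : ℕ := Nat.card c.K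

lemma FiltSpace.two_le_q (c : FiltSpace n) : 2 ≤ c.q := two_le_card

/-- Functions of a sequence of subspaces and a vector. -/
abbrev SeqFun (n : ℕ) : Type 1 :=
  (c : FiltSpace n) → ℕ → (ℕ → Submodule c.K c.V) → c.V → ℚ

/-- Predicates of a sequence of subspaces. -/
abbrev SeqPred (n : ℕ) : Type 1 :=
  (c : FiltSpace n) → ℕ → (ℕ → Submodule c.K c.V) → Prop

/-- The subspaces `g r`, `r ∈ D`, have relative position `(ρ r + p ε r, m r)`. -/
def Typed (ε : ℕ → ℕ → ℤ) (D : Finset ℕ) (ρ : ℕ → ℕ → ℤ) (m : ℕ → ℕ) (c : FiltSpace n) (p : ℕ)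
    (g : ℕ → Submodule c.K c.V) (w : c.V) : Prop :=
  ∀ r ∈ D, HasType c.E w (g r) (fun j => ρ r j + p * ε r j) (m r)

/-- On the domain `Dom`, the value of `Φ` depends only on the relative position
`(ρ r + p ε r, m r)` of the `g r`, `r ∈ D`, and is a tame function of `q` and `p`. -/
def Tame (𝓕 : Filter ℕ) (D : Finset ℕ) (Dom : SeqPred n) (ε : ℕ → ℕ → ℤ) (Φ : SeqFun n) : Prop :=
  ∀ (ρ : ℕ → ℕ → ℤ) (m : ℕ → ℕ), ∃ φ, Tm φ ∧ ∀ᶠ p in 𝓕, ∀ (c : FiltSpace n) g w,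
    Dom c p g → Typed ε D ρ m c p g w → Φ c p g w = φ c.q p

section

variable {𝓕 : Filter ℕ} {D : Finset ℕ} {Dom Dom' : SeqPred n} {ε : ℕ → ℕ → ℤ} {Φ Ψ : SeqFun n}

lemma Tame.congr (h : Tame 𝓕 D Dom ε Φ) (hΨ : ∀ᶠ p in 𝓕, ∀ c g w, Dom c p g → Ψ c p g w = Φ c p g w) :
    Tame 𝓕 D Dom ε Ψ := fun ρ m => by
  obtain ⟨φ, h1, h2⟩ := h ρ m
  refine ⟨φ, h1, ?_⟩
  filter_upwards [h2, hΨ] with p h2 h3 c g w hg ht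
  rw [h3 c g w hg, h2 c g w hg ht]

lemma Tame.sub (h : Tame 𝓕 D Dom ε Φ) (h' : Tame 𝓕 D Dom ε Ψ) :
    Tame 𝓕 D Dom ε fun c p g w => Φ c p g w - Ψ c p g w := fun ρ m => by
  obtain ⟨φ, h1, h2⟩ := h ρ m
  obtain ⟨φ', h1', h2'⟩ := h' ρ m
  refine ⟨_, h1.sub h1', ?_⟩
  filter_upwards [h2, h2'] with p h2 h3 c g w hg ht
  rw [h2 c g w hg ht, h3 c g w hg ht]

lemma Tame.mul_left {φ₀ : ℕ → ℕ → ℚ} (h₀ : Tm φ₀) (h : Tame 𝓕 D Dom ε Φ) :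
    Tame 𝓕 D Dom ε fun c p g w => φ₀ c.q p * Φ c p g w := fun ρ m => by
  obtain ⟨φ, h1, h2⟩ := h ρ m
  refine ⟨_, h₀.mul h1, ?_⟩
  filter_upwards [h2] with p h2 c g w hg ht
  rw [h2 c g w hg ht]

/-- Sum over the hyperplanes of `g y` containing `g b`, put in place of `g r`. -/
def hyperOp (b y r : ℕ) (Φ : SeqFun n) : SeqFun n := fun c p g w =>
  fsum (hypers (g b) (g y)) fun U => Φ c p (Function.update g r U) w

/-- Sum over the subspaces of `g y` containing `g b` as a hyperplane, put in place of `g r`. -/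
def lineOp (b y r : ℕ) (Φ : SeqFun n) : SeqFun n := fun c p g w =>
  fsum (lines (g b) (g y)) fun U => Φ c p (Function.update g r U) w

lemma Typed.update {ρ : ℕ → ℕ → ℤ} {m : ℕ → ℕ} {c : FiltSpace n} {p : ℕ}
    {g : ℕ → Submodule c.K c.V} {w : c.V} (h : Typed ε D ρ m c p g w) {r : ℕ}
    {U : Submodule c.K c.V} {ρU e : ℕ → ℤ} {mU : ℕ}
    (hU : HasType c.E w U (fun j => ρU j + p * e j) mU) :
    Typed (Function.update ε r e) (insert r D) (Function.update ρ r ρU) (Function.update m r mU)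
      c p (Function.update g r U) w := by
  intro i hi
  by_cases hir : i = r
  · subst hir; simpa using hU
  · simpa [Function.update_of_ne hir] using h i (by simpa [hir] using hi)

/-- All exponents in `fsum_hypers` are affine in p. A hyperplane has the same dimensions as `g y` up
to a bounded correction, so the new entry inherits the slope `ε y`. -/
lemma Tame.hyperOp {b y r : ℕ} (hb : b ∈ D) (hy : y ∈ D)
    (h : Tame 𝓕 (insert r D) Dom' (Function.update ε r (ε y)) Φ)
    (hle : ∀ᶠ p in 𝓕, ∀ c g, Dom c p g → g b ≤ g y ∧
      ∀ U ∈ hypers (g b) (g y), Dom' c p (Function.update g r U)) :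
    Tame 𝓕 D Dom ε (hyperOp b y r Φ) := fun ρ m => by
  choose φ₁ hφ₁ h₁ using fun t : ℕ => h
    (Function.update ρ r (fun j => ρ y j - if t + 1 ≤ j then 1 else 0)) (Function.update m r (m y))
  choose φ₂ hφ₂ h₂ using fun t : ℕ => h
    (Function.update ρ r (fun j => ρ y j - if t + 1 ≤ j then 1 else 0)) (Function.update m r (t + 1))
  have key : ∀ (α β : ℤ), Tm fun q p => projCard q (β + p * α) := Tm.projCard
  have hP : ∀ j, Tm fun q p => projCard q ((ρ y n + p * ε y n) -
      ((ρ b n + p * ε b n) + (ρ y j + p * ε y j) - (ρ b j + p * ε b j))) := fun j =>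
    (key (ε y n - (ε b n + ε y j - ε b j)) (ρ y n - (ρ b n + ρ y j - ρ b j))).congr
      fun q p _ => by congr 1; ring
  have hPx : ∀ j, Tm fun q p => projCard q ((ρ y n + p * ε y n) -
      ((ρ b n + p * ε b n) + (ρ y j + p * ε y j) - (ρ b j + p * ε b j) +
        if m b ≤ j then 0 else 1)) := fun j =>
    (key (ε y n - (ε b n + ε y j - ε b j)) (ρ y n - (ρ b n + ρ y j - ρ b j +
        if m b ≤ j then 0 else 1))).congr
      fun q p _ => by congr 1; ring
  refine ⟨_, Tm.sum (Finset.range n) fun t _ => Tm.ite (m y ≤ t)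
    ((((hPx t).sub (hPx (t + 1))).mul (hφ₁ t)).add
      ((((hP t).sub (hP (t + 1))).sub ((hPx t).sub (hPx (t + 1)))).mul (hφ₂ t)))
    (((hP t).sub (hP (t + 1))).mul (hφ₁ t)), ?_⟩
  have e1 := (Filter.eventually_all_finset (Finset.range n)).2 fun t _ => h₁ t
  have e2 := (Filter.eventually_all_finset (Finset.range n)).2 fun t _ => h₂ t
  filter_upwards [e1, e2, hle] with p e1 e2 hle c g w hg ht
  obtain ⟨hle1, hle2⟩ := hle c g hg
  have hcomm : ∀ t j : ℕ, (ρ y j + (p : ℤ) * ε y j - if t + 1 ≤ j then 1 else 0)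
      = (ρ y j - if t + 1 ≤ j then 1 else 0) + p * ε y j := fun t j => by ring
  exact fsum_hypers c.mono c.zero c.top hle1 (ht b hb) (ht y hy) _ (fun t => φ₁ t c.q p)
    (fun t => φ₂ t c.q p)
    (fun U hU t htn hT => e1 t (Finset.mem_range.2 htn) c _ w (hle2 U hU)
      (ht.update (by simpa only [hcomm] using hT)))
    (fun U hU t htn hT => e2 t (Finset.mem_range.2 htn) c _ w (hle2 U hU)
      (ht.update (by simpa only [hcomm] using hT)))

/-- Analogous to `Tame.hyperOp`, with `fsum_lines`; the new entry now differs boundedly from `g b`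
and inherits its slope. -/
lemma Tame.lineOp {b y r : ℕ} (hb : b ∈ D) (hy : y ∈ D)
    (h : Tame 𝓕 (insert r D) Dom' (Function.update ε r (ε b)) Φ)
    (hle : ∀ᶠ p in 𝓕, ∀ c g, Dom c p g → g b ≤ g y ∧
      ∀ U ∈ lines (g b) (g y), Dom' c p (Function.update g r U)) :
    Tame 𝓕 D Dom ε (lineOp b y r Φ) := fun ρ m => by
  choose φ₁ hφ₁ h₁ using fun t : ℕ => h
    (Function.update ρ r (fun j => ρ b j + if t + 1 ≤ j then 1 else 0)) (Function.update m r (m b))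
  choose φ₂ hφ₂ h₂ using fun j : ℕ => h
    (Function.update ρ r (fun j => ρ b j + if m b ≤ j then 1 else 0)) (Function.update m r j)
  have key : ∀ (α β : ℤ), Tm fun q p => projCard q (β + p * α) := Tm.projCard
  have hP : ∀ j, Tm fun q p => projCard q ((ρ y j + p * ε y j) - (ρ b j + p * ε b j)) := fun j =>
    (key (ε y j - ε b j) (ρ y j - ρ b j)).congr fun q p _ => by congr 1; ring
  have hP1 : ∀ j, Tm fun q p => projCard q ((ρ y j + p * ε y j) - (ρ b j + p * ε b j) + 1) := fun j =>
    (key (ε y j - ε b j) (ρ y j - ρ b j + 1)).congr fun q p _ => by congr 1; ring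
  have hD : ∀ j, Tm fun q p => if m y ≤ j then
      projCard q ((ρ y j + p * ε y j) - (ρ b j + p * ε b j) + 1) -
        projCard q ((ρ y j + p * ε y j) - (ρ b j + p * ε b j)) else 0 := fun j =>
    Tm.ite _ ((hP1 j).sub (hP j)) Tm.zero
  refine ⟨_, Tm.sum (Finset.range n) fun t _ => Tm.ite (t + 1 = m b ∧ m y < m b)
    (((((hP (t + 1)).sub (hP t)).sub (hD t)).mul (hφ₁ t)).add
      (((hD 0).mul (hφ₂ 0)).add (Tm.sum (Finset.range t) fun j _ =>
        ((hD (j + 1)).sub (hD j)).mul (hφ₂ (j + 1)))))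
    (((hP (t + 1)).sub (hP t)).mul (hφ₁ t)), ?_⟩
  have e1 := (Filter.eventually_all_finset (Finset.range n)).2 fun t _ => h₁ t
  have e2 := (Filter.eventually_all_finset (Finset.range n)).2 fun t _ => h₂ t
  filter_upwards [e1, e2, hle] with p e1 e2 hle c g w hg ht
  obtain ⟨hle1, hle2⟩ := hle c g hg
  have hcomm : ∀ (P : Prop) [Decidable P] (j : ℕ), (ρ b j + (p : ℤ) * ε b j + if P then 1 else 0)
      = (ρ b j + if P then 1 else 0) + p * ε b j := fun P _ j => by ring
  exact fsum_lines c.mono c.zero c.top hle1 (ht b hb) (ht y hy) _ (fun t => φ₁ t c.q p)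
    (fun t => φ₂ t c.q p)
    (fun U hU t htn hT => e1 t (Finset.mem_range.2 htn) c _ w (hle2 U hU)
      (ht.update (by simpa only [hcomm] using hT)))
    (fun U hU t htn hT => e2 t (Finset.mem_range.2 htn) c _ w (hle2 U hU)
      (ht.update (by simpa only [hcomm] using hT)))

/-- Sum over the translates of the vector by elements of `g s`. -/
def shiftOp (s : ℕ) (Φ : SeqFun n) : SeqFun n := fun c p g w =>
  fsum (g s : Set c.V) fun μ => Φ c p g (w - μ)

lemma card_inf_coset {K V : Type*} [Field K] [Finite K] [AddCommGroup V] [Module K V] [Finite V]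
    (S T : Submodule K V) {w : V} (h : w ∈ S ⊔ T) :
    ({μ ∈ (S : Set V) | w - μ ∈ T}.ncard : ℚ) = (Nat.card K : ℚ) ^ (finrank K ↥(S ⊓ T)) := by
  obtain ⟨x, hx, t, ht, rfl⟩ := Submodule.mem_sup.1 h
  have : {μ ∈ (S : Set V) | x + t - μ ∈ T} = (fun y => x + y) '' ((S ⊓ T : Submodule K V) : Set V) := by
    ext μ
    simp only [Set.mem_ofPred_eq, SetLike.mem_coe, Set.mem_image, Submodule.mem_inf]
    constructor
    · rintro ⟨h1, h2⟩
      refine ⟨μ - x, ⟨sub_mem h1 hx, ?_⟩, by abel⟩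
      have := sub_mem ht h2
      convert this using 1
      abel
    · rintro ⟨y, ⟨h1, h2⟩, rfl⟩
      refine ⟨add_mem hx h1, ?_⟩
      convert sub_mem ht h2 using 1
      abel
  rw [this, Set.ncard_image_of_injective _ (add_right_injective x)]
  have h2 := card_submodule (S ⊓ T)
  have h3 : Nat.card ↥(S ⊓ T) = ((S ⊓ T : Submodule K V) : Set V).ncard := Nat.card_coe_set_eq _
  rw [← h3, h2]
  push_cast
  rfl

lemma fsum_translate {K V : Type*} [Field K] [AddCommGroup V] [Module K V] [Finite V]
    (S : Submodule K V) {u : V} (hu : u ∈ S) (f : V → ℚ) :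
    fsum (S : Set V) (fun μ => f (u + μ)) = fsum (S : Set V) f := by
  refine Finset.sum_bij' (fun μ _ => u + μ) (fun μ _ => -u + μ) ?_ ?_ ?_ ?_ ?_
  · intro a ha; simp at ha ⊢; exact add_mem hu ha
  · intro a ha; simp only [Set.Finite.mem_toFinset, SetLike.mem_coe] at ha ⊢; exact add_mem (neg_mem hu) ha
  · intros; simp
  · intros; simp
  · intros; simp

lemma shiftOp_add_left {s : ℕ} {c : FiltSpace n} {p : ℕ} {g : ℕ → Submodule c.K c.V} {u : c.V}
    (hu : u ∈ g s) (w : c.V) : shiftOp s Φ c p g (u + w) = shiftOp s Φ c p g w := by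
  have := fsum_translate (g s) hu (fun μ => Φ c p g (u + w - μ))
  rw [shiftOp, shiftOp, ← this]
  refine fsum_congr rfl fun a _ => ?_
  congr 1
  abel

/-- Adding an element of `g s` to an element of `g (s + 1)` reaches every element of `g (s + 1)`
exactly |g s| times. -/
lemma shiftOp_succ {s : ℕ} {c : FiltSpace n} {p : ℕ} {g : ℕ → Submodule c.K c.V} (w : c.V)
    (h : g s ≤ g (s + 1)) :
    fsum (g (s + 1) : Set c.V) (fun μ => shiftOp s Φ c p g (w - μ)) =
      (c.q : ℚ) ^ (finrank c.K (g s)) * shiftOp (s + 1) Φ c p g w := by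
  unfold shiftOp
  rw [fsum_comm _ (fun _ => (g s : Set c.V)) (g s : Set c.V) (fun _ => (g (s + 1) : Set c.V)) _
    (fun a b => and_comm)]
  rw [fsum_const (c := shiftOp (s + 1) Φ c p g w)]
  · congr 1
    have h2 := card_submodule (g s)
    have h3 : Nat.card (g s) = (g s : Set c.V).ncard := Nat.card_coe_set_eq _
    rw [← h3, h2]
    push_cast
    rfl
  · intro b hb
    rw [shiftOp, ← fsum_translate (g (s + 1)) (h hb) (fun μ => Φ c p g (w - μ))]
    refine fsum_congr rfl fun a _ => ?_
    congr 1
    abel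

/-- Induction on s through `shiftOp_succ`. The vectors μ of `g (s + 1)` are grouped by the least j
with w - μ ∈ g s + E j. Sums over `g s` see w - μ only modulo `g s`, so it may be replaced by a
vector of E j, whose threshold is j relative to `g r` for r ≤ s and unchanged for r > s. -/
lemma Tame.shiftOp {N : ℕ} (h : Tame 𝓕 (Finset.range (N + 1)) Dom ε Φ)
    (hDom : ∀ c p g, Dom c p g → g 0 = ⊥ ∧ ∀ i j, i ≤ j → j ≤ N → g i ≤ g j) (s : ℕ) (hs : s ≤ N) :
    Tame 𝓕 (Finset.range (N + 1)) Dom ε (shiftOp s Φ) := by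
  induction s with
  | zero =>
    refine h.congr (Filter.Eventually.of_forall fun p c g w hg => ?_)
    have : (g 0 : Set c.V) = {0} := by rw [(hDom c p g hg).1]; rfl
    rw [Mirabolic.shiftOp, this, fsum_singleton, sub_zero]
  | succ s ih =>
    have ih := ih (by omega)
    intro ρ m
    choose φ hφ h1 using fun j : ℕ => ih ρ (fun r => if r ≤ s then j else m r)
    have hP : ∀ j, Tm fun q p => if m (s + 1) ≤ j then
        (q : ℚ) ^ (((ρ s n + p * ε s n) + (ρ (s + 1) j + p * ε (s + 1) j) - (ρ s j + p * ε s j)))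
        else 0 := fun j =>
      Tm.ite _ ((Tm.zpow (ε s n + ε (s + 1) j - ε s j) (ρ s n + ρ (s + 1) j - ρ s j)).congr
        fun q p _ => by congr 1; ring) Tm.zero
    -- The leading power of q is 1/|g s|, which undoes the multiplicity in `shiftOp_succ`.
    refine ⟨_, (Tm.zpow (-ε s n) (-ρ s n)).mul (((hP 0).mul (hφ 0)).add
      (Tm.sum (Finset.range n) fun j _ => ((hP (j + 1)).sub (hP j)).mul (hφ (j + 1)))), ?_⟩
    have e1 := (Filter.eventually_all_finset (Finset.range (n + 1))).2 fun t _ => h1 t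
    filter_upwards [e1] with p e1 c g w hg ht
    have : Module.Finite c.K c.V := Module.Finite.of_finite
    obtain ⟨h0, hmono⟩ := hDom c p g hg
    have hss : g s ≤ g (s + 1) := hmono _ _ (Nat.le_succ s) hs
    have hts := ht s (Finset.mem_range.2 (by omega))
    have hts1 := ht (s + 1) (Finset.mem_range.2 (by omega))
    have hq0 : (c.q : ℚ) ≠ 0 := by have := c.two_le_q; positivity
    have key := shiftOp_succ (Φ := Φ) (p := p) w hss
    set A : ℕ → Set c.V := fun j => {μ ∈ (g (s + 1) : Set c.V) | w - μ ∈ g s ⊔ c.E j} with hA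
    have hAmono : ∀ j, A j ⊆ A (j + 1) := fun j μ hμ =>
      ⟨hμ.1, sup_le_sup_left (c.mono (Nat.le_succ j)) _ hμ.2⟩
    have hAn : A n = (g (s + 1) : Set c.V) := by
      ext μ; simp [hA, c.top]
    have hlevel : ∀ j ≤ n, ∀ μ ∈ g (s + 1), (∀ i, w - μ ∈ g s ⊔ c.E i ↔ j ≤ i) →
        Mirabolic.shiftOp s Φ c p g (w - μ) = φ j c.q p := by
      intro j hj μ hμ hi
      obtain ⟨u, hu, e, he, hue⟩ := Submodule.mem_sup.1 ((hi j).2 le_rfl)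
      rw [← hue, shiftOp_add_left hu]
      refine e1 j (Finset.mem_range.2 (by omega)) c g e hg fun r hr => ⟨(ht r hr).1, fun i => ?_⟩
      have hr := Finset.mem_range.1 hr
      dsimp only
      split_ifs with hrs
      · refine ⟨fun h => (hi i).1 ?_, fun h => Submodule.mem_sup_right (c.mono h he)⟩
        rw [← hue]
        exact add_mem (Submodule.mem_sup_left hu) (sup_le_sup_right (hmono _ _ hrs (by omega)) _ h)
      · rw [← (ht r (Finset.mem_range.2 hr)).2 i]
        have hmem : μ + u ∈ g r ⊔ c.E i := Submodule.mem_sup_left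
          (add_mem (hmono _ _ (by omega) (by omega) hμ) (hmono _ _ (by omega) (by omega) hu))
        have : w = (μ + u) + e := by rw [add_assoc, hue]; abel
        rw [this]
        exact ((g r ⊔ c.E i).add_mem_iff_right hmem).symm
    have hcard : ∀ j, ((A j).ncard : ℚ) = if m (s + 1) ≤ j then
        (c.q : ℚ) ^ (((ρ s n + p * ε s n) + (ρ (s + 1) j + p * ε (s + 1) j) - (ρ s j + p * ε s j)))
        else 0 := by
      intro j
      split_ifs with hj
      · have hw : w ∈ g (s + 1) ⊔ (g s ⊔ c.E j) :=
          (sup_le_sup_left le_sup_right _ : g (s + 1) ⊔ c.E j ≤ _) ((hts1.2 j).2 hj)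
        rw [hA, card_inf_coset _ _ hw, inf_comm, sup_inf_assoc_of_le _ hss, ← zpow_natCast,
          inf_comm, finrank_sup_inf hss, hts.finrank_eq c.top, hts.1, hts1.1]
        rfl
      · have : A j = ∅ := by
          rw [Set.eq_empty_iff_forall_notMem]
          rintro μ ⟨h1, h2⟩
          apply hj
          rw [← hts1.2 j]
          have h3 : w - μ ∈ g (s + 1) ⊔ c.E j := sup_le_sup_right hss _ h2
          have := add_mem h3 (Submodule.mem_sup_left h1)
          rwa [sub_add_cancel] at this
        simp [this]
    have hsum : (fsum (A 0) fun μ => Mirabolic.shiftOp s Φ c p g (w - μ))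
        = ((A 0).ncard : ℚ) * φ 0 c.q p := by
      refine fsum_const _ fun μ hμ => hlevel 0 (by omega) μ hμ.1 fun i => ⟨fun _ => by omega,
        fun _ => sup_le_sup_left (c.mono (by omega)) _ hμ.2⟩
    have hsum' : ∀ j ∈ Finset.range n,
        (fsum (A (j + 1) \ A j) fun μ => Mirabolic.shiftOp s Φ c p g (w - μ))
        = (((A (j + 1)).ncard : ℚ) - (A j).ncard) * φ (j + 1) c.q p := by
      intro j hj
      rw [← ncard_diff (hAmono j)]
      refine fsum_const _ fun μ hμ => hlevel (j + 1) (by simpa using hj) μ hμ.1.1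
        fun i => ⟨fun h => ?_, fun h => sup_le_sup_left (c.mono h) _ hμ.1.2⟩
      by_contra hi
      exact hμ.2 ⟨hμ.1.1, sup_le_sup_left (c.mono (by omega)) _ h⟩
    rw [← hAn, fsum_telescope A hAmono _ n, hsum, Finset.sum_congr rfl hsum'] at key
    simp only [hcard] at key
    rw [key, ← mul_assoc, ← zpow_natCast, hts.finrank_eq c.top, ← zpow_add₀ hq0]
    rw [show -ρ s n + (p : ℤ) * -ε s n + (ρ s n + p * ε s n) = 0 by ring, zpow_zero, one_mul]

end

end Mirabolic

namespace Mirabolic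

open Module

/-! ### Sorting sequences by adjacent transpositions -/

section Swap

/-- The sequence with the entries `r` and `r + 1` interchanged. -/
def swapAt {α : Type*} (L : ℕ → α) (r : ℕ) : ℕ → α := fun i => L (Equiv.swap r (r + 1) i)

variable {α : Type*} (L : ℕ → α) (r : ℕ)

@[simp] lemma swapAt_left : swapAt L r r = L (r + 1) := by simp [swapAt]

@[simp] lemma swapAt_right : swapAt L r (r + 1) = L r := by simp [swapAt]

lemma swapAt_of_ne {i : ℕ} (h : i ≠ r) (h' : i ≠ r + 1) : swapAt L r i = L i := by
  simp [swapAt, Equiv.swap_apply_of_ne_of_ne h h']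

lemma sum_swapAt {M : Type*} [AddCommMonoid M] (f : α → M) {i : ℕ} (hi : i ≠ r + 1) :
    ∑ j ∈ Finset.range i, f (swapAt L r j) = ∑ j ∈ Finset.range i, f (L j) := by
  refine Finset.sum_equiv (Equiv.swap r (r + 1)) (fun j => ?_) (fun j _ => rfl)
  by_cases h1 : j = r
  · subst h1; simp; omega
  by_cases h2 : j = r + 1
  · subst h2; simp; omega
  rw [Equiv.swap_apply_of_ne_of_ne h1 h2]

lemma sum_swapAt_mid {M : Type*} [AddCommMonoid M] (f : α → M) :
    ∑ j ∈ Finset.range (r + 1), f (swapAt L r j) = ∑ j ∈ Finset.range r, f (L j) + f (L (r + 1)) := by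
  rw [Finset.sum_range_succ, sum_swapAt _ _ _ (by omega), swapAt_left]

/-- Exchanging a descent at r lowers the sum of κ over the first r + 1 entries and no other prefix
sum, so the total of all prefix sums decreases. The relation `Rel` carries through the sorting
whatever is needed to justify each exchange. -/
lemma bubble_sort {N : ℕ} (κ : α → ℕ) (Rel : α → α → Prop)
    (hRel : ∀ x y, κ y < κ x → Rel x y → Rel y x) (P : (ℕ → α) → Prop)
    (base : ∀ L : ℕ → α, (∀ i j, i < j → j < N → Rel (L i) (L j)) →
      (∀ i j, i ≤ j → j < N → κ (L i) ≤ κ (L j)) → P L)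
    (step : ∀ (L : ℕ → α) r, r + 1 < N → κ (L (r + 1)) < κ (L r) → Rel (L r) (L (r + 1)) →
      P (swapAt L r) → P L)
    (L : ℕ → α) (hL : ∀ i j, i < j → j < N → Rel (L i) (L j)) : P L := by
  induction hM : ∑ i ∈ Finset.range (N + 1), ∑ j ∈ Finset.range i, κ (L j)
    using Nat.strong_induction_on generalizing L with
  | _ M ih =>
    by_cases hs : ∃ r, r + 1 < N ∧ κ (L (r + 1)) < κ (L r)
    · obtain ⟨r, hr, hlt⟩ := hs
      refine step L r hr hlt (hL _ _ (Nat.lt_succ_self r) hr) (ih _ ?_ _ ?_ rfl)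
      · rw [← hM]
        refine Finset.sum_lt_sum (fun i _ => ?_) ⟨r + 1, Finset.mem_range.2 (by omega), ?_⟩
        · by_cases hi : i = r + 1
          · subst hi
            rw [sum_swapAt_mid, Finset.sum_range_succ]
            omega
          · rw [sum_swapAt _ _ _ hi]
        · rw [sum_swapAt_mid, Finset.sum_range_succ]
          omega
      · intro i j hij hj
        by_cases h1 : i = r
        · subst h1
          by_cases h2 : j = i + 1
          · subst h2
            simpa using hRel _ _ hlt (hL _ _ hij hj)
          · rw [swapAt_left, swapAt_of_ne _ _ (by omega) h2]
            exact hL _ _ (by omega) hj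
        by_cases h2 : i = r + 1
        · subst h2
          rw [swapAt_right, swapAt_of_ne _ _ (by omega) (by omega)]
          exact hL _ _ (by omega) hj
        rw [swapAt_of_ne _ _ h1 h2]
        by_cases h3 : j = r
        · subst h3; rw [swapAt_left]; exact hL _ _ (by omega) hr
        by_cases h4 : j = r + 1
        · subst h4; rw [swapAt_right]; exact hL _ _ (by omega) (by omega)
        rw [swapAt_of_ne _ _ h3 h4]
        exact hL _ _ hij hj
    · push Not at hs
      refine base L hL fun i j hij => ?_
      induction j, hij using Nat.le_induction with
      | base => exact fun _ => le_rfl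
      | succ j hj ih' => exact fun h => (ih' (by omega)).trans (hs j h)

end Swap

/-! ### Adapted flags -/

section Adapted

variable {Λ : Type*} [Lattice Λ] [IsModularLattice Λ]

/-- `F` jumps on `X / B` exactly at the step from `l` to `l + 1`. -/
def JumpsAt (F : ℕ → Λ) (l : ℕ) (B X : Λ) : Prop :=
  ∀ j, (l < j → X ≤ B ⊔ F j) ∧ (j ≤ l → X ⊓ F j ≤ B)

variable {F : ℕ → Λ} {a b : ℕ} {B X Y U : Λ}

lemma JumpsAt.swap_back (hab : b < a) (hXY : X ≤ Y) (hinf : X ⊓ U = B)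
    (hsup : X ⊔ U = Y) (h1 : JumpsAt F b B U) (h2 : JumpsAt F a U Y) :
    JumpsAt F a B X ∧ JumpsAt F b X Y := by
  have hBX : B ≤ X := hinf ▸ inf_le_left
  have hfull : ∀ j, b < j → Y ≤ X ⊔ F j := fun j hj => by
    rw [← hsup]
    exact sup_le le_sup_left (((h1 j).1 hj).trans (sup_le_sup_right hBX _))
  refine ⟨fun j => ⟨fun hj => ?_, fun hj => ?_⟩, fun j => ⟨hfull j, fun hj => ?_⟩⟩
  · exact hXY.trans (((h2 j).1 hj).trans (sup_le ((h1 j).1 (hab.trans hj)) le_sup_right))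
  · rw [← hinf]
    exact le_inf inf_le_left ((inf_le_inf_right _ hXY).trans ((h2 j).2 hj))
  · have : Y ⊓ F j ≤ U := (h2 j).2 (hj.trans hab.le)
    exact (le_inf this inf_le_right).trans (((h1 j).2 hj).trans hBX)

/-- Since b < a, the part of Y on which F jumps early is what F (b + 1) contributes. Between b + 1
and a nothing new appears in Y modulo B, so B + Y ∩ F (b + 1) is a complement of X with the two
jumps in the opposite order. -/
lemma JumpsAt.swap_exists (hF : Monotone F) (hab : b < a) (hBX : B ≤ X) (hXY : X ≤ Y)
    (h1 : JumpsAt F a B X) (h2 : JumpsAt F b X Y) :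
    X ⊓ (B ⊔ Y ⊓ F (b + 1)) = B ∧ X ⊔ (B ⊔ Y ⊓ F (b + 1)) = Y ∧
      JumpsAt F b B (B ⊔ Y ⊓ F (b + 1)) ∧ JumpsAt F a (B ⊔ Y ⊓ F (b + 1)) Y := by
  have hsup : X ⊔ (B ⊔ Y ⊓ F (b + 1)) = Y := by
    rw [← sup_assoc, sup_eq_left.2 hBX, inf_comm, ← sup_inf_assoc_of_le _ hXY]
    exact inf_eq_right.2 ((h2 _).1 (Nat.lt_succ_self b))
  have hnull : ∀ j, b + 1 ≤ j → j ≤ a → Y ⊓ F j ≤ B ⊔ Y ⊓ F (b + 1) := by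
    intro j hj hja
    have h3 : Y ⊓ F j ≤ (Y ⊓ F (b + 1) ⊔ X) ⊓ F j := by
      refine le_inf ?_ inf_le_right
      refine inf_le_left.trans ?_
      nth_rw 1 [← hsup]
      exact sup_le le_sup_right (sup_le (hBX.trans le_sup_right) le_sup_left)
    rw [sup_inf_assoc_of_le _ (inf_le_right.trans (hF hj) : Y ⊓ F (b + 1) ≤ F j)] at h3
    exact h3.trans (sup_le le_sup_right (((h1 j).2 hja).trans le_sup_left))
  refine ⟨?_, hsup, fun j => ⟨fun hj => ?_, fun hj => ?_⟩, fun j => ⟨fun hj => ?_, fun hj => ?_⟩⟩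
  · rw [inf_comm, sup_inf_assoc_of_le _ hBX]
    refine sup_eq_left.2 (le_trans ?_ ((h1 (b + 1)).2 hab))
    exact le_inf inf_le_right (inf_le_left.trans inf_le_right)
  · exact sup_le_sup_left (inf_le_right.trans (hF hj)) _
  · have h4 : (B ⊔ Y ⊓ F (b + 1)) ⊓ F j ≤ Y ⊓ F j :=
      inf_le_inf_right _ (sup_le (hBX.trans hXY) inf_le_left)
    have h5 : Y ⊓ F j ≤ X := (h2 j).2 hj
    exact h4.trans ((le_inf h5 inf_le_right).trans ((h1 j).2 (by omega)))
  · nth_rw 1 [← hsup]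
    refine sup_le (((h1 j).1 hj).trans (sup_le_sup_right le_sup_left _)) le_sup_left
  · by_cases hjb : b + 1 ≤ j
    · exact hnull j hjb hj
    · exact (inf_le_inf_left _ (hF (by omega))).trans le_sup_right

/-- A jump at b forces U to lie in B + Y ∩ F (b + 1). Both are complements of X in the same
interval, so by modularity they are equal. -/
lemma JumpsAt.swap_unique (hBX : B ≤ X) (hXY : X ≤ Y) (hUY : U ≤ Y) (hinf : X ⊓ U = B) (hsup : X ⊔ U = Y)
    (h : JumpsAt F b B U) (hinf' : X ⊓ (B ⊔ Y ⊓ F (b + 1)) = B) : U = B ⊔ Y ⊓ F (b + 1) := by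
  have hle : U ≤ B ⊔ Y ⊓ F (b + 1) := by
    rw [inf_comm, ← sup_inf_assoc_of_le _ (hBX.trans hXY)]
    exact le_inf ((h _).1 (Nat.lt_succ_self b)) hUY
  refine le_antisymm hle ?_
  have h1 : B ⊔ Y ⊓ F (b + 1) ≤ (U ⊔ X) ⊓ (B ⊔ Y ⊓ F (b + 1)) := by
    refine le_inf ?_ le_rfl
    rw [sup_comm U X, hsup]
    exact sup_le (hBX.trans hXY) inf_le_left
  rw [sup_inf_assoc_of_le _ hle, hinf'] at h1
  exact h1.trans (sup_le le_rfl (hinf ▸ inf_le_right))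

end Adapted

section FlagSeq

variable {K : Type} [Field K] {n : ℕ} {V : Type} [AddCommGroup V] [Module K V]

/-- A flag as a sequence of subspaces. -/
def Flag.seq (F : Flag K n V) (i : ℕ) : Submodule K V :=
  if h : i < n + 1 then F.sub ⟨i, h⟩ else ⊤

lemma Flag.seq_of_lt (F : Flag K n V) {i : ℕ} (h : i < n + 1) : F.seq i = F.sub ⟨i, h⟩ := dif_pos h

lemma Flag.seq_mono (F : Flag K n V) : Monotone F.seq := by
  intro i j hij
  unfold Flag.seq
  split_ifs with h1 h2
  · exact F.mono hij
  · exact le_top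
  · omega
  · exact le_rfl

lemma Flag.seq_zero (F : Flag K n V) : F.seq 0 = ⊥ := by
  rw [F.seq_of_lt (Nat.succ_pos n)]; exact F.first

lemma Flag.seq_last (F : Flag K n V) : F.seq n = ⊤ := by
  rw [F.seq_of_lt (Nat.lt_succ_self n)]; exact F.last

lemma Flag.seq_of_le (F : Flag K n V) {i : ℕ} (h : n ≤ i) : F.seq i = ⊤ :=
  top_le_iff.1 (F.seq_last ▸ F.seq_mono h)

/-- The flag with the given steps. -/
def Flag.ofSeq (f : ℕ → Submodule K V) (h0 : f 0 = ⊥) (hn : f n = ⊤)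
    (hf : ∀ i j, i ≤ j → j ≤ n → f i ≤ f j) : Flag K n V where
  sub i := f i
  mono _ j hij := hf _ _ hij (Nat.lt_succ_iff.1 j.2)
  first := h0
  last := hn

lemma Flag.ofSeq_seq (f : ℕ → Submodule K V) (h0 hn hf) {i : ℕ} (hi : i ≤ n) :
    (Flag.ofSeq (n := n) f h0 hn hf).seq i = f i := by
  rw [Flag.seq_of_lt _ (Nat.lt_succ_iff.2 hi)]; rfl

lemma Flag.ext_seq {F G : Flag K n V} (h : ∀ i ≤ n, F.seq i = G.seq i) : F = G := by
  apply Flag.ext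
  funext i
  have := h i (Nat.lt_succ_iff.1 i.2)
  rwa [F.seq_of_lt i.2, G.seq_of_lt i.2] at this

end FlagSeq

end Mirabolic

/-! ### Exchanging two neighbouring steps of a chain -/

namespace Mirabolic

open Module

variable {n : ℕ}

/-- Functions of a flag and a vector. -/
abbrev FlagFun (n : ℕ) : Type 1 := (c : FiltSpace n) → ℕ → Flag c.K n c.V → c.V → ℚ

/-- The value of `Φ` is a tame function of `q` and `p` when the relative position is
`(ρ i j + p min(i, j), m i)`. -/
def FTame (𝓕 : Filter ℕ) (Φ : FlagFun n) : Prop :=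
  ∀ (ρ : ℕ → ℕ → ℤ) (m : ℕ → ℕ), ∃ φ, Tm φ ∧ ∀ᶠ p : ℕ in 𝓕, ∀ (c : FiltSpace n) F w,
    (∀ i ≤ n, HasType c.E w (F.seq i) (fun j => ρ i j + p * (min i j : ℕ)) (m i)) →
      Φ c p F w = φ c.q p

/-- The flags jumping on the `r`-th step of `g` at the column of `L r`. -/
def adapted {K V : Type} [Field K] [AddCommGroup V] [Module K V] (N : ℕ) (L : ℕ → Fin n × Fin n)
    (g : ℕ → Submodule K V) : Set (Flag K n V) :=
  {F | ∀ r < N, JumpsAt F.seq (L r).2 (g r) (g (r + 1))}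

/-- `g` is a chain (on `D`) with step `r` of dimension `δ (L r)`. -/
def chainDom (N : ℕ) (δ : ℕ → Fin n × Fin n → ℕ) (D : Finset ℕ) (L : ℕ → Fin n × Fin n) : SeqPred n :=
  fun c p g => (∀ i ∈ D, ∀ j ∈ D, i ≤ j → g i ≤ g j) ∧
    (∀ i ∈ D, finrank c.K (g i) = ∑ r ∈ Finset.range i, δ p (L r)) ∧ g N = ⊤

/-- The number of diagonal cells among `L 0, …, L (i - 1)` in the first `j` rows. -/
def diagPat (L : ℕ → Fin n × Fin n) (i j : ℕ) : ℤ :=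
  ∑ r ∈ Finset.range i, if (L r).1 = (L r).2 ∧ ((L r).1 : ℕ) < j then 1 else 0

/-- Complements of `X` between `B` and `Y`. -/
def complIn {Λ : Type*} [Lattice Λ] (B X Y : Λ) : Set Λ := {U | X ⊓ U = B ∧ X ⊔ U = Y}

section

variable {K V : Type} [Field K] [AddCommGroup V] [Module K V] {N : ℕ} {L : ℕ → Fin n × Fin n}
  {g : ℕ → Submodule K V} {r : ℕ}

lemma adapted_of_swapAt (hr : r + 1 < N) (hlt : (L (r + 1)).2 < (L r).2)
    (hXY : g (r + 1) ≤ g (r + 2)) {U : Submodule K V}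
    (hU : U ∈ complIn (g r) (g (r + 1)) (g (r + 2))) {F : Flag K n V}
    (hF : F ∈ adapted N (swapAt L r) (Function.update g (r + 1) U)) : F ∈ adapted N L g := by
  have h1 := hF r (by omega)
  have h2 := hF (r + 1) hr
  rw [swapAt_left, Function.update_self, Function.update_of_ne (by omega)] at h1
  rw [swapAt_right, Function.update_self, Function.update_of_ne (by omega)] at h2
  have h3 := JumpsAt.swap_back (Fin.lt_def.1 hlt) hXY hU.1 hU.2 h1 h2
  intro i hi
  by_cases hir : i = r
  · subst hir; exact h3.1
  by_cases hir1 : i = r + 1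
  · subst hir1; exact h3.2
  have := hF i hi
  rwa [swapAt_of_ne _ _ hir hir1, Function.update_of_ne (by omega), Function.update_of_ne (by omega)] at this

lemma existsUnique_adapted_swapAt (hr : r + 1 < N) (hlt : (L (r + 1)).2 < (L r).2)
    (hBX : g r ≤ g (r + 1)) (hXY : g (r + 1) ≤ g (r + 2)) {F : Flag K n V} (hF : F ∈ adapted N L g) :
    ∃ U₀, {U ∈ complIn (g r) (g (r + 1)) (g (r + 2)) |
      F ∈ adapted N (swapAt L r) (Function.update g (r + 1) U)} = {U₀} := by
  have h := JumpsAt.swap_exists F.seq_mono (Fin.lt_def.1 hlt) hBX hXY (hF r (by omega)) (hF (r + 1) hr)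
  refine ⟨g r ⊔ g (r + 2) ⊓ F.seq ((L (r + 1)).2 + 1), ?_⟩
  ext U
  rw [Set.mem_singleton_iff]
  constructor
  · rintro ⟨hU, hFU⟩
    have h1 := hFU r (by omega)
    rw [swapAt_left, Function.update_self, Function.update_of_ne (by omega)] at h1
    exact JumpsAt.swap_unique hBX hXY (hU.2 ▸ le_sup_right) hU.1 hU.2 h1 h.1
  · rintro rfl
    refine ⟨⟨h.1, h.2.1⟩, fun i hi => ?_⟩
    by_cases hir : i = r
    · subst hir
      rw [swapAt_left, Function.update_self, Function.update_of_ne (by omega)]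
      exact h.2.2.1
    by_cases hir1 : i = r + 1
    · subst hir1
      rw [swapAt_right, Function.update_self, Function.update_of_ne (by omega)]
      exact h.2.2.2
    rw [swapAt_of_ne _ _ hir hir1, Function.update_of_ne (by omega), Function.update_of_ne (by omega)]
    exact hF i hi

/-- Each adapted flag determines exactly one complement for which it is adapted to the exchanged
chain, so a double sum may be reordered. The second summand `Z'` is allowed to depend on U because
subspaces attached to the chain have to be rewritten after the exchange. -/
lemma fsum_adapted_swapAt [Finite V] (hr : r + 1 < N) (hlt : (L (r + 1)).2 < (L r).2)
    (hBX : g r ≤ g (r + 1)) (hXY : g (r + 1) ≤ g (r + 2)) (Z : Flag K n V → ℚ)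
    (Z' : Submodule K V → Flag K n V → ℚ)
    (hZ : ∀ U ∈ complIn (g r) (g (r + 1)) (g (r + 2)),
      ∀ F ∈ adapted N (swapAt L r) (Function.update g (r + 1) U), Z F = Z' U F) :
    fsum (adapted N L g) Z = fsum (complIn (g r) (g (r + 1)) (g (r + 2))) fun U =>
      fsum (adapted N (swapAt L r) (Function.update g (r + 1) U)) (Z' U) := by
  rw [fsum_comm _ _ (adapted N L g) (fun F => {U ∈ complIn (g r) (g (r + 1)) (g (r + 2)) |
      F ∈ adapted N (swapAt L r) (Function.update g (r + 1) U)})]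
  · refine fsum_congr rfl fun F hF => ?_
    obtain ⟨U₀, hU₀⟩ := existsUnique_adapted_swapAt hr hlt hBX hXY hF
    have : U₀ ∈ ({U₀} : Set (Submodule K V)) := rfl
    rw [← hU₀] at this
    rw [hU₀, fsum_singleton]
    exact hZ _ this.1 _ this.2
  · intro U F
    exact ⟨fun h => ⟨adapted_of_swapAt hr hlt hXY h.1 h.2, h⟩, fun h => h.2⟩

/-- When X/B is a line, a complement of X is a hyperplane of Y over B that does not contain X;
`complIn_eq_lines` is the dual case. -/
lemma complIn_eq_hypers [Finite V] {B X Y : Submodule K V} (hBX : B ≤ X) (hXY : X ≤ Y)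
    (h : finrank K X = finrank K B + 1) : complIn B X Y = hypers B Y \ hypers X Y := by
  have : Module.Finite K V := Module.Finite.of_finite
  ext U
  constructor
  · rintro ⟨h1, h2⟩
    have h3 := Submodule.finrank_sup_add_finrank_inf_eq X U
    rw [h1, h2] at h3
    refine ⟨⟨h1 ▸ inf_le_right, h2 ▸ le_sup_right, by omega⟩, fun h4 => ?_⟩
    rw [inf_eq_left.2 h4.1] at h1
    rw [h1] at h
    omega
  · rintro ⟨h1, h2⟩
    have h3 : ¬ X ≤ U := fun h => h2 ⟨h, h1.2⟩
    refine ⟨?_, ?_⟩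
    · refine (Submodule.eq_of_le_of_finrank_le (le_inf hBX h1.1) ?_).symm
      have := Submodule.finrank_lt_finrank_of_lt (inf_lt_left.2 h3)
      omega
    · rw [sup_comm]; exact sup_eq_of_hyper h1 hXY h3

lemma complIn_eq_lines [Finite V] {B X Y : Submodule K V} (hBX : B ≤ X) (hXY : X ≤ Y)
    (h : finrank K Y = finrank K X + 1) : complIn B X Y = lines B Y \ lines B X := by
  have : Module.Finite K V := Module.Finite.of_finite
  ext U
  constructor
  · rintro ⟨h1, h2⟩
    have h3 := Submodule.finrank_sup_add_finrank_inf_eq X U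
    rw [h1, h2] at h3
    refine ⟨⟨h1 ▸ inf_le_right, h2 ▸ le_sup_right, by omega⟩, fun h4 => ?_⟩
    rw [sup_eq_left.2 h4.2.1] at h2
    rw [h2] at h
    omega
  · rintro ⟨h1, h2⟩
    have h3 : ¬ U ≤ X := fun h => h2 ⟨h1.1, h, h1.2.2⟩
    refine ⟨?_, ?_⟩
    · refine (Submodule.eq_of_le_of_finrank_le (le_inf hBX h1.1) ?_).symm
      have := Submodule.finrank_lt_finrank_of_lt (inf_lt_right.2 h3)
      have := h1.2.2
      omega
    · refine Submodule.eq_of_le_of_finrank_le (sup_le hXY h1.2.1) ?_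
      have := Submodule.finrank_lt_finrank_of_lt (left_lt_sup.2 h3)
      omega

end

section

variable {𝓕 : Filter ℕ} {N : ℕ} {δ : ℕ → Fin n × Fin n → ℕ} {L : ℕ → Fin n × Fin n} {r : ℕ}

lemma chainDom.update_swapAt {c : FiltSpace n} {p : ℕ} {g : ℕ → Submodule c.K c.V} (hr : r + 1 < N)
    (hg : chainDom N δ (Finset.range (N + 1)) L c p g) {U : Submodule c.K c.V}
    (h1 : g r ≤ U) (h2 : U ≤ g (r + 2)) (h3 : finrank c.K U = finrank c.K (g r) + δ p (L (r + 1))) :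
    chainDom N δ (Finset.range (N + 1)) (swapAt L r) c p (Function.update g (r + 1) U) := by
  obtain ⟨hm, hd, ht⟩ := hg
  refine ⟨fun i hi j hj hij => ?_, fun i hi => ?_, ?_⟩
  · by_cases h4 : i = r + 1
    · subst h4
      by_cases h5 : j = r + 1
      · subst h5; exact le_rfl
      · rw [Function.update_self, Function.update_of_ne h5]
        exact h2.trans (hm _ (Finset.mem_range.2 (by omega)) _ hj (by omega))
    · rw [Function.update_of_ne h4]
      by_cases h5 : j = r + 1
      · subst h5
        rw [Function.update_self]
        exact (hm _ hi _ (Finset.mem_range.2 (by omega)) (by omega)).trans h1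
      · rw [Function.update_of_ne h5]
        exact hm _ hi _ hj hij
  · by_cases h4 : i = r + 1
    · subst h4
      rw [Function.update_self, sum_swapAt_mid, h3, hd _ (Finset.mem_range.2 (by omega))]
    · rw [Function.update_of_ne h4, sum_swapAt _ _ _ h4, hd _ hi]
  · rw [Function.update_of_ne (by omega), ht]

/-- At least one of the two steps is off-diagonal, hence one-dimensional. If it is the upper step
the complements are lines over `g r`, and if it is the lower step they are hyperplanes of `g (r +
2)`. Either way the sum is a difference of two sums already known to be tame. -/
lemma Tame.complOp (hδ : ∀ p x, x.1 ≠ x.2 → δ p x = 1) (hr : r + 1 < N)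
    (hnd : ¬ ((L r).1 = (L r).2 ∧ (L (r + 1)).1 = (L (r + 1)).2)) {Φ : SeqFun n}
    (h : Tame 𝓕 (Finset.range (N + 1)) (chainDom N δ (Finset.range (N + 1)) (swapAt L r))
      (diagPat (swapAt L r)) Φ) :
    Tame 𝓕 (Finset.range (N + 1)) (chainDom N δ (Finset.range (N + 1)) L) (diagPat L)
      fun c p g w => fsum (complIn (g r) (g (r + 1)) (g (r + 2))) fun U =>
        Φ c p (Function.update g (r + 1) U) w := by
  have hmem : ∀ i ≤ N, i ∈ Finset.range (N + 1) := fun i hi => Finset.mem_range.2 (by omega)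
  have hins : insert (r + 1) (Finset.range (N + 1)) = Finset.range (N + 1) :=
    Finset.insert_eq_of_mem (hmem _ (by omega))
  have hpat : ∀ e : ℕ → ℤ, (e = fun j => diagPat L r j +
      if (L (r + 1)).1 = (L (r + 1)).2 ∧ ((L (r + 1)).1 : ℕ) < j then 1 else 0) →
      Function.update (diagPat L) (r + 1) e = diagPat (swapAt L r) := by
    rintro e rfl
    funext i j
    by_cases hi : i = r + 1
    · subst hi
      rw [Function.update_self]
      exact (sum_swapAt_mid L r
        (fun x : Fin n × Fin n => if x.1 = x.2 ∧ (x.1 : ℕ) < j then (1 : ℤ) else 0)).symm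
    · rw [Function.update_of_ne hi]
      exact (sum_swapAt L r
        (fun x : Fin n × Fin n => if x.1 = x.2 ∧ (x.1 : ℕ) < j then (1 : ℤ) else 0) hi).symm
  have hstep : ∀ c p g, chainDom N δ (Finset.range (N + 1)) L c p g →
      g r ≤ g (r + 1) ∧ g (r + 1) ≤ g (r + 2) ∧
      finrank c.K (g (r + 1)) = finrank c.K (g r) + δ p (L r) ∧
      finrank c.K (g (r + 2)) = finrank c.K (g r) + δ p (L r) + δ p (L (r + 1)) := by
    intro c p g hg
    refine ⟨hg.1 _ (hmem _ (by omega)) _ (hmem _ (by omega)) (by omega),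
      hg.1 _ (hmem _ (by omega)) _ (hmem _ (by omega)) (by omega), ?_, ?_⟩
    · rw [hg.2.1 _ (hmem _ (by omega)), hg.2.1 _ (hmem _ (by omega)), Finset.sum_range_succ]
    · rw [hg.2.1 _ (hmem _ (by omega)), hg.2.1 _ (hmem _ (by omega)), Finset.sum_range_succ,
        Finset.sum_range_succ]
  by_cases hx : (L r).1 = (L r).2
  · have hy : (L (r + 1)).1 ≠ (L (r + 1)).2 := fun hy => hnd ⟨hx, hy⟩
    have h' := h
    rw [← hpat (diagPat L r) (by simp [hy]), ← hins] at h'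
    have t1 := Tame.lineOp (D := Finset.range (N + 1)) (Dom := chainDom N δ (Finset.range (N + 1)) L)
      (b := r) (y := r + 2) (r := r + 1) (hmem _ (by omega)) (hmem _ (by omega)) h' (by
        refine Filter.Eventually.of_forall fun p c g hg => ?_
        obtain ⟨h1, h2, h3, h4⟩ := hstep c p g hg
        refine ⟨h1.trans h2, fun U hU => ?_⟩
        rw [hins]
        exact hg.update_swapAt hr hU.1 hU.2.1 (by rw [hU.2.2, hδ _ _ hy]))
    have t2 := Tame.lineOp (D := Finset.range (N + 1)) (Dom := chainDom N δ (Finset.range (N + 1)) L)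
      (b := r) (y := r + 1) (r := r + 1) (hmem _ (by omega)) (hmem _ (by omega)) h' (by
        refine Filter.Eventually.of_forall fun p c g hg => ?_
        obtain ⟨h1, h2, h3, h4⟩ := hstep c p g hg
        refine ⟨h1, fun U hU => ?_⟩
        rw [hins]
        exact hg.update_swapAt hr hU.1 (hU.2.1.trans h2) (by rw [hU.2.2, hδ _ _ hy]))
    refine (t1.sub t2).congr (Filter.Eventually.of_forall fun p c g w hg => ?_)
    obtain ⟨h1, h2, h3, h4⟩ := hstep c p g hg
    rw [complIn_eq_lines h1 h2 (by rw [h4, h3, hδ _ _ hy]), fsum_diff]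
    · rfl
    · exact fun U hU => ⟨hU.1, hU.2.1.trans h2, hU.2.2⟩
  · have h' := h
    rw [← hpat (diagPat L (r + 2)) (by
      funext j
      rw [diagPat, Finset.sum_range_succ, Finset.sum_range_succ, if_neg (fun h => hx h.1), add_zero]
      rfl), ← hins] at h'
    have t1 := Tame.hyperOp (D := Finset.range (N + 1)) (Dom := chainDom N δ (Finset.range (N + 1)) L)
      (b := r) (y := r + 2) (r := r + 1) (hmem _ (by omega)) (hmem _ (by omega)) h' (by
        refine Filter.Eventually.of_forall fun p c g hg => ?_
        obtain ⟨h1, h2, h3, h4⟩ := hstep c p g hg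
        refine ⟨h1.trans h2, fun U hU => ?_⟩
        rw [hins]
        refine hg.update_swapAt hr hU.1 hU.2.1 ?_
        have := hU.2.2
        rw [hδ _ _ hx] at h4
        omega)
    have t2 := Tame.hyperOp (D := Finset.range (N + 1)) (Dom := chainDom N δ (Finset.range (N + 1)) L)
      (b := r + 1) (y := r + 2) (r := r + 1) (hmem _ (by omega)) (hmem _ (by omega)) h' (by
        refine Filter.Eventually.of_forall fun p c g hg => ?_
        obtain ⟨h1, h2, h3, h4⟩ := hstep c p g hg
        refine ⟨h2, fun U hU => ?_⟩
        rw [hins]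
        refine hg.update_swapAt hr (h1.trans hU.1) hU.2.1 ?_
        have := hU.2.2
        rw [hδ _ _ hx] at h4
        omega)
    refine (t1.sub t2).congr (Filter.Eventually.of_forall fun p c g w hg => ?_)
    obtain ⟨h1, h2, h3, h4⟩ := hstep c p g hg
    rw [complIn_eq_hypers h1 h2 (by rw [h3, hδ _ _ hx]), fsum_diff]
    · rfl
    · exact fun U hU => ⟨h1.trans hU.1, hU.2⟩

end

end Mirabolic

/-! ### Sums over the flags adapted to a fully refined chain -/

namespace Mirabolic

open Module

variable {n : ℕ}

/-- The number of `s < N` with `κ s < j`. -/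
def cut (N : ℕ) (κ : ℕ → ℕ) (j : ℕ) : ℕ := ((Finset.range N).filter fun s => κ s < j).card

lemma cut_le (N : ℕ) (κ : ℕ → ℕ) (j : ℕ) : cut N κ j ≤ N :=
  (Finset.card_filter_le _ _).trans (Finset.card_range N).le

lemma cut_mono (N : ℕ) (κ : ℕ → ℕ) : Monotone (cut N κ) := fun _ _ h =>
  Finset.card_le_card fun s hs => by
    rw [Finset.mem_filter] at hs ⊢
    exact ⟨hs.1, hs.2.trans_le h⟩

lemma cut_eq_self {N : ℕ} {κ : ℕ → ℕ} {j : ℕ} (h : ∀ s < N, κ s < j) : cut N κ j = N := by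
  rw [cut, Finset.filter_true_of_mem fun s hs => h s (Finset.mem_range.1 hs), Finset.card_range]

lemma cut_zero (N : ℕ) (κ : ℕ → ℕ) : cut N κ 0 = 0 := by simp [cut]

lemma lt_cut_iff {N : ℕ} {κ : ℕ → ℕ} (hκ : ∀ i j, i ≤ j → j < N → κ i ≤ κ j) {r : ℕ} (hr : r < N)
    (j : ℕ) : r < cut N κ j ↔ κ r < j := by
  constructor
  · intro h
    by_contra hj
    have : (Finset.range N).filter (fun s => κ s < j) ⊆ Finset.range r := fun s hs => by
      rw [Finset.mem_filter, Finset.mem_range] at hs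
      rw [Finset.mem_range]
      by_contra hsr
      have := hκ r s (by omega) hs.1
      omega
    have := Finset.card_le_card this
    rw [Finset.card_range] at this
    exact absurd h (not_lt.2 this)
  · intro h
    have : Finset.range (r + 1) ⊆ (Finset.range N).filter (fun s => κ s < j) := fun s hs => by
      rw [Finset.mem_range] at hs
      rw [Finset.mem_filter, Finset.mem_range]
      exact ⟨by omega, (hκ s r (by omega) hr).trans_lt h⟩
    have := Finset.card_le_card this
    rw [Finset.card_range] at this
    exact this

lemma sum_range_cut {N : ℕ} {κ : ℕ → ℕ} (hκ : ∀ i j, i ≤ j → j < N → κ i ≤ κ j) (j : ℕ)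
    {M : Type*} [AddCommMonoid M] (f : ℕ → M) :
    ∑ r ∈ Finset.range (cut N κ j), f r = ∑ r ∈ Finset.range N, if κ r < j then f r else 0 := by
  rw [← Finset.sum_filter]
  congr 1
  ext r
  rw [Finset.mem_filter, Finset.mem_range, Finset.mem_range]
  constructor
  · intro h
    have := h.trans_le (cut_le N κ j)
    exact ⟨this, (lt_cut_iff hκ this j).1 h⟩
  · exact fun h => (lt_cut_iff hκ h.1 j).2 h.2

/-- Every diagonal cell occurs exactly once among `L 0, …, L (N - 1)`. -/
def DiagOnce (N : ℕ) (L : ℕ → Fin n × Fin n) : Prop :=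
  ∀ f : Fin n → ℤ, ∑ r ∈ Finset.range N, (if (L r).1 = (L r).2 then f (L r).1 else 0) = ∑ a, f a

lemma DiagOnce.swapAt {N : ℕ} {L : ℕ → Fin n × Fin n} (h : DiagOnce N L) {r : ℕ} (hr : r + 1 < N) :
    DiagOnce N (swapAt L r) := fun f => by
  rw [← h f]
  exact sum_swapAt L r (fun x : Fin n × Fin n => if x.1 = x.2 then f x.1 else 0) (by omega)

lemma card_fin_lt (i : ℕ) (hi : i ≤ n) (j : ℕ) :
    ∑ a : Fin n, (if (a : ℕ) < i ∧ (a : ℕ) < j then (1 : ℤ) else 0) = (min i j : ℕ) := by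
  rw [Fin.sum_univ_eq_sum_range (fun a => if a < i ∧ a < j then (1 : ℤ) else 0) n, ← Finset.sum_filter,
    Finset.sum_const, nsmul_eq_mul, mul_one]
  have : (Finset.range n).filter (fun a => a < i ∧ a < j) = Finset.range (min i j) := by
    ext a; simp; omega
  rw [this, Finset.card_range]

/-- A flag cut out of a chain sorted by rows or by columns contains in its i-th member just the
first i diagonal steps. Its dimensions therefore grow with p like p min(i, j), which is the pattern
built into `FTame`. -/
lemma diagPat_cut {N : ℕ} {L : ℕ → Fin n × Fin n} (hL : DiagOnce N L) (κ : Fin n × Fin n → Fin n)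
    (hκ : ∀ a, κ (a, a) = a) (hmono : ∀ i j, i ≤ j → j < N → ((κ (L i) : Fin n) : ℕ) ≤ κ (L j))
    {i : ℕ} (hi : i ≤ n) (j : ℕ) :
    diagPat L (cut N (fun r => κ (L r)) i) j = (min i j : ℕ) := by
  rw [diagPat, sum_range_cut hmono, ← card_fin_lt i hi j, ← hL]
  refine Finset.sum_congr rfl fun r _ => ?_
  by_cases h : (L r).1 = (L r).2
  · have : L r = ((L r).1, (L r).1) := Prod.ext rfl h.symm
    have hk : κ (L r) = (L r).1 := by rw [this, hκ]
    simp only [h, true_and, ← ite_and]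
    rw [← h, ← hk]
  · simp [h]

/-- The sum over the adapted flags. -/
def flagSum (N : ℕ) (L : ℕ → Fin n × Fin n) (Φ : FlagFun n) : SeqFun n := fun c p g w =>
  fsum (adapted N L g) fun F => Φ c p F w

/-- The sum of the `g (r + 1) ⊓ F (col + 1)` over the cells `L r` in `I`. -/
def idealSpan {K V : Type} [Field K] [AddCommGroup V] [Module K V] (N : ℕ) (L : ℕ → Fin n × Fin n)
    (I : Set (Fin n × Fin n)) (g : ℕ → Submodule K V) (F : Flag K n V) : Submodule K V :=
  ⨆ r, ⨆ _ : r < N ∧ L r ∈ I, g (r + 1) ⊓ F.seq ((L r).2 + 1)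

/-- The sum over the adapted flags and the translates by the vectors in `idealSpan`. -/
def flagSumI (N : ℕ) (L : ℕ → Fin n × Fin n) (I : Set (Fin n × Fin n)) (Φ : FlagFun n) : SeqFun n :=
  fun c p g w => fsum (adapted N L g) fun F =>
    fsum (idealSpan N L I g F : Set c.V) fun μ => Φ c p F (w - μ)

section

variable {𝓕 : Filter ℕ} {N : ℕ} {δ : ℕ → Fin n × Fin n → ℕ} {L : ℕ → Fin n × Fin n}
  {Φ : FlagFun n}

lemma chainDom.zero {D : Finset ℕ} (h0 : 0 ∈ D) {c : FiltSpace n} {p : ℕ} {g : ℕ → Submodule c.K c.V}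
    (hg : chainDom N δ D L c p g) : g 0 = ⊥ := by
  have : Module.Finite c.K c.V := Module.Finite.of_finite
  rw [← Submodule.finrank_eq_zero (R := c.K), hg.2.1 0 h0, Finset.sum_range_zero]

/-- If the columns increase along the chain, the i-th member of an adapted flag contains every step
whose column is below i, and its intersections with the later members add nothing. It is thus the
member of the chain at the cut. -/
lemma adapted_eq_of_sorted {c : FiltSpace n} {g : ℕ → Submodule c.K c.V}
    (hs : ∀ i j, i ≤ j → j < N → ((L i).2 : ℕ) ≤ (L j).2) (h0 : g 0 = ⊥) (hN : g N = ⊤)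
    (hg : ∀ i j, i ≤ j → j ≤ N → g i ≤ g j) :
    ∃ F : Flag c.K n c.V, adapted N L g = {F} ∧ ∀ i ≤ n, F.seq i = g (cut N (fun r => (L r).2) i) := by
  have hn : cut N (fun r => ((L r).2 : ℕ)) n = N := cut_eq_self fun s _ => (L s).2.2
  let F : Flag c.K n c.V := Flag.ofSeq (fun i => g (cut N (fun r => (L r).2) i))
    (by rw [cut_zero, h0]) (by rw [hn, hN])
    (fun i j hij _ => hg _ _ (cut_mono N _ hij) (cut_le _ _ _))
  have hF : ∀ i ≤ n, F.seq i = g (cut N (fun r => (L r).2) i) := fun i hi => Flag.ofSeq_seq _ _ _ _ hi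
  refine ⟨F, ?_, hF⟩
  ext G
  rw [Set.mem_singleton_iff]
  constructor
  · intro hG
    refine Flag.ext_seq fun i hi => ?_
    rw [hF i hi]
    refine le_antisymm ?_ ?_
    · have : ∀ s, cut N (fun r => ((L r).2 : ℕ)) i ≤ s → s ≤ N →
          G.seq i ⊓ g s ≤ g (cut N (fun r => (L r).2) i) := by
        intro s hs1
        induction s, hs1 using Nat.le_induction with
        | base => exact fun _ => inf_le_right
        | succ s hs1 ih =>
          intro hs2
          refine le_trans (le_inf inf_le_left ?_) (ih (by omega))
          rw [inf_comm]
          refine ((hG s (by omega)) i).2 ?_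
          by_contra h
          have := (lt_cut_iff hs (by omega : s < N) i).2 (not_le.1 h)
          omega
      have := this N (cut_le _ _ _) le_rfl
      rwa [hN, inf_top_eq] at this
    · have : ∀ s, s ≤ cut N (fun r => ((L r).2 : ℕ)) i → g s ≤ G.seq i := by
        intro s
        induction s with
        | zero => intro _; rw [h0]; exact bot_le
        | succ s ih =>
          intro h
          have hsN : s < N := by have := cut_le N (fun r => ((L r).2 : ℕ)) i; omega
          exact (((hG s hsN) i).1 ((lt_cut_iff hs hsN i).1 h)).trans (sup_le (ih (by omega)) le_rfl)
      exact this _ le_rfl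
  · rintro rfl r hr j
    by_cases hj : j ≤ n
    · rw [hF j hj]
      refine ⟨fun h => ?_, fun h => ?_⟩
      · exact (hg _ _ ((lt_cut_iff hs hr j).2 h) (cut_le _ _ _)).trans le_sup_right
      · refine inf_le_right.trans (hg _ _ ?_ hr.le)
        by_contra h'
        have := (lt_cut_iff hs hr j).1 (not_le.1 h')
        omega
    · rw [Flag.seq_of_le _ (by omega)]
      refine ⟨fun _ => by rw [sup_top_eq]; exact le_top, fun h => ?_⟩
      have := (L r).2.2
      omega

/-- Sorting by columns reduces to the case of a single adapted flag, where tameness of Φ applies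
directly. Diagonal cells are in increasing order from the start and remain so, which guarantees that
a descent never consists of two diagonal cells. -/
lemma FTame.flagSum (hΦ : FTame 𝓕 Φ) (hδ : ∀ p x, x.1 ≠ x.2 → δ p x = 1) (hL : DiagOnce N L)
    (hd : ∀ i j, i < j → j < N → (L i).1 = (L i).2 → (L j).1 = (L j).2 → (L i).2 ≤ (L j).2) :
    Tame 𝓕 (Finset.range (N + 1)) (chainDom N δ (Finset.range (N + 1)) L) (diagPat L)
      (flagSum N L Φ) := by
  refine bubble_sort (N := N) (fun x : Fin n × Fin n => (x.2 : ℕ))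
    (fun x y => x.1 = x.2 → y.1 = y.2 → x.2 ≤ y.2) (fun x y h _ _ _ => le_of_lt h)
    (fun L => DiagOnce N L → Tame 𝓕 (Finset.range (N + 1)) (chainDom N δ (Finset.range (N + 1)) L)
      (diagPat L) (Mirabolic.flagSum N L Φ)) ?_ ?_ L hd hL
  · intro L _ hs hL ρ m
    obtain ⟨φ, h1, h2⟩ := hΦ (fun i => ρ (cut N (fun r => (L r).2) i))
      (fun i => m (cut N (fun r => (L r).2) i))
    refine ⟨φ, h1, ?_⟩
    filter_upwards [h2] with p h2 c g w hg ht
    obtain ⟨F, hF1, hF2⟩ := adapted_eq_of_sorted (c := c) (g := g) hs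
      (hg.zero (Finset.mem_range.2 (by omega))) hg.2.2
      (fun i j hij hj => hg.1 _ (Finset.mem_range.2 (by omega)) _ (Finset.mem_range.2 (by omega)) hij)
    rw [Mirabolic.flagSum, hF1, fsum_singleton]
    refine h2 c F w fun i hi => ?_
    rw [hF2 i hi]
    have := ht (cut N (fun r => (L r).2) i) (Finset.mem_range.2 (Nat.lt_succ_of_le (cut_le _ _ _)))
    simpa only [diagPat_cut hL (fun x => x.2) (fun _ => rfl) hs hi] using this
  · intro L r hr hlt hrel ih hL
    have hnd : ¬ ((L r).1 = (L r).2 ∧ (L (r + 1)).1 = (L (r + 1)).2) := fun h =>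
      absurd (Fin.le_def.1 (hrel h.1 h.2)) (not_le.2 hlt)
    refine (Tame.complOp hδ hr hnd (ih (hL.swapAt hr))).congr
      (Filter.Eventually.of_forall fun p c g w hg => ?_)
    exact fsum_adapted_swapAt hr (Fin.lt_def.2 hlt)
      (hg.1 _ (Finset.mem_range.2 (by omega)) _ (Finset.mem_range.2 (by omega)) (by omega))
      (hg.1 _ (Finset.mem_range.2 (by omega)) _ (Finset.mem_range.2 (by omega)) (by omega))
      _ _ fun U _ F _ => rfl

lemma idealSpan_of_sorted {K V : Type} [Field K] [AddCommGroup V] [Module K V]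
    {I : Set (Fin n × Fin n)} {g : ℕ → Submodule K V} {F : Flag K n V} (hF : F ∈ adapted N L g)
    (h0 : g 0 = ⊥) (hg : ∀ i j, i ≤ j → j ≤ N → g i ≤ g j) {s : ℕ} (hs : s ≤ N)
    (hI : ∀ r < N, L r ∈ I ↔ r < s) : idealSpan N L I g F = g s := by
  refine le_antisymm (iSup₂_le fun r hr => ?_) ?_
  · exact inf_le_left.trans (hg _ _ ((hI r hr.1).1 hr.2) hs)
  · have : ∀ t ≤ s, g t ≤ idealSpan N L I g F := by
      intro t
      induction t with
      | zero => intro _; rw [h0]; exact bot_le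
      | succ t ih =>
        intro ht
        have h1 := (hF t (by omega) _).1 (Nat.lt_succ_self _)
        have h2 : g (t + 1) ≤ g t ⊔ g (t + 1) ⊓ F.seq ((L t).2 + 1) := by
          rw [inf_comm, ← sup_inf_assoc_of_le _ (hg t (t + 1) (by omega) (by omega))]
          exact le_inf h1 le_rfl
        refine h2.trans (sup_le (ih (by omega)) ?_)
        exact le_iSup₂_of_le t ⟨by omega, (hI t (by omega)).2 (by omega)⟩ le_rfl
    exact this s le_rfl

/-- The cell leaving the front is not in I. For the cell moved forward, the late jump of F on Y/U
puts Y ∩ F (b + 1) inside U, so its contribution to the span is the same before and after the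
exchange. -/
lemma idealSpan_swapAt {K V : Type} [Field K] [AddCommGroup V] [Module K V]
    {I : Set (Fin n × Fin n)} {g : ℕ → Submodule K V} {F : Flag K n V} {r : ℕ} (hr : r + 1 < N)
    (hx : L r ∉ I) (hlt : (L (r + 1)).2 < (L r).2) {U : Submodule K V} (hU : U ≤ g (r + 2))
    (hF : F ∈ adapted N (swapAt L r) (Function.update g (r + 1) U)) :
    idealSpan N L I g F = idealSpan N (swapAt L r) I (Function.update g (r + 1) U) F := by
  have h2 := hF (r + 1) hr
  rw [swapAt_right, Function.update_self, Function.update_of_ne (by omega)] at h2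
  have h3 : g (r + 2) ⊓ F.seq ((L (r + 1)).2 + 1) ≤ U := (h2 _).2 (Fin.lt_def.1 hlt)
  refine le_antisymm (iSup₂_le fun i hi => ?_) (iSup₂_le fun i hi => ?_)
  · by_cases hir : i = r
    · subst hir; exact absurd hi.2 hx
    by_cases hir1 : i = r + 1
    · subst hir1
      refine le_iSup₂_of_le r ⟨by omega, by rw [swapAt_left]; exact hi.2⟩ ?_
      rw [swapAt_left, Function.update_self]
      exact le_inf h3 inf_le_right
    · refine le_iSup₂_of_le i ⟨hi.1, by rw [swapAt_of_ne _ _ hir hir1]; exact hi.2⟩ ?_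
      rw [swapAt_of_ne _ _ hir hir1, Function.update_of_ne (by omega)]
  · by_cases hir : i = r
    · subst hir
      rw [swapAt_left] at hi ⊢
      rw [Function.update_self]
      refine le_iSup₂_of_le (i + 1) ⟨hr, hi.2⟩ ?_
      exact inf_le_inf_right _ hU
    by_cases hir1 : i = r + 1
    · subst hir1
      rw [swapAt_right] at hi
      exact absurd hi.2 hx
    · rw [swapAt_of_ne _ _ hir hir1] at hi ⊢
      rw [Function.update_of_ne (by omega)]
      exact le_iSup₂_of_le i hi le_rfl

open Classical in
-- Here the cells of I are moved to the front. Once they form an initial segment of length s, the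
-- subspace of translations is `g s`, independent of the flag, and the two operations `flagSum` and
-- `shiftOp` can be performed separately.
lemma FTame.flagSumI (hΦ : FTame 𝓕 Φ) (hδ : ∀ p x, x.1 ≠ x.2 → δ p x = 1) (hL : DiagOnce N L)
    (I : Set (Fin n × Fin n))
    (hd : ∀ i j, i < j → j < N → (L i ∉ I → L j ∈ I → (L j).2 < (L i).2) ∧
      ((L i).1 = (L i).2 → (L j).1 = (L j).2 → (L i).2 ≤ (L j).2)) :
    Tame 𝓕 (Finset.range (N + 1)) (chainDom N δ (Finset.range (N + 1)) L) (diagPat L)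
      (flagSumI N L I Φ) := by
  refine bubble_sort (N := N) (fun x : Fin n × Fin n => if x ∈ I then 0 else 1)
    (fun x y => (x ∉ I → y ∈ I → y.2 < x.2) ∧ (x.1 = x.2 → y.1 = y.2 → x.2 ≤ y.2)) ?_
    (fun L => DiagOnce N L → Tame 𝓕 (Finset.range (N + 1)) (chainDom N δ (Finset.range (N + 1)) L)
      (diagPat L) (Mirabolic.flagSumI N L I Φ)) ?_ ?_ L hd hL
  · intro x y h h'
    have hx : x ∉ I := fun hx => by simp [hx] at h
    have hy : y ∈ I := by_contra fun hy => by simp [hy, hx] at h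
    exact ⟨fun hy' => absurd hy hy', fun _ _ => (h'.1 hx hy).le⟩
  · intro L hrel hs hL
    have h1 := FTame.flagSum (L := L) hΦ hδ hL (fun i j hij hj => (hrel i j hij hj).2)
    set s := cut N (fun r => if L r ∈ I then 0 else 1) 1 with hsdef
    have hI : ∀ r < N, L r ∈ I ↔ r < s := fun r hr => by
      rw [hsdef, lt_cut_iff hs hr]
      split_ifs with h <;> simp [h]
    have hmono : ∀ c p g, chainDom N δ (Finset.range (N + 1)) L c p g →
        g 0 = ⊥ ∧ ∀ i j, i ≤ j → j ≤ N → g i ≤ g j := fun c p g hg =>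
      ⟨hg.zero (Finset.mem_range.2 (by omega)), fun i j hij hj =>
        hg.1 _ (Finset.mem_range.2 (by omega)) _ (Finset.mem_range.2 (by omega)) hij⟩
    refine (h1.shiftOp hmono s (cut_le _ _ _)).congr (Filter.Eventually.of_forall fun p c g w hg => ?_)
    obtain ⟨h0, hm⟩ := hmono c p g hg
    rw [Mirabolic.flagSumI, shiftOp]
    unfold Mirabolic.flagSum
    rw [← fsum_comm (adapted N L g) (fun _ => (g s : Set c.V)) _ _
      (fun F μ => Φ c p F (w - μ)) (fun _ _ => and_comm)]
    refine fsum_congr rfl fun F hF => fsum_congr ?_ fun _ _ => rfl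
    rw [idealSpan_of_sorted hF h0 hm (cut_le _ _ _) hI]
  · intro L r hr hlt hrel ih hL
    have hx : L r ∉ I := fun hx => by simp [hx] at hlt
    have hy : L (r + 1) ∈ I := by_contra fun hy => by simp [hy, hx] at hlt
    have hlt2 := hrel.1 hx hy
    have hnd : ¬ ((L r).1 = (L r).2 ∧ (L (r + 1)).1 = (L (r + 1)).2) := fun h =>
      absurd (hrel.2 h.1 h.2) (not_le.2 hlt2)
    refine (Tame.complOp hδ hr hnd (ih (hL.swapAt hr))).congr
      (Filter.Eventually.of_forall fun p c g w hg => ?_)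
    refine fsum_adapted_swapAt hr hlt2
      (hg.1 _ (Finset.mem_range.2 (by omega)) _ (Finset.mem_range.2 (by omega)) (by omega))
      (hg.1 _ (Finset.mem_range.2 (by omega)) _ (Finset.mem_range.2 (by omega)) (by omega))
      _ _ fun U hU F hF => ?_
    rw [idealSpan_swapAt hr hx hlt2 (hU.2 ▸ le_sup_right) hF]

end

end Mirabolic

/-! ### From the fully refined chain back to a flag -/

namespace Mirabolic

open Module

variable {n : ℕ}

/-- `L 0, …, L (N - 1)` is in lexicographic order. -/
def LexSorted (N : ℕ) (L : ℕ → Fin n × Fin n) : Prop :=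
  ∀ i j, i ≤ j → j < N → (L i).1 < (L j).1 ∨ (L i).1 = (L j).1 ∧ (L i).2 ≤ (L j).2

lemma LexSorted.row_le {N : ℕ} {L : ℕ → Fin n × Fin n} (h : LexSorted N L) (i j : ℕ) (hij : i ≤ j)
    (hj : j < N) : ((L i).1 : ℕ) ≤ (L j).1 := by
  rcases h i j hij hj with h | h
  · exact h.le
  · exact h.1.le

lemma DiagOnce.ne_of_lt {N : ℕ} {L : ℕ → Fin n × Fin n} (h : DiagOnce N L) {i j : ℕ} (hij : i < j)
    (hj : j < N) (hd : (L i).1 = (L i).2) : L i ≠ L j := fun he => by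
  have h1 := h (fun a => if a = (L i).1 then 1 else 0)
  rw [Finset.sum_ite_eq' Finset.univ, if_pos (Finset.mem_univ _)] at h1
  have h2 : ∑ r ∈ ({i, j} : Finset ℕ), (if (L r).1 = (L r).2 then
      (if (L r).1 = (L i).1 then (1 : ℤ) else 0) else 0) ≤ 1 := by
    conv_rhs => rw [← h1]
    refine Finset.sum_le_sum_of_subset_of_nonneg (fun r hr => ?_) fun r _ _ => ?_
    swap
    · split_ifs <;> simp
    simp only [Finset.mem_insert, Finset.mem_singleton] at hr
    rw [Finset.mem_range]
    omega
  rw [Finset.sum_pair hij.ne, ← he] at h2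
  simp [hd] at h2

/-- The dimension of `g y ⊓ F j` for a flag `F` adapted to `g`. -/
def colCount (δ : ℕ → Fin n × Fin n → ℕ) (p : ℕ) (L : ℕ → Fin n × Fin n) (y j : ℕ) : ℕ :=
  ∑ s ∈ Finset.range y, if ((L s).2 : ℕ) < j then δ p (L s) else 0

/-- The flags in the prescribed position to the `g y`, `y ∈ D`. -/
def posSet {K V : Type} [Field K] [AddCommGroup V] [Module K V] (δ : ℕ → Fin n × Fin n → ℕ) (p : ℕ)
    (L : ℕ → Fin n × Fin n) (D : Finset ℕ) (g : ℕ → Submodule K V) : Set (Flag K n V) :=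
  {F | ∀ y ∈ D, ∀ j, finrank K ↥(g y ⊓ F.seq j) = colCount δ p L y j}

/-- The position at which the row `i` begins. -/
def rowCut (N : ℕ) (L : ℕ → Fin n × Fin n) (i : ℕ) : ℕ := cut N (fun r => (L r).1) i

/-- The positions at which rows begin or end. -/
def rowEnds (N : ℕ) (L : ℕ → Fin n × Fin n) : Finset ℕ := (Finset.range (n + 1)).image (rowCut N L)

/-- The sum of the intersections of members of two flags over the cells `L r` in `I`. -/
def rowSpan {K V : Type} [Field K] [AddCommGroup V] [Module K V] (N : ℕ) (L : ℕ → Fin n × Fin n)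
    (I : Set (Fin n × Fin n)) (g : ℕ → Submodule K V) (F : Flag K n V) : Submodule K V :=
  ⨆ r, ⨆ _ : r < N ∧ L r ∈ I, g (rowCut N L ((L r).1 + 1)) ⊓ F.seq ((L r).2 + 1)

/-- The sum over the flags in prescribed position and translates by the vectors in `rowSpan`. -/
def fillSum (N : ℕ) (L : ℕ → Fin n × Fin n) (δ : ℕ → Fin n × Fin n → ℕ) (D : Finset ℕ)
    (I : Set (Fin n × Fin n)) (Φ : FlagFun n) : SeqFun n :=
  fun c p g w => fsum (posSet δ p L D g) fun F =>
    fsum (rowSpan N L I g F : Set c.V) fun μ => Φ c p F (w - μ)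

section

variable {𝓕 : Filter ℕ} {N : ℕ} {δ : ℕ → Fin n × Fin n → ℕ} {L : ℕ → Fin n × Fin n}
  {Φ : FlagFun n} {D : Finset ℕ} {I : Set (Fin n × Fin n)}

lemma rowCut_mem {i : ℕ} (hi : i ≤ n) : rowCut N L i ∈ rowEnds N L :=
  Finset.mem_image_of_mem _ (Finset.mem_range.2 (by omega))

lemma zero_mem_rowEnds : 0 ∈ rowEnds N L := by
  have := rowCut_mem (N := N) (L := L) (Nat.zero_le n)
  rwa [rowCut, cut_zero] at this

lemma rowCut_last : rowCut N L n = N := cut_eq_self fun s _ => (L s).1.2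

lemma last_mem_rowEnds : N ∈ rowEnds N L := by
  have := rowCut_mem (N := N) (L := L) le_rfl
  rwa [rowCut_last] at this

section linalg

variable {K V : Type} [Field K] [AddCommGroup V] [Module K V] [Finite V] {g : ℕ → Submodule K V}
  {F : Flag K n V} {p : ℕ}

/-- On one step, containment Y ≤ B + F j means that the intersection with F j grows by the full
dimension of the step, and Y ∩ F j ≤ B means that it does not grow at all. -/
lemma adapted_iff_posSet (h0 : g 0 = ⊥) (hg : ∀ r < N, g r ≤ g (r + 1))
    (hd : ∀ r < N, finrank K (g (r + 1)) = finrank K (g r) + δ p (L r)) :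
    F ∈ adapted N L g ↔ F ∈ posSet δ p L (Finset.range (N + 1)) g := by
  have : Module.Finite K V := Module.Finite.of_finite
  have key : ∀ r j, r < N → ((finrank K ↥(g r ⊔ g (r + 1) ⊓ F.seq j) : ℤ) =
      finrank K (g r) + finrank K ↥(g (r + 1) ⊓ F.seq j) - finrank K ↥(g r ⊓ F.seq j)) :=
    fun r j hr => finrank_sup_inf (hg r hr) _
  constructor
  · intro hF y hy j
    rw [Finset.mem_range] at hy
    induction y with
    | zero => rw [h0, bot_inf_eq, finrank_bot]; rfl
    | succ y ih =>
      have ih := ih (by omega)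
      have hyN : y < N := by omega
      rw [colCount, Finset.sum_range_succ, ← colCount, ← ih]
      obtain ⟨h1, h2⟩ := hF y hyN j
      split_ifs with hj
      · have h3 : g y ⊔ g (y + 1) ⊓ F.seq j = g (y + 1) := by
          rw [inf_comm, ← sup_inf_assoc_of_le _ (hg y hyN)]
          exact inf_eq_right.2 (h1 hj)
        have h4 := key y j hyN
        rw [h3, hd y hyN] at h4
        push_cast at h4
        omega
      · rw [add_zero]
        rw [le_antisymm (le_inf (h2 (not_lt.1 hj)) inf_le_right) (inf_le_inf_right (F.seq j) (hg y hyN))]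
  · intro hF r hr j
    have h1 := hF r (Finset.mem_range.2 (by omega)) j
    have h2 := hF (r + 1) (Finset.mem_range.2 (by omega)) j
    rw [colCount, Finset.sum_range_succ, ← colCount, ← h1] at h2
    refine ⟨fun hj => ?_, fun hj => ?_⟩
    · rw [if_pos hj] at h2
      have h4 := key r j hr
      have h5 : g r ⊔ g (r + 1) ⊓ F.seq j = g (r + 1) := by
        refine Submodule.eq_of_le_of_finrank_eq (sup_le (hg r hr) inf_le_left) ?_
        have := hd r hr
        omega
      nth_rw 1 [← h5]
      exact sup_le_sup_left inf_le_right _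
    · rw [if_neg (not_lt.2 hj), add_zero] at h2
      have := Submodule.eq_of_le_of_finrank_eq (inf_le_inf_right (F.seq j) (hg r hr)) h2.symm
      rw [← this]
      exact inf_le_left

/-- Within a row the columns increase. Later steps of the row with a larger column do not enlarge
the intersection with F (col + 1), and later steps with the same column carry the same cell, hence
also belong to I. -/
lemma rowSpan_eq_idealSpan (hs : LexSorted N L) (hg : ∀ i j, i ≤ j → j ≤ N → g i ≤ g j)
    (hF : F ∈ adapted N L g) : rowSpan N L I g F = idealSpan N L I g F := by
  have hlt : ∀ r < N, ∀ i, r < rowCut N L i ↔ ((L r).1 : ℕ) < i := fun r hr i =>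
    lt_cut_iff hs.row_le hr i
  refine le_antisymm (iSup₂_le fun r hr => ?_) (iSup₂_le fun r hr => ?_)
  · have hr1 := (hlt r hr.1 ((L r).1 + 1)).2 (Nat.lt_succ_self _)
    have : ∀ t, r + 1 ≤ t → t ≤ rowCut N L ((L r).1 + 1) →
        g t ⊓ F.seq ((L r).2 + 1) ≤ idealSpan N L I g F := by
      intro t ht
      induction t, ht using Nat.le_induction with
      | base => exact fun _ => le_iSup₂_of_le r hr le_rfl
      | succ t ht ih =>
        intro ht'
        have htN : t < N := lt_of_lt_of_le ht' (cut_le _ _ _)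
        have hrow := (hlt t htN _).1 ht'
        rcases hs r t (by omega) htN with h | ⟨h, h'⟩
        · rw [Fin.lt_def] at h; omega
        · rcases h'.lt_or_eq with h' | h'
          · exact (le_inf (((hF t htN) _).2 h') inf_le_right).trans (ih (by omega))
          · have hLt : L r = L t := Prod.ext h h'
            rw [h']
            exact le_iSup₂_of_le t ⟨htN, hLt ▸ hr.2⟩ le_rfl
    exact this _ hr1 le_rfl
  · refine le_iSup₂_of_le r hr (inf_le_inf_right _ (hg _ _ ?_ (cut_le _ _ _)))
    exact (hlt r hr.1 _).2 (Nat.lt_succ_self _)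

/-- For a fixed flag F, this identifies the admissible first steps of a gap whose smallest column is
l. They form a full set of lines, so their number depends only on dimensions. `hypers_posSet` does
the same for the last step and the largest column. -/
lemma lines_posSet {l : ℕ} {B Y : Submodule K V} (hBY : B ≤ Y) {cb cy : ℕ → ℕ}
    (hb : ∀ j, finrank K ↥(B ⊓ F.seq j) = cb j) (hy : ∀ j, finrank K ↥(Y ⊓ F.seq j) = cy j)
    (hl : ∀ j ≤ l, cy j = cb j) :
    {U ∈ lines B Y | ∀ j, finrank K ↥(U ⊓ F.seq j) = cb j + if l < j then 1 else 0} =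
      lines B (B ⊔ Y ⊓ F.seq (l + 1)) := by
  have : Module.Finite K V := Module.Finite.of_finite
  ext U
  constructor
  · rintro ⟨hU, h⟩
    refine ⟨hU.1, ?_, hU.2.2⟩
    have h1 : ¬ U ⊓ F.seq (l + 1) ≤ B := fun h1 => by
      have h2 := Submodule.finrank_mono (le_inf h1 inf_le_right : _ ≤ B ⊓ F.seq (l + 1))
      rw [hb, h, if_pos (Nat.lt_succ_self l)] at h2
      omega
    rw [← sup_eq_of_line hU inf_le_left h1]
    exact sup_le_sup_left (inf_le_inf_right _ hU.2.1) _
  · intro hU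
    have hUY : U ≤ Y := hU.2.1.trans (sup_le hBY inf_le_left)
    refine ⟨⟨hU.1, hUY, hU.2.2⟩, fun j => ?_⟩
    split_ifs with hj
    · have h1 : U ≤ B ⊔ U ⊓ F.seq j := by
        rw [inf_comm, ← sup_inf_assoc_of_le _ hU.1]
        exact le_inf (hU.2.1.trans (sup_le_sup_left (inf_le_right.trans (F.seq_mono hj)) _)) le_rfl
      have h2 : B ⊔ U ⊓ F.seq j = U := le_antisymm (sup_le hU.1 inf_le_left) h1
      have h3 := finrank_sup_inf hU.1 (F.seq j)
      rw [h2, hb, hU.2.2] at h3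
      push_cast at h3
      omega
    · have h1 := Submodule.finrank_mono (inf_le_inf_right (F.seq j) hU.1)
      have h2 := Submodule.finrank_mono (inf_le_inf_right (F.seq j) hUY)
      rw [hb] at h1
      rw [hy, hl j (not_lt.1 hj)] at h2
      omega

lemma hypers_posSet {l : ℕ} {B Y : Submodule K V} (hBY : B ≤ Y) {cb cy : ℕ → ℕ}
    (hb : ∀ j, finrank K ↥(B ⊓ F.seq j) = cb j) (hy : ∀ j, finrank K ↥(Y ⊓ F.seq j) = cy j)
    (hl : ∀ j, l < j → (cy j : ℤ) - cb j = (finrank K Y : ℤ) - finrank K B) :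
    {U ∈ hypers B Y | ∀ j, finrank K ↥(U ⊓ F.seq j) + (if l < j then 1 else 0) = cy j} =
      hypers (B ⊔ Y ⊓ F.seq l) Y := by
  have : Module.Finite K V := Module.Finite.of_finite
  ext U
  constructor
  · rintro ⟨hU, h⟩
    refine ⟨sup_le hU.1 ?_, hU.2⟩
    have h1 := h l
    rw [if_neg (lt_irrefl l), add_zero, ← hy] at h1
    rw [← Submodule.eq_of_le_of_finrank_eq (inf_le_inf_right (F.seq l) hU.2.1) h1]
    exact inf_le_left
  · intro hU
    have hBU : B ≤ U := le_sup_left.trans hU.1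
    refine ⟨⟨hBU, hU.2⟩, fun j => ?_⟩
    split_ifs with hj
    · have h1 : B ⊔ Y ⊓ F.seq j = Y := by
        refine Submodule.eq_of_le_of_finrank_eq (sup_le hBY inf_le_left) ?_
        have h2 := finrank_sup_inf hBY (F.seq j)
        rw [hb, hy] at h2
        have := hl j hj
        omega
      have h3 : ¬ Y ⊓ F.seq j ≤ U := fun h => by
        have := Submodule.finrank_mono (h1 ▸ sup_le hBU h)
        have := hU.2.2
        omega
      have h4 := sup_eq_of_hyper ⟨hBU, hU.2⟩ inf_le_left h3
      have h5 := finrank_sup_inf hU.2.1 (F.seq j)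
      rw [h4, hy] at h5
      have := hU.2.2
      omega
    · rw [add_zero, ← hy]
      rw [le_antisymm (inf_le_inf_right (F.seq j) hU.2.1) (le_inf ?_ inf_le_right)]
      exact (inf_le_inf_left _ (F.seq_mono (not_lt.1 hj))).trans (le_sup_right.trans hU.1)

end linalg

/-- A gap between consecutive elements `b < y` of `D` inside a row. -/
structure IsGap (N : ℕ) (D : Finset ℕ) (b y : ℕ) : Prop where
  left_mem : b ∈ D
  right_mem : y ∈ D
  lt : b + 1 < y
  le : y ≤ N
  gap : ∀ i ∈ D, i ≤ b ∨ y ≤ i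

lemma exists_isGap (h0 : 0 ∈ D) (hN : N ∈ D) (hD : D ⊆ Finset.range (N + 1))
    (hne : D ≠ Finset.range (N + 1)) : ∃ b y, IsGap N D b y := by
  obtain ⟨r, hr, hrD⟩ : ∃ r ∈ Finset.range (N + 1), r ∉ D := by
    by_contra! h
    exact hne (Finset.Subset.antisymm hD h)
  have h1 : (D.filter (· < r)).Nonempty := ⟨0, Finset.mem_filter.2 ⟨h0, by
    rcases Nat.eq_zero_or_pos r with rfl | h
    · exact absurd h0 hrD
    · exact h⟩⟩
  have hrN : r < N := lt_of_le_of_ne (Nat.lt_succ_iff.1 (Finset.mem_range.1 hr))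
    (by rintro rfl; exact hrD hN)
  have h2 : (D.filter (r < ·)).Nonempty := ⟨N, Finset.mem_filter.2 ⟨hN, hrN⟩⟩
  have h3 := Finset.mem_filter.1 (Finset.max'_mem _ h1)
  have h4 := Finset.mem_filter.1 (Finset.min'_mem _ h2)
  refine ⟨_, _, h3.1, h4.1, by omega, Nat.lt_succ_iff.1 (Finset.mem_range.1 (hD h4.1)), fun i hi => ?_⟩
  rcases lt_trichotomy i r with h | rfl | h
  · exact Or.inl (Finset.le_max' _ _ (Finset.mem_filter.2 ⟨hi, h⟩))
  · exact absurd hi hrD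
  · exact Or.inr (Finset.min'_le _ _ (Finset.mem_filter.2 ⟨hi, h⟩))

lemma IsGap.row_eq {b y : ℕ} (h : IsGap N D b y) (hs : LexSorted N L) (hD : rowEnds N L ⊆ D)
    {s t : ℕ} (hs1 : b ≤ s) (hst : s ≤ t) (ht : t < y) : (L s).1 = (L t).1 := by
  have htN : t < N := ht.trans_le h.le
  refine le_antisymm (hs.row_le s t hst htN) (not_lt.1 fun hlt => ?_)
  have h1 := (lt_cut_iff hs.row_le (hst.trans_lt htN) (L t).1).2 (Fin.lt_def.1 hlt)
  have h2 : ¬ t < rowCut N L (L t).1 := fun h2 => lt_irrefl _ ((lt_cut_iff hs.row_le htN _).1 h2)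
  have := h.gap _ (hD (rowCut_mem (N := N) (L := L) (i := (L t).1) (L t).1.2.le))
  unfold rowCut at *
  omega

lemma rowSpan_update {K V : Type} [Field K] [AddCommGroup V] [Module K V] {g : ℕ → Submodule K V}
    {F : Flag K n V} {r : ℕ} (hr : r ∉ rowEnds N L) (U : Submodule K V) :
    rowSpan N L I (Function.update g r U) F = rowSpan N L I g F := by
  unfold rowSpan
  refine iSup_congr fun s => iSup_congr fun _ => ?_
  rw [Function.update_of_ne]
  rintro h
  exact hr (h ▸ rowCut_mem (L s).1.2)

lemma chainDom.insert_of_gap {c : FiltSpace n} {p b y r : ℕ} {g : ℕ → Submodule c.K c.V}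
    (h : IsGap N D b y) (hg : chainDom N δ D L c p g) (hb : b < r) (hy : r < y)
    {U : Submodule c.K c.V} (h1 : g b ≤ U) (h2 : U ≤ g y)
    (h3 : finrank c.K U = ∑ s ∈ Finset.range r, δ p (L s)) :
    chainDom N δ (insert r D) L c p (Function.update g r U) := by
  have hmem : ∀ i ∈ insert r D, i ≠ r → i ∈ D := fun i hi hir =>
    (Finset.mem_insert.1 hi).resolve_left hir
  refine ⟨fun i hi j hj hij => ?_, fun i hi => ?_, ?_⟩
  · by_cases h4 : i = r
    · by_cases h5 : j = r
      · rw [h4, h5]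
      · rw [h4, Function.update_self, Function.update_of_ne h5]
        have := h.gap j (hmem j hj h5)
        exact h2.trans (hg.1 _ h.right_mem _ (hmem j hj h5) (by omega))
    · by_cases h5 : j = r
      · rw [h5, Function.update_self, Function.update_of_ne h4]
        have := h.gap i (hmem i hi h4)
        exact (hg.1 _ (hmem i hi h4) _ h.left_mem (by omega)).trans h1
      · rw [Function.update_of_ne h4, Function.update_of_ne h5]
        exact hg.1 _ (hmem i hi h4) _ (hmem j hj h5) hij
  · by_cases h4 : i = r
    · rw [h4, Function.update_self, h3]
    · rw [Function.update_of_ne h4, hg.2.1 _ (hmem i hi h4)]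
  · rw [Function.update_of_ne (by have := h.le; omega), hg.2.2]

/-- Double counting of pairs (new step U, flag F): every F is compatible with the same number of U,
and the summand ignores U because the span only involves row ends, which are not refined. -/
lemma fsum_posSet_insert {c : FiltSpace n} {p r k : ℕ} {g : ℕ → Submodule c.K c.V} (hr : r ∉ D)
    (hD : rowEnds N L ⊆ D) (S : Set (Submodule c.K c.V))
    (hS : ∀ F ∈ posSet δ p L D g,
      ({U ∈ S | ∀ j, finrank c.K ↥(U ⊓ F.seq j) = colCount δ p L r j}.ncard : ℚ) = projCard c.q k)
    (w : c.V) :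
    fsum S (fun U => fillSum N L δ (insert r D) I Φ c p (Function.update g r U) w) =
      projCard c.q k * fillSum N L δ D I Φ c p g w := by
  have h1 : ∀ U, ∀ F, F ∈ posSet δ p L (insert r D) (Function.update g r U) ↔
      F ∈ posSet δ p L D g ∧ ∀ j, finrank c.K ↥(U ⊓ F.seq j) = colCount δ p L r j := by
    intro U F
    constructor
    · intro h
      refine ⟨fun y hy j => ?_, fun j => ?_⟩
      · have := h y (Finset.mem_insert_of_mem hy) j
        rwa [Function.update_of_ne (by rintro rfl; exact hr hy)] at this
      · have := h r (Finset.mem_insert_self _ _) j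
        rwa [Function.update_self] at this
    · rintro ⟨h, h'⟩ y hy j
      by_cases hyr : y = r
      · subst hyr; rw [Function.update_self]; exact h' j
      · rw [Function.update_of_ne hyr]
        exact h y ((Finset.mem_insert.1 hy).resolve_left hyr) j
  unfold fillSum
  rw [fsum_comm S _ (posSet δ p L D g)
    (fun F => {U ∈ S | ∀ j, finrank c.K ↥(U ⊓ F.seq j) = colCount δ p L r j})]
  · rw [← fsum_mul_left]
    refine fsum_congr rfl fun F hF => ?_
    rw [← hS F hF]
    refine fsum_const _ fun U _ => ?_
    rw [rowSpan_update fun h => hr (hD h)]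
  · intro U F
    rw [h1]
    exact ⟨fun h => ⟨h.2.1, h.1, h.2.2⟩, fun h => ⟨h.2.1, h.1, h.2.2⟩⟩

lemma colCount_sub {p b y : ℕ} (hby : b ≤ y) (j : ℕ) : colCount δ p L y j = colCount δ p L b j +
    ∑ s ∈ Finset.Ico b y, if ((L s).2 : ℕ) < j then δ p (L s) else 0 := by
  rw [colCount, colCount, Finset.sum_range_add_sum_Ico _ hby]

lemma diagPat_succ {r : ℕ} (h : (L r).1 ≠ (L r).2) : diagPat L (r + 1) = diagPat L r := by
  funext j
  rw [diagPat, Finset.sum_range_succ, if_neg fun h' => h h'.1, add_zero]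
  rfl

lemma IsGap.col_le {b y : ℕ} (h : IsGap N D b y) (hs : LexSorted N L) (hD : rowEnds N L ⊆ D)
    {s t : ℕ} (hs1 : b ≤ s) (hst : s ≤ t) (ht : t < y) : (L s).2 ≤ (L t).2 :=
  ((hs s t hst (ht.trans_le h.le)).resolve_left (h.row_eq hs hD hs1 hst ht).not_lt).2

/-- Summing over the possible first steps of the gap counts each flag (q^k - 1)/(q - 1) times, where
k is the multiplicity of the first cell in the gap. This k is independent of p because the cell is
off-diagonal, so the division preserves tameness. -/
lemma Tame.fillSum_of_line {b y : ℕ} (hgap : IsGap N D b y) (hs : LexSorted N L)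
    (hD : rowEnds N L ⊆ D) (hδ : ∀ p x, x.1 ≠ x.2 → δ p x = 1) (hb : (L b).1 ≠ (L b).2)
    (h : Tame 𝓕 (insert (b + 1) D) (chainDom N δ (insert (b + 1) D) L) (diagPat L)
      (fillSum N L δ (insert (b + 1) D) I Φ)) :
    Tame 𝓕 D (chainDom N δ D L) (diagPat L) (fillSum N L δ D I Φ) := by
  have hby : b < y := by have := hgap.lt; omega
  have hrD : b + 1 ∉ D := fun hr => by have := hgap.gap _ hr; have := hgap.lt; omega
  set k := ((Finset.Ico b y).filter fun s => (L s).2 = (L b).2).card with hk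
  have hk0 : 0 < k := Finset.card_pos.2 ⟨b, by simp [hby]⟩
  have hupd : Function.update (diagPat L) (b + 1) (diagPat L b) = diagPat L := by
    rw [← diagPat_succ hb, Function.update_eq_self]
  have h1 : Tame 𝓕 D (chainDom N δ D L) (diagPat L)
      (Mirabolic.lineOp b y (b + 1) (fillSum N L δ (insert (b + 1) D) I Φ)) := by
    refine Tame.lineOp hgap.left_mem hgap.right_mem (by rw [hupd]; exact h)
      (Filter.Eventually.of_forall fun p c g hg => ?_)
    refine ⟨hg.1 _ hgap.left_mem _ hgap.right_mem hby.le, fun U hU => ?_⟩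
    refine hg.insert_of_gap hgap (Nat.lt_succ_self b) hgap.lt hU.1 hU.2.1 ?_
    rw [hU.2.2, hg.2.1 _ hgap.left_mem, Finset.sum_range_succ, hδ _ _ hb]
  refine (Tame.mul_left (Tm.inv_projCard hk0) h1).congr
    (Filter.Eventually.of_forall fun p c g w hg => ?_)
  have hle := hg.1 _ hgap.left_mem _ hgap.right_mem hby.le
  rw [Mirabolic.lineOp, fsum_posSet_insert (k := k) hrD hD, inv_mul_cancel_left₀ (projCard_pos c.two_le_q hk0).ne']
  intro F hF
  have hset : {U ∈ lines (g b) (g y) | ∀ j, finrank c.K ↥(U ⊓ F.seq j) = colCount δ p L (b + 1) j} =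
      lines (g b) (g b ⊔ g y ⊓ F.seq ((L b).2 + 1)) := by
    rw [← lines_posSet hle (hF b hgap.left_mem) (hF y hgap.right_mem)]
    · simp only [colCount, Finset.sum_range_succ, hδ _ _ hb]
    · intro j hj
      rw [colCount_sub hby.le, Finset.sum_eq_zero, add_zero]
      intro s hs'
      rw [Finset.mem_Ico] at hs'
      have := Fin.le_def.1 (hgap.col_le hs hD le_rfl hs'.1 hs'.2)
      exact if_neg (by omega)
  rw [hset, ncard_lines le_sup_left, FiltSpace.q]
  congr 1
  rw [finrank_sup_inf hle, hF b hgap.left_mem, hF y hgap.right_mem, colCount_sub hby.le]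
  have : ∑ s ∈ Finset.Ico b y, (if ((L s).2 : ℕ) < (L b).2 + 1 then δ p (L s) else 0) = k := by
    rw [hk, Finset.card_filter]
    refine Finset.sum_congr rfl fun s hs' => ?_
    rw [Finset.mem_Ico] at hs'
    have h2 := Fin.le_def.1 (hgap.col_le hs hD le_rfl hs'.1 hs'.2)
    have h3 := hgap.row_eq hs hD le_rfl hs'.1 hs'.2
    by_cases h4 : (L s).2 = (L b).2
    · rw [if_pos h4, if_pos (by rw [h4]; omega), ← (Prod.ext h3 h4.symm : L b = L s), hδ _ _ hb]
    · rw [if_neg h4, if_neg]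
      rw [Fin.ext_iff] at h4
      omega
  rw [this]
  push_cast
  ring

/-- The counterpart of `Tame.fillSum_of_line` that splits off the last step, for gaps whose first
step is diagonal and may have a dimension depending on p. -/
lemma Tame.fillSum_of_hyper {b y : ℕ} (hgap : IsGap N D b (y + 1)) (hs : LexSorted N L)
    (hD : rowEnds N L ⊆ D) (hδ : ∀ p x, x.1 ≠ x.2 → δ p x = 1) (hy : (L y).1 ≠ (L y).2)
    (h : Tame 𝓕 (insert y D) (chainDom N δ (insert y D) L) (diagPat L)
      (fillSum N L δ (insert y D) I Φ)) :
    Tame 𝓕 D (chainDom N δ D L) (diagPat L) (fillSum N L δ D I Φ) := by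
  have hby : b < y := by have := hgap.lt; omega
  have hrD : y ∉ D := fun hr => by have := hgap.gap _ hr; omega
  set k := ((Finset.Ico b (y + 1)).filter fun s => (L s).2 = (L y).2).card with hk
  have hk0 : 0 < k := Finset.card_pos.2 ⟨y, by simp [hby.le]⟩
  have hupd : Function.update (diagPat L) y (diagPat L (y + 1)) = diagPat L := by
    rw [diagPat_succ hy, Function.update_eq_self]
  have hdim : ∀ (c : FiltSpace n) p (g : ℕ → Submodule c.K c.V), chainDom N δ D L c p g →
      finrank c.K (g (y + 1)) = (∑ s ∈ Finset.range y, δ p (L s)) + 1 := fun c p g hg => by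
    rw [hg.2.1 _ hgap.right_mem, Finset.sum_range_succ, hδ _ _ hy]
  have h1 : Tame 𝓕 D (chainDom N δ D L) (diagPat L)
      (Mirabolic.hyperOp b (y + 1) y (fillSum N L δ (insert y D) I Φ)) := by
    refine Tame.hyperOp hgap.left_mem hgap.right_mem (by rw [hupd]; exact h)
      (Filter.Eventually.of_forall fun p c g hg => ?_)
    refine ⟨hg.1 _ hgap.left_mem _ hgap.right_mem (by omega), fun U hU => ?_⟩
    refine hg.insert_of_gap hgap hby (Nat.lt_succ_self y) hU.1 hU.2.1 ?_
    have := hU.2.2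
    rw [hdim c p g hg] at this
    omega
  refine (Tame.mul_left (Tm.inv_projCard hk0) h1).congr
    (Filter.Eventually.of_forall fun p c g w hg => ?_)
  have hle := hg.1 _ hgap.left_mem _ hgap.right_mem (by omega)
  rw [Mirabolic.hyperOp, fsum_posSet_insert (k := k) hrD hD, inv_mul_cancel_left₀ (projCard_pos c.two_le_q hk0).ne']
  intro F hF
  have hcol : ∀ s ∈ Finset.Ico b (y + 1), ((L s).2 : ℕ) ≤ (L y).2 := fun s hs' => by
    rw [Finset.mem_Ico] at hs'
    exact hgap.col_le hs hD hs'.1 (by omega) (Nat.lt_succ_self y)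
  have hdsub : (finrank c.K (g (y + 1)) : ℤ) =
      finrank c.K (g b) + (∑ s ∈ Finset.Ico b (y + 1), δ p (L s) : ℕ) := by
    rw [hg.2.1 _ hgap.right_mem, hg.2.1 _ hgap.left_mem, ← Nat.cast_add,
      Finset.sum_range_add_sum_Ico _ (by omega)]
  have hset : {U ∈ hypers (g b) (g (y + 1)) | ∀ j, finrank c.K ↥(U ⊓ F.seq j) = colCount δ p L y j} =
      hypers (g b ⊔ g (y + 1) ⊓ F.seq (L y).2) (g (y + 1)) := by
    rw [← hypers_posSet hle (hF b hgap.left_mem) (hF (y + 1) hgap.right_mem)]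
    · simp only [colCount, Finset.sum_range_succ, hδ _ _ hy, Nat.add_right_cancel_iff]
    · intro j hj
      rw [colCount_sub (by omega : b ≤ y + 1), hdsub, Finset.sum_congr rfl fun s hs' =>
        if_pos ((hcol s hs').trans_lt hj)]
      push_cast
      ring
  rw [hset, ncard_hypers (sup_le hle inf_le_left), FiltSpace.q]
  congr 1
  rw [finrank_sup_inf hle, hF b hgap.left_mem, hF (y + 1) hgap.right_mem,
    colCount_sub (by omega : b ≤ y + 1), hdsub]
  have : ∑ s ∈ Finset.Ico b (y + 1), δ p (L s) =
      (∑ s ∈ Finset.Ico b (y + 1), (if ((L s).2 : ℕ) < (L y).2 then δ p (L s) else 0)) + k := by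
    rw [hk, Finset.card_filter, ← Finset.sum_add_distrib]
    refine Finset.sum_congr rfl fun s hs' => ?_
    have h2 := hcol s hs'
    rw [Finset.mem_Ico] at hs'
    have h3 := hgap.row_eq hs hD hs'.1 (by omega : s ≤ y) (Nat.lt_succ_self y)
    by_cases h4 : (L s).2 = (L y).2
    · rw [if_pos h4, if_neg (by rw [h4]; omega), (Prod.ext h3 h4 : L s = L y), hδ _ _ hy]
    · rw [if_neg h4, if_pos, add_zero]
      rw [Fin.ext_iff] at h4
      omega
  rw [this]
  push_cast
  ring

/-- Induction on the number of positions missing from D: each gap is shortened by a one-dimensional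
step at one of its ends until the chain is fully refined and `FTame.flagSumI` applies. -/
lemma FTame.fillSum (hΦ : FTame 𝓕 Φ) (hδ : ∀ p x, x.1 ≠ x.2 → δ p x = 1) (hL : DiagOnce N L)
    (hs : LexSorted N L) (hI : IsLowerSet I) (hD : rowEnds N L ⊆ D)
    (hD' : D ⊆ Finset.range (N + 1)) :
    Tame 𝓕 D (chainDom N δ D L) (diagPat L) (fillSum N L δ D I Φ) := by
  induction hm : (Finset.range (N + 1) \ D).card generalizing D with
  | zero =>
    have hDe : D = Finset.range (N + 1) :=
      Finset.Subset.antisymm hD' (Finset.sdiff_eq_empty_iff_subset.1 (Finset.card_eq_zero.1 hm))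
    rw [hDe]
    -- Rows increase weakly and I is a lower set. A cell outside I that precedes one inside I must
    -- therefore have the larger column, which is what makes the exchange possible.
    have h1 := FTame.flagSumI (L := L) hΦ hδ hL I fun i j hij hj => by
      refine ⟨fun h1 h2 => ?_, fun h1 h2 => ?_⟩
      · rw [← not_le]
        exact fun h => h1 (hI ⟨Fin.le_def.2 (hs.row_le i j hij.le hj), h⟩ h2)
      · rw [← h1, ← h2]
        exact hs.row_le i j hij.le hj
    refine h1.congr (Filter.Eventually.of_forall fun p c g w hg => ?_)
    have hm : ∀ i j, i ≤ j → j ≤ N → g i ≤ g j := fun i j hij hj =>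
      hg.1 _ (Finset.mem_range.2 (by omega)) _ (Finset.mem_range.2 (by omega)) hij
    have hset : posSet δ p L (Finset.range (N + 1)) g = adapted N L g := by
      ext F
      refine (adapted_iff_posSet (hg.zero (Finset.mem_range.2 (by omega)))
        (fun r hr => hm _ _ (by omega) (by omega)) fun r hr => ?_).symm
      rw [hg.2.1 _ (Finset.mem_range.2 (by omega)), hg.2.1 _ (Finset.mem_range.2 (by omega)),
        Finset.sum_range_succ]
    refine fsum_congr hset fun F hF => ?_
    rw [rowSpan_eq_idealSpan hs hm hF]
  | succ m ih =>
    obtain ⟨b, y, hgap⟩ := exists_isGap (hD zero_mem_rowEnds) (hD last_mem_rowEnds) hD' (by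
      rintro rfl
      simp at hm)
    have hstep : ∀ r, r < N → r ∉ D → Tame 𝓕 (insert r D) (chainDom N δ (insert r D) L) (diagPat L)
        (Mirabolic.fillSum N L δ (insert r D) I Φ) := fun r hr hrD => by
      have hrm : r ∈ Finset.range (N + 1) := Finset.mem_range.2 (by omega)
      refine ih (hD.trans (Finset.subset_insert _ _)) (Finset.insert_subset hrm hD') ?_
      rw [Finset.sdiff_insert, Finset.card_erase_of_mem (Finset.mem_sdiff.2 ⟨hrm, hrD⟩), hm]
      rfl
    have := hgap.lt
    have := hgap.le
    -- A gap lies within one row, and a row has only one diagonal slot; so if the first slot of the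
    -- gap is diagonal, the last one is not.
    by_cases hb : (L b).1 = (L b).2
    · obtain ⟨y, rfl⟩ : ∃ y', y = y' + 1 := ⟨y - 1, by omega⟩
      refine Tame.fillSum_of_hyper hgap hs hD hδ (fun hy => ?_) (hstep y (by omega) fun h => by
        have := hgap.gap _ h; omega)
      have hrow := hgap.row_eq hs hD le_rfl (by omega : b ≤ y) (Nat.lt_succ_self y)
      exact hL.ne_of_lt (by omega : b < y) (by omega) hb
        (Prod.ext hrow (by rw [← hb, ← hy, hrow]))
    · exact Tame.fillSum_of_line hgap hs hD hδ hb (hstep (b + 1) (by omega) fun h => by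
        have := hgap.gap _ h; omega)

end

end Mirabolic

/-! ### Orbits described by dimensions and by bad cells of the vector -/

namespace Mirabolic

open Module

variable {n : ℕ}

section

variable {K : Type} [Field K] {V : Type} [AddCommGroup V] [Module K V] (F F' : Flag K n V)

lemma Flag.sub_succ (i : Fin n) : F.sub i.succ = F.seq (i + 1) :=
  (F.seq_of_lt (Nat.succ_lt_succ i.2)).symm

lemma Flag.sub_castSucc (i : Fin n) : F.sub i.castSucc = F.seq i :=
  (F.seq_of_lt (Nat.lt_succ_of_lt i.2)).symm

lemma cell_eq (x : Fin n × Fin n) : cell F F' x = F.seq (x.1 + 1) ⊓ F'.seq (x.2 + 1) := by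
  rw [cell, Flag.sub_succ, Flag.sub_succ]

lemma cellBelow_eq (x : Fin n × Fin n) : cellBelow F F' x =
    F.seq x.1 ⊓ F'.seq (x.2 + 1) ⊔ F.seq (x.1 + 1) ⊓ F'.seq x.2 := by
  rw [cellBelow, Flag.sub_succ, Flag.sub_succ, Flag.sub_castSucc, Flag.sub_castSucc]

lemma cell_mono {x y : Fin n × Fin n} (h : x ≤ y) : cell F F' x ≤ cell F F' y := by
  rw [cell_eq, cell_eq]
  exact inf_le_inf (F.seq_mono (Nat.succ_le_succ h.1)) (F'.seq_mono (Nat.succ_le_succ h.2))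

/-- Two applications of the modular law. Thus a vector of a cell avoids the part below exactly when
it avoids the sum of the preceding members of the two flags, a condition that can be tested on
arbitrary vectors. -/
lemma cell_inf_sup (x : Fin n × Fin n) :
    cell F F' x ⊓ (F.seq x.1 ⊔ F'.seq x.2) = cellBelow F F' x := by
  have h1 : F.seq x.1 ≤ F.seq (x.1 + 1) := F.seq_mono (Nat.le_succ _)
  have h2 : F'.seq x.2 ≤ F'.seq (x.2 + 1) := F'.seq_mono (Nat.le_succ _)
  rw [cell_eq, cellBelow_eq, inf_comm (F.seq (x.1 + 1)), inf_assoc, inf_comm (F.seq (x.1 + 1)),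
    sup_inf_assoc_of_le _ h1, inf_comm (F'.seq (x.2 + 1)), inf_comm (F.seq (x.1 + 1)),
    sup_comm, sup_comm (F.seq x.1 ⊓ _), sup_inf_assoc_of_le _ (inf_le_left.trans h2)]

/-- The cells `(i, j)` (counted from zero) with `w ∉ F i + F' j`. -/
def badCells (w : V) : Set (Fin n × Fin n) := {y | w ∉ F.seq y.1 ⊔ F'.seq y.2}

/-- The sum of the intersections of members of the flags over the cells in `J`. -/
def cellSpan (J : Set (Fin n × Fin n)) : Submodule K V := ⨆ x, ⨆ _ : x ∈ J, cell F F' x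

variable {F F'} {w : V} {J : Set (Fin n × Fin n)}

lemma isLowerSet_badCells : IsLowerSet (badCells F F' w) := fun _ _ hyx hx hy =>
  hx ((sup_le_sup (F.seq_mono hyx.1) (F'.seq_mono hyx.2)) hy)

lemma cell_le_sup_of_not_le {x y : Fin n × Fin n} (h : ¬ y ≤ x) :
    cell F F' x ≤ F.seq y.1 ⊔ F'.seq y.2 := by
  rw [cell_eq]
  by_cases h1 : y.1 ≤ x.1
  · have h2 : x.2 < y.2 := not_le.1 fun h2 => h ⟨h1, h2⟩
    exact inf_le_right.trans ((F'.seq_mono (Fin.lt_def.1 h2)).trans le_sup_right)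
  · exact inf_le_left.trans ((F.seq_mono (Fin.lt_def.1 (not_le.1 h1))).trans le_sup_left)

lemma exists_threshold (hJ : IsLowerSet J) (i : ℕ) : ∃ m : ℕ,
    (∀ x ∈ J, i ≤ (x.1 : ℕ) → (x.2 : ℕ) < m) ∧
    ∀ k, m = k + 1 → ∃ x ∈ J, (x.1 : ℕ) = i ∧ (x.2 : ℕ) = k := by
  classical
  have hex : ∃ m : ℕ, ∀ x ∈ J, i ≤ (x.1 : ℕ) → (x.2 : ℕ) < m := ⟨n, fun x _ _ => x.2.2⟩
  refine ⟨Nat.find hex, Nat.find_spec hex, fun k hk => ?_⟩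
  have := Nat.find_min hex (m := k) (by omega)
  push Not at this
  obtain ⟨x, hx, h1, h2⟩ := this
  exact ⟨(⟨i, h1.trans_lt x.1.2⟩, ⟨k, h2.trans_lt x.2.2⟩), hJ ⟨h1, h2⟩ hx, rfl, rfl⟩

/-- A cell x lies in F i + F' j unless (i, j) ≤ x, which gives one direction. Conversely J is a
staircase with heights m i, the hypothesis says w ∈ F i + F' (m i) for each row, and w is decomposed
row by row from the top using the cells at the corners. -/
lemma mem_cellSpan_iff (hJ : IsLowerSet J) : w ∈ cellSpan F F' J ↔ badCells F F' w ⊆ J := by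
  constructor
  · intro hw y hy
    by_contra hyJ
    refine hy ((iSup₂_le fun x hx => ?_ : cellSpan F F' J ≤ _) hw)
    exact cell_le_sup_of_not_le fun h => hyJ (hJ h hx)
  · intro h
    choose m hm1 hm2 using exists_threshold hJ
    have hthr : ∀ i < n, w ∈ F.seq i ⊔ F'.seq (m i) := by
      intro i hi
      by_cases hmi : m i < n
      · by_contra hw
        exact absurd (hm1 i (⟨i, hi⟩, ⟨m i, hmi⟩) (h hw) le_rfl) (lt_irrefl _)
      · rw [F'.seq_of_le (not_lt.1 hmi), sup_top_eq]; exact Submodule.mem_top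
    have hcell : ∀ i < n, F.seq (i + 1) ⊓ F'.seq (m i) ≤ cellSpan F F' J := by
      intro i hi
      rcases hk : m i with _ | k
      · rw [F'.seq_zero, inf_bot_eq]; exact bot_le
      · obtain ⟨x, hx, h1, h2⟩ := hm2 i k hk
        rw [← h1, ← h2, ← cell_eq]
        exact le_iSup₂_of_le x hx le_rfl
    have hanti : ∀ i, m (i + 1) ≤ m i := by
      intro i
      rcases hk : m (i + 1) with _ | k
      · exact Nat.zero_le _
      · obtain ⟨x, hx, h1, h2⟩ := hm2 _ k hk
        have := hm1 i x hx (by omega)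
        omega
    -- The part s already split off must stay inside F' (m i), since otherwise the condition on w in
    -- the next row would say nothing about w - s. This uses that the heights grow as the row index
    -- decreases.
    have key : ∀ t ≤ n, ∃ s ∈ cellSpan F F' J ⊓ F'.seq (m (n - t)), w - s ∈ F.seq (n - t) := by
      intro t
      induction t with
      | zero =>
        intro _
        refine ⟨0, zero_mem _, ?_⟩
        rw [Nat.sub_zero, F.seq_last]; exact Submodule.mem_top
      | succ t ih =>
        intro ht
        obtain ⟨s, hs, hws⟩ := ih (by omega)
        obtain ⟨i, hi⟩ : ∃ i, i = n - (t + 1) := ⟨_, rfl⟩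
        have hi1 : n - t = i + 1 := by omega
        rw [hi1] at hs hws
        rw [← hi]
        have hs2 : s ∈ F'.seq (m i) := F'.seq_mono (hanti i) hs.2
        have h1 : w - s ∈ (F.seq i ⊔ F'.seq (m i)) ⊓ F.seq (i + 1) :=
          ⟨sub_mem (hthr i (by omega)) (Submodule.mem_sup_right hs2), hws⟩
        rw [sup_inf_assoc_of_le _ (F.seq_mono (Nat.le_succ i))] at h1
        obtain ⟨a, ha, b, hb, hab⟩ := Submodule.mem_sup.1 h1
        refine ⟨s + b, ⟨add_mem hs.1 (hcell i (by omega) ⟨hb.2, hb.1⟩), add_mem hs2 hb.1⟩, ?_⟩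
        rw [show w - (s + b) = a by rw [← sub_sub, ← hab]; abel]
        exact ha
    obtain ⟨s, hs, hws⟩ := key n le_rfl
    rw [Nat.sub_self, F.seq_zero, Submodule.mem_bot, sub_eq_zero] at hws
    rw [hws]
    exact hs.1

/-- The cells below a member of `Δ`. -/
def shadow (Δ : Finset (Fin n × Fin n)) : Set (Fin n × Fin n) := {x | ∃ y ∈ Δ, x ≤ y}

lemma isLowerSet_shadow (Δ : Finset (Fin n × Fin n)) : IsLowerSet (shadow Δ) :=
  fun _ _ hba ⟨y, hy, h⟩ => ⟨y, hy, hba.trans h⟩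

/-- The cells of Δ are pairwise incomparable, so all components but the one at (i, j) lie in F i +
F' j. Whether (i, j) ∈ Δ is bad for w is hence decided by that component alone, and the bad cells
are those below Δ. -/
lemma exists_decomposition_iff {Δ : Finset (Fin n × Fin n)}
    (hΔ : ∀ x ∈ Δ, ∀ y ∈ Δ, x ≠ y → (x.1 < y.1 ∧ y.2 < x.2) ∨ (y.1 < x.1 ∧ x.2 < y.2)) :
    (∃ ω : Fin n × Fin n → V, (∀ x ∈ Δ, ω x ∈ cell F F' x ∧ ω x ∉ cellBelow F F' x) ∧
      w = ∑ x ∈ Δ, ω x) ↔ badCells F F' w = shadow Δ := by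
  classical
  have hanti : ∀ x ∈ Δ, ∀ y ∈ Δ, y ≠ x → ¬ x ≤ y := fun x hx y hy hne hle => by
    rcases hΔ x hx y hy hne.symm with h | h
    · exact absurd hle.2 (not_le.2 h.2)
    · exact absurd hle.1 (not_le.2 h.1)
  have hrest : ∀ ω : Fin n × Fin n → V, (∀ x ∈ Δ, ω x ∈ cell F F' x) → ∀ x ∈ Δ,
      (∑ y ∈ Δ, ω y ∈ F.seq x.1 ⊔ F'.seq x.2 ↔ ω x ∈ F.seq x.1 ⊔ F'.seq x.2) := by
    intro ω hω x hx
    rw [← Finset.add_sum_erase _ _ hx]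
    refine Submodule.add_mem_iff_left _ (Submodule.sum_mem _ fun y hy => ?_)
    rw [Finset.mem_erase] at hy
    exact cell_le_sup_of_not_le (hanti x hx y hy.2 hy.1) (hω y hy.2)
  constructor
  · rintro ⟨ω, hω, rfl⟩
    refine Set.Subset.antisymm ?_ ?_
    · rw [← mem_cellSpan_iff (isLowerSet_shadow Δ)]
      refine Submodule.sum_mem _ fun x hx => ?_
      exact (le_iSup₂_of_le x ⟨x, hx, le_rfl⟩ le_rfl : cell F F' x ≤ cellSpan F F' (shadow Δ)) (hω x hx).1
    · rintro y ⟨x, hx, hyx⟩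
      refine isLowerSet_badCells hyx fun h => (hω x hx).2 ?_
      rw [← cell_inf_sup]
      exact ⟨(hω x hx).1, (hrest ω (fun x hx => (hω x hx).1) x hx).1 h⟩
  · intro h
    have h1 : w ∈ cellSpan F F' (shadow Δ) := (mem_cellSpan_iff (isLowerSet_shadow Δ)).2 h.subset
    have h2 : cellSpan F F' (shadow Δ) ≤ ⨆ x ∈ Δ, cell F F' x := by
      refine iSup₂_le fun x hx => ?_
      obtain ⟨y, hy, hxy⟩ := hx
      exact (cell_mono F F' hxy).trans (le_iSup₂_of_le y hy le_rfl)
    obtain ⟨ω, hsum⟩ := (Submodule.mem_iSup_finset_iff_exists_sum _ _).1 (h2 h1)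
    refine ⟨fun x => ω x, fun x hx => ⟨(ω x).2, fun hb => ?_⟩, hsum.symm⟩
    rw [← cell_inf_sup] at hb
    have h3 : x ∈ badCells F F' w := h ▸ ⟨x, hx, le_rfl⟩
    exact h3 (hsum ▸ (hrest (fun x => ω x) (fun x _ => (ω x).2) x hx).2 hb.2)

end

/-! ### Dimensions -/

/-- The sum of the entries in the first `i` rows and `j` columns. -/
def rankSum (A : Matrix (Fin n) (Fin n) ℤ) (i j : ℕ) : ℤ :=
  ∑ x : Fin n × Fin n, if (x.1 : ℕ) < i ∧ (x.2 : ℕ) < j then A x.1 x.2 else 0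

lemma rankSum_zero_left (A : Matrix (Fin n) (Fin n) ℤ) (j : ℕ) : rankSum A 0 j = 0 := by
  simp [rankSum]

lemma rankSum_zero_right (A : Matrix (Fin n) (Fin n) ℤ) (i : ℕ) : rankSum A i 0 = 0 := by
  simp [rankSum]

lemma rankSum_diff (A : Matrix (Fin n) (Fin n) ℤ) (x : Fin n × Fin n) :
    rankSum A (x.1 + 1) (x.2 + 1) =
      rankSum A x.1 (x.2 + 1) + rankSum A (x.1 + 1) x.2 - rankSum A x.1 x.2 + A x.1 x.2 := by
  have h : A x.1 x.2 = ∑ y : Fin n × Fin n, if y = x then A y.1 y.2 else 0 := by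
    rw [Finset.sum_ite_eq' Finset.univ x, if_pos (Finset.mem_univ _)]
  rw [h]
  unfold rankSum
  rw [← Finset.sum_add_distrib, ← Finset.sum_sub_distrib, ← Finset.sum_add_distrib]
  refine Finset.sum_congr rfl fun y _ => ?_
  have : y = x ↔ (y.1 : ℕ) = x.1 ∧ (y.2 : ℕ) = x.2 := by
    rw [Prod.ext_iff, Fin.ext_iff, Fin.ext_iff]
  by_cases h1 : (y.1 : ℕ) < x.1 <;> by_cases h2 : (y.2 : ℕ) < x.2 <;>
    by_cases h3 : (y.1 : ℕ) = x.1 <;> by_cases h4 : (y.2 : ℕ) = x.2 <;>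
    simp [this, h1, h2, h3, h4] <;> omega

lemma rankSum_of_le_right (A : Matrix (Fin n) (Fin n) ℤ) (i : ℕ) {j : ℕ} (hj : n ≤ j) :
    rankSum A i j = rankSum A i n :=
  Finset.sum_congr rfl fun x _ => by
    have := x.2.2
    simp only [show ((x.2 : ℕ) < j ↔ (x.2 : ℕ) < n) from ⟨fun _ => this, fun _ => by omega⟩]

/-- This is where the shift by pI enters: the upper left block of size i by j contains min(i, j)
diagonal positions. -/
lemma rankSum_add_diagonal (A : Matrix (Fin n) (Fin n) ℤ) (p : ℤ) {i : ℕ} (hi : i ≤ n) (j : ℕ) :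
    rankSum (A + Matrix.diagonal fun _ => p) i j = rankSum A i j + p * (min i j : ℕ) := by
  rw [← card_fin_lt i hi j, rankSum, rankSum, Finset.mul_sum, Fintype.sum_prod_type,
    Fintype.sum_prod_type, ← Finset.sum_add_distrib]
  refine Finset.sum_congr rfl fun a _ => ?_
  have : p * (if (a : ℕ) < i ∧ (a : ℕ) < j then 1 else 0) =
      ∑ b : Fin n, if a = b then (if (a : ℕ) < i ∧ (b : ℕ) < j then p else 0) else 0 := by
    rw [Finset.sum_ite_eq Finset.univ a, if_pos (Finset.mem_univ _)]
    split_ifs <;> simp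
  rw [this, ← Finset.sum_add_distrib]
  refine Finset.sum_congr rfl fun b _ => ?_
  rw [Matrix.add_apply, Matrix.diagonal_apply]
  split_ifs <;> simp

section

variable {K : Type} [Field K] {V : Type} [AddCommGroup V] [Module K V] [Finite V] {F F' : Flag K n V}
  {w : V}

lemma finrank_cellBelow (x : Fin n × Fin n) : (finrank K (cellBelow F F' x) : ℤ) =
    finrank K ↥(F.seq x.1 ⊓ F'.seq (x.2 + 1)) + finrank K ↥(F.seq (x.1 + 1) ⊓ F'.seq x.2) -
      finrank K ↥(F.seq x.1 ⊓ F'.seq x.2) := by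
  have : Module.Finite K V := Module.Finite.of_finite
  have h := Submodule.finrank_sup_add_finrank_inf_eq (F.seq x.1 ⊓ F'.seq (x.2 + 1))
    (F.seq (x.1 + 1) ⊓ F'.seq x.2)
  have h2 : F.seq x.1 ⊓ F'.seq (x.2 + 1) ⊓ (F.seq (x.1 + 1) ⊓ F'.seq x.2) = F.seq x.1 ⊓ F'.seq x.2 := by
    refine le_antisymm (le_inf (inf_le_left.trans inf_le_left) (inf_le_right.trans inf_le_right)) ?_
    exact le_inf (inf_le_inf_left _ (F'.seq_mono (Nat.le_succ _)))
      (inf_le_inf_right _ (F.seq_mono (Nat.le_succ _)))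
  rw [h2] at h
  rw [cellBelow_eq]
  omega

/-- The entries of A are the mixed second differences of the dimensions of F i ∩ F' j, and these
vanish on the boundary. -/
lemma finrank_cell_iff (A : Matrix (Fin n) (Fin n) ℤ) :
    (∀ x : Fin n × Fin n, (finrank K (cell F F' x) : ℤ) = finrank K (cellBelow F F' x) + A x.1 x.2) ↔
      ∀ i ≤ n, ∀ j, (finrank K ↥(F.seq i ⊓ F'.seq j) : ℤ) = rankSum A i j := by
  have : Module.Finite K V := Module.Finite.of_finite
  constructor
  · intro h i
    induction i with
    | zero => intro _ j; rw [F.seq_zero, bot_inf_eq, finrank_bot, rankSum_zero_left]; rfl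
    | succ i ihi =>
      intro hi
      have ihi := ihi (by omega)
      have : ∀ j ≤ n, (finrank K ↥(F.seq (i + 1) ⊓ F'.seq j) : ℤ) = rankSum A (i + 1) j := by
        intro j
        induction j with
        | zero => intro _; rw [F'.seq_zero, inf_bot_eq, finrank_bot, rankSum_zero_right]; rfl
        | succ j ihj =>
          intro hj
          have h1 := h (⟨i, hi⟩, ⟨j, hj⟩)
          rw [finrank_cellBelow, cell_eq] at h1
          dsimp only at h1
          rw [h1, ihj (by omega), ihi, ihi]
          exact (rankSum_diff A (⟨i, hi⟩, ⟨j, hj⟩)).symm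
      intro j
      by_cases hj : j ≤ n
      · exact this j hj
      · rw [F'.seq_of_le (by omega), rankSum_of_le_right A _ (by omega), ← this n le_rfl, F'.seq_last]
  · intro h x
    rw [finrank_cellBelow, cell_eq, h _ x.1.2, h _ x.1.2, h _ x.1.2.le, h _ x.1.2.le, rankSum_diff]

/-- The least `m` such that all cells of `Δ` in the rows from `i` on are in the first `m` columns. -/
def threshold (Δ : Finset (Fin n × Fin n)) (i : ℕ) : ℕ :=
  (Δ.filter fun x => i ≤ (x.1 : ℕ)).sup fun x => (x.2 : ℕ) + 1

lemma threshold_le_iff {Δ : Finset (Fin n × Fin n)} {i j : ℕ} :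
    threshold Δ i ≤ j ↔ ∀ x ∈ Δ, i ≤ (x.1 : ℕ) → (x.2 : ℕ) < j := by
  rw [threshold, Finset.sup_le_iff]
  simp only [Finset.mem_filter, and_imp, Nat.succ_le_iff]

lemma badCells_eq_shadow_iff {Δ : Finset (Fin n × Fin n)} : badCells F F' w = shadow Δ ↔
    ∀ i ≤ n, ∀ j, w ∈ F.seq i ⊔ F'.seq j ↔ threshold Δ i ≤ j := by
  have hsh : ∀ x : Fin n × Fin n, x ∈ shadow Δ ↔ ¬ threshold Δ x.1 ≤ x.2 := by
    intro x
    rw [threshold_le_iff]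
    push Not
    rfl
  constructor
  · intro h i hi j
    by_cases hi' : i < n
    · by_cases hj : j < n
      · have h1 := hsh (⟨i, hi'⟩, ⟨j, hj⟩)
        rw [← h] at h1
        exact not_iff_not.1 h1
      · rw [F'.seq_of_le (by omega), sup_top_eq, threshold_le_iff]
        exact ⟨fun _ x _ _ => by have := x.2.2; omega, fun _ => Submodule.mem_top⟩
    · rw [F.seq_of_le (by omega), top_sup_eq, threshold_le_iff]
      exact ⟨fun _ x _ _ => by have := x.1.2; omega, fun _ => Submodule.mem_top⟩
  · intro h
    ext x
    rw [hsh, ← h _ x.1.2.le]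
    rfl

lemma inOrbit_iff (M : DecMat n) : InOrbit M F F' w ↔
    (∀ i ≤ n, ∀ j, (finrank K ↥(F.seq i ⊓ F'.seq j) : ℤ) = rankSum M.A i j) ∧
      badCells F F' w = shadow M.Δ := by
  rw [InOrbit, finrank_cell_iff, exists_decomposition_iff M.chain]

/-- The decoration is equivalent to its row thresholds, so an orbit is described by the type of each
member of the first flag. This connects orbits with tame functions. -/
lemma inOrbit_iff_hasType (M : DecMat n) : InOrbit M F F' w ↔
    ∀ i ≤ n, HasType F'.seq w (F.seq i) (rankSum M.A i) (threshold M.Δ i) := by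
  rw [inOrbit_iff, badCells_eq_shadow_iff]
  exact ⟨fun h i hi => ⟨h.1 i hi, h.2 i hi⟩, fun h => ⟨fun i hi => (h i hi).1, fun i hi => (h i hi).2⟩⟩

open Classical in
-- The bad cells equal the shadow of Δ exactly when they are contained in it and omit no member of
-- Δ. Removing a set S of members of Δ, which are maximal in the shadow, leaves a lower set. The
-- formula is inclusion-exclusion over the members that are omitted.
lemma charFun_eq_sum {M : DecMat n}
    (h : ∀ i ≤ n, ∀ j, (finrank K ↥(F.seq i ⊓ F'.seq j) : ℤ) = rankSum M.A i j) :
    charFun M F F' w = ∑ S ∈ M.Δ.powerset,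
      (-1) ^ S.card * if w ∈ cellSpan F F' (shadow M.Δ \ S) then 1 else 0 := by
  have hanti : ∀ x ∈ M.Δ, ∀ y ∈ M.Δ, y ≠ x → ¬ x ≤ y := fun x hx y hy hne hle => by
    rcases M.chain x hx y hy hne.symm with h | h
    · exact absurd hle.2 (not_le.2 h.2)
    · exact absurd hle.1 (not_le.2 h.1)
  have hlow : ∀ S ∈ M.Δ.powerset, IsLowerSet (shadow M.Δ \ (S : Set (Fin n × Fin n))) := by
    intro S hS x y hyx hx
    refine ⟨isLowerSet_shadow _ hyx hx.1, fun hyS => hx.2 ?_⟩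
    obtain ⟨z, hz, hxz⟩ := hx.1
    have hy := Finset.mem_powerset.1 hS hyS
    have : y = z := by_contra fun hne => hanti y hy z hz (Ne.symm hne) (hyx.trans hxz)
    subst this
    rwa [le_antisymm hxz hyx]
  have hmem : ∀ S ∈ M.Δ.powerset, (w ∈ cellSpan F F' (shadow M.Δ \ S) ↔
      badCells F F' w ⊆ shadow M.Δ ∧ S ∈ (M.Δ.filter (· ∉ badCells F F' w)).powerset) := by
    intro S hS
    rw [mem_cellSpan_iff (hlow S hS), Set.subset_sdiff, Finset.mem_powerset]
    refine and_congr_right fun _ => ⟨fun h x hx => ?_, fun h => ?_⟩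
    · exact Finset.mem_filter.2 ⟨Finset.mem_powerset.1 hS hx, fun hb => Set.disjoint_left.1 h hb hx⟩
    · exact Set.disjoint_left.2 fun x hb hx => (Finset.mem_filter.1 (h hx)).2 hb
  rw [Finset.sum_congr rfl fun S hS => by rw [if_congr (hmem S hS) rfl rfl]]
  by_cases hT : badCells F F' w ⊆ shadow M.Δ
  · simp only [hT, true_and, mul_ite, mul_one, mul_zero]
    rw [← Finset.sum_filter]
    have : M.Δ.powerset.filter (· ∈ (M.Δ.filter (· ∉ badCells F F' w)).powerset) =
        (M.Δ.filter (· ∉ badCells F F' w)).powerset := by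
      ext S
      simp only [Finset.mem_filter, Finset.mem_powerset]
      exact ⟨fun h => h.2, fun h => ⟨h.trans (Finset.filter_subset _ _), h⟩⟩
    rw [this, Finset.sum_powerset_neg_one_pow_card, charFun]
    refine if_congr ((inOrbit_iff M).trans ?_) rfl rfl
    rw [Finset.filter_eq_empty_iff]
    constructor
    · rintro ⟨_, h2⟩ x hx hb
      exact hb (h2 ▸ ⟨x, hx, le_rfl⟩)
    · intro h2
      refine ⟨h, Set.Subset.antisymm hT fun y hy => ?_⟩
      obtain ⟨x, hx, hyx⟩ := hy
      exact isLowerSet_badCells hyx (not_not.1 (h2 hx))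
  · simp only [hT, false_and, if_false, mul_zero, Finset.sum_const_zero]
    rw [charFun, inOrbit_iff, if_neg]
    exact fun h => hT h.2.subset

end

end Mirabolic

/-! ### Left multiplication by an orbit preserves tameness -/

namespace Mirabolic

open Module

variable {n : ℕ}

lemma exists_labels (hn : 0 < n) (mult : Fin n × Fin n → ℕ) : ∃ (N : ℕ) (L : ℕ → Fin n × Fin n),
    LexSorted N L ∧ ∀ G : Fin n × Fin n → ℤ,
      ∑ r ∈ Finset.range N, G (L r) = ∑ x, mult x * G x := by
  let s : Multiset (Fin n ×ₗ Fin n) := ∑ x : Fin n × Fin n, Multiset.replicate (mult x) (toLex x)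
  let l : List (Fin n ×ₗ Fin n) := s.sort (· ≤ ·)
  let L : ℕ → Fin n × Fin n := fun r => ofLex (l.getD r (toLex (⟨0, hn⟩, ⟨0, hn⟩)))
  refine ⟨l.length, L, fun i j hij hj => ?_, fun G => ?_⟩
  · have h1 : l[i] ≤ l[j] := by
      rcases hij.lt_or_eq with h | h
      · exact List.pairwise_iff_getElem.1 (Multiset.pairwise_sort s (· ≤ ·)) i j _ hj h
      · simp [h]
    have h2 : ∀ k (hk : k < l.length), L k = ofLex l[k] := fun k hk => by
      simp only [L, List.getD_eq_getElem _ _ hk]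
    rw [h2 i (hij.trans_lt hj), h2 j hj]
    exact Prod.Lex.le_iff.1 h1
  · have h1 : ∑ r ∈ Finset.range l.length, G (L r) = (l.map fun x => G (ofLex x)).sum := by
      rw [← Fin.sum_univ_eq_sum_range (fun r => G (L r)), ← List.sum_ofFn]
      congr 1
      refine List.ext_getElem (by simp) fun i h1 h2 => ?_
      simp only [List.length_map] at h2
      simp [L]
    have h2 : (l.map fun x => G (ofLex x)).sum = (s.map fun x => G (ofLex x)).sum := by
      conv_rhs => rw [← Multiset.sort_eq s (· ≤ ·)]
      simp only [l, Multiset.map_coe, Multiset.sum_coe]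
    rw [h1, h2]
    change ((Multiset.mapAddMonoidHom fun x => G (ofLex x)) s).sum = _
    rw [map_sum, Multiset.sum_sum]
    refine Finset.sum_congr rfl fun x _ => ?_
    simp

section fsum

variable {α : Type*} [Finite α]

lemma fsum_subset {s t : Set α} (h : s ⊆ t) {f : α → ℚ} (hf : ∀ a ∈ t, a ∉ s → f a = 0) :
    fsum t f = fsum s f := by
  have h1 := fsum_diff h f
  rw [fsum_const (t \ s) (f := f) (c := 0) fun a ha => hf a ha.1 ha.2] at h1
  linarith

lemma fsum_sum {ι : Type*} (I : Finset ι) (s : Set α) (f : ι → α → ℚ) :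
    fsum s (fun a => ∑ i ∈ I, f i a) = ∑ i ∈ I, fsum s (f i) :=
  Finset.sum_comm

open Classical in
lemma fsum_indicator (s : Set α) (f : α → ℚ) :
    fsum Set.univ (fun a => (if a ∈ s then 1 else 0) * f a) = fsum s f := by
  rw [fsum_subset (Set.subset_univ s) fun a _ ha => by rw [if_neg ha, zero_mul]]
  exact fsum_congr rfl fun a ha => by rw [if_pos ha, one_mul]

end fsum

/-- The filtration as a flag. -/
def FiltSpace.flag (c : FiltSpace n) : Flag c.K n c.V :=
  Flag.ofSeq c.E c.zero c.top fun _ _ h _ => c.mono h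

lemma FiltSpace.flag_seq (c : FiltSpace n) (j : ℕ) : c.flag.seq j = c.E j := by
  by_cases hj : j ≤ n
  · exact Flag.ofSeq_seq _ _ _ _ hj
  · rw [Flag.seq_of_le _ (by omega)]
    exact (top_le_iff.1 (c.top ▸ c.mono (by omega))).symm

/-- Convolution with the characteristic function of an orbit on the left. -/
def leftMult (M : DecMat n) (Φ : FlagFun n) : FlagFun n := fun c p F w =>
  fsum Set.univ fun F'' : Flag c.K n c.V => fsum Set.univ fun μ : c.V =>
    (charFun (M.shift p) F F'' μ : ℚ) * Φ c p F'' (w - μ)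

/-- The number of slots of each cell. -/
def slotMult (M : DecMat n) (x : Fin n × Fin n) : ℕ := if x.1 = x.2 then 1 else (M.A x.1 x.2).toNat

/-- The dimension of the slots. -/
def slotDim (M : DecMat n) (p : ℕ) (x : Fin n × Fin n) : ℕ :=
  if x.1 = x.2 then (M.A x.1 x.2 + p).toNat else 1

lemma DecMat.shift_A (M : DecMat n) (p : ℕ) (x : Fin n × Fin n) :
    (M.shift p).A x.1 x.2 = M.A x.1 x.2 + if x.1 = x.2 then (p : ℤ) else 0 := by
  simp only [DecMat.shift, Matrix.add_apply, Matrix.diagonal_apply]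

lemma slotMult_mul_slotDim {M : DecMat n} {p : ℕ} (h : ∀ i, 0 ≤ (M.shift p).A i i)
    (x : Fin n × Fin n) : (slotMult M x : ℤ) * slotDim M p x = (M.shift p).A x.1 x.2 := by
  rw [slotMult, slotDim, M.shift_A p x]
  split_ifs with hx
  · have := h x.1
    have h2 := M.shift_A p (x.1, x.1)
    simp only [if_true] at h2
    rw [h2] at this
    rw [← hx, Int.toNat_of_nonneg this]
    simp
  · rw [Int.toNat_of_nonneg (M.offDiag_nonneg _ _ hx)]
    simp

/-- `L` lists the cells according to `slotMult`. -/
structure IsSlots (M : DecMat n) (N : ℕ) (L : ℕ → Fin n × Fin n) : Prop where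
  sorted : LexSorted N L
  sum_eq : ∀ G : Fin n × Fin n → ℤ, ∑ r ∈ Finset.range N, G (L r) = ∑ x, slotMult M x * G x

/-- The row beginning at the position `y`. -/
def rowAt (N : ℕ) (L : ℕ → Fin n × Fin n) (y : ℕ) : ℕ := if y < N then (L y).1 else n

namespace IsSlots

variable {M : DecMat n} {N : ℕ} {L : ℕ → Fin n × Fin n}

lemma sum_ite_eq (h : IsSlots M N L) {p : ℕ} (hp : ∀ i, 0 ≤ (M.shift p).A i i)
    (P : Fin n × Fin n → Prop) [DecidablePred P] :
    ∑ r ∈ Finset.range N, (if P (L r) then (slotDim M p (L r) : ℤ) else 0) =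
      ∑ x : Fin n × Fin n, if P x then (M.shift p).A x.1 x.2 else 0 := by
  rw [h.sum_eq fun x => if P x then (slotDim M p x : ℤ) else 0]
  refine Finset.sum_congr rfl fun x _ => ?_
  rw [← slotMult_mul_slotDim hp]
  split_ifs <;> simp

lemma exists_slot (h : IsSlots M N L) {x : Fin n × Fin n} (hx : 0 < slotMult M x) :
    ∃ r < N, L r = x := by
  by_contra! hne
  have h1 := h.sum_eq fun y => if y = x then 1 else 0
  rw [Finset.sum_eq_zero fun r hr => if_neg (hne r (Finset.mem_range.1 hr))] at h1
  simp only [mul_ite, mul_one, mul_zero, Finset.sum_ite_eq', Finset.mem_univ, if_true] at h1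
  omega

lemma diagOnce (h : IsSlots M N L) : DiagOnce N L := fun f => by
  rw [h.sum_eq fun x => if x.1 = x.2 then f x.1 else 0, Fintype.sum_prod_type]
  refine Finset.sum_congr rfl fun a _ => ?_
  simp [slotMult]

lemma colCount_rowCut (h : IsSlots M N L) {p : ℕ} (hp : ∀ i, 0 ≤ (M.shift p).A i i) (i j : ℕ) :
    (colCount (slotDim M) p L (rowCut N L i) j : ℤ) = rankSum (M.shift p).A i j := by
  rw [colCount, rowCut, sum_range_cut h.sorted.row_le, rankSum, ← h.sum_ite_eq hp]
  push_cast
  refine Finset.sum_congr rfl fun r _ => ?_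
  rw [ite_and]

lemma sum_slotDim (h : IsSlots M N L) {p : ℕ} (hp : ∀ i, 0 ≤ (M.shift p).A i i) (i : ℕ) :
    ((∑ s ∈ Finset.range (rowCut N L i), slotDim M p (L s) : ℕ) : ℤ) = rankSum (M.shift p).A i n := by
  rw [← h.colCount_rowCut hp, colCount]
  push_cast
  exact Finset.sum_congr rfl fun r _ => by rw [if_pos (L r).2.2]

/-- Every row has its diagonal slot, even when the diagonal entry is zero. No row is empty, so the
position at which a row begins determines the row. -/
lemma rowAt_rowCut (h : IsSlots M N L) {i : ℕ} (hi : i ≤ n) : rowAt N L (rowCut N L i) = i := by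
  rcases hi.lt_or_eq with hi | rfl
  · obtain ⟨r, hr, hLr⟩ := h.exists_slot (x := (⟨i, hi⟩, ⟨i, hi⟩)) (by simp [slotMult])
    have h1 : ¬ r < rowCut N L i := fun h1 => by
      have := (lt_cut_iff h.sorted.row_le hr i).1 h1
      rw [hLr] at this
      exact lt_irrefl _ this
    have h2 : rowCut N L i < N := (not_lt.1 h1).trans_lt hr
    rw [rowAt, if_pos h2]
    have h3 := h.sorted.row_le _ _ (not_lt.1 h1) hr
    rw [hLr] at h3
    refine le_antisymm h3 (not_lt.1 fun h4 => ?_)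
    exact lt_irrefl _ ((lt_cut_iff h.sorted.row_le h2 i).2 h4)
  · rw [rowCut_last, rowAt, if_neg (lt_irrefl _)]

variable {K V : Type} [Field K] [AddCommGroup V] [Module K V] {F F'' : Flag K n V} {p : ℕ}

lemma mem_posSet_iff (h : IsSlots M N L) (hp : ∀ i, 0 ≤ (M.shift p).A i i) :
    F'' ∈ posSet (slotDim M) p L (rowEnds N L) (fun y => F.seq (rowAt N L y)) ↔
      ∀ i ≤ n, ∀ j, (finrank K ↥(F.seq i ⊓ F''.seq j) : ℤ) = rankSum (M.shift p).A i j := by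
  constructor
  · intro hF i hi j
    have hg : (fun y => F.seq (rowAt N L y)) (rowCut N L i) = F.seq i :=
      congrArg F.seq (h.rowAt_rowCut hi)
    have := hF _ (rowCut_mem hi) j
    rw [hg] at this
    rw [this, h.colCount_rowCut hp]
  · intro hF y hy j
    obtain ⟨i, hi, rfl⟩ := Finset.mem_image.1 hy
    have hi : i ≤ n := Nat.lt_succ_iff.1 (Finset.mem_range.1 hi)
    have hg : (fun y => F.seq (rowAt N L y)) (rowCut N L i) = F.seq i :=
      congrArg F.seq (h.rowAt_rowCut hi)
    rw [hg]
    have := hF i hi j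
    rw [← h.colCount_rowCut hp] at this
    exact_mod_cast this

/-- A cell without slots has entry zero, so it equals the sum of the two smaller neighbouring cells.
These belong to the lower set I as well, and an induction on the sum of the indices removes all such
cells from the span. -/
lemma rowSpan_eq_cellSpan [Finite V] (h : IsSlots M N L) (hp : ∀ i, 0 ≤ (M.shift p).A i i)
    {I : Set (Fin n × Fin n)} (hI : IsLowerSet I)
    (hF : ∀ i ≤ n, ∀ j, (finrank K ↥(F.seq i ⊓ F''.seq j) : ℤ) = rankSum (M.shift p).A i j) :
    rowSpan N L I (fun y => F.seq (rowAt N L y)) F'' = cellSpan F F'' I := by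
  have : Module.Finite K V := Module.Finite.of_finite
  have hterm : ∀ r, F.seq (rowAt N L (rowCut N L ((L r).1 + 1))) ⊓ F''.seq ((L r).2 + 1) =
      cell F F'' (L r) := fun r => by
    rw [h.rowAt_rowCut (L r).1.2, cell_eq]
  refine le_antisymm (iSup₂_le fun r hr => ?_) (iSup₂_le fun x hx => ?_)
  · dsimp only
    rw [hterm]
    exact le_iSup₂_of_le (L r) hr.2 le_rfl
  · induction hm : (x.1 : ℕ) + x.2 using Nat.strong_induction_on generalizing x with
    | _ m ih =>
      by_cases hmult : 0 < slotMult M x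
      · obtain ⟨r, hr, rfl⟩ := h.exists_slot hmult
        refine le_iSup₂_of_le r ⟨hr, hx⟩ ?_
        dsimp only
        rw [hterm]
      · have hd := (finrank_cell_iff _).2 hF x
        rw [← slotMult_mul_slotDim hp, Nat.eq_zero_of_not_pos hmult] at hd
        have hle : cellBelow F F'' x ≤ cell F F'' x := by rw [← cell_inf_sup]; exact inf_le_left
        have heq : cellBelow F F'' x = cell F F'' x :=
          Submodule.eq_of_le_of_finrank_eq hle (by push_cast at hd; omega)
        rw [← heq, cellBelow_eq]
        refine sup_le ?_ ?_
        · rcases hi : (x.1 : ℕ) with _ | i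
          · rw [F.seq_zero, bot_inf_eq]; exact bot_le
          · have hin : i < n := by have := x.1.2; omega
            have := ih (i + x.2) (by omega) (⟨i, hin⟩, x.2) (hI (show ((⟨i, hin⟩, x.2) : Fin n × Fin n) ≤ x from
              ⟨Fin.le_def.2 (by simp [hi]), le_rfl⟩) hx) rfl
            rwa [cell_eq] at this
        · rcases hj : (x.2 : ℕ) with _ | j
          · rw [F''.seq_zero, inf_bot_eq]; exact bot_le
          · have hjn : j < n := by have := x.2.2; omega
            have := ih (x.1 + j) (by omega) (x.1, ⟨j, hjn⟩) (hI (show ((x.1, ⟨j, hjn⟩) : Fin n × Fin n) ≤ x from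
              ⟨le_rfl, Fin.le_def.2 (by simp [hj])⟩) hx) rfl
            rwa [cell_eq] at this

end IsSlots

lemma isLowerSet_shadow_diff (M : DecMat n) {S : Finset (Fin n × Fin n)} (hS : S ⊆ M.Δ) :
    IsLowerSet (shadow M.Δ \ (S : Set (Fin n × Fin n))) := by
  intro x y hyx hx
  refine ⟨isLowerSet_shadow _ hyx hx.1, fun hyS => hx.2 ?_⟩
  obtain ⟨z, hz, hxz⟩ := hx.1
  have hy := hS hyS
  have : y = z := by_contra fun hne => by
    have hyz := hyx.trans hxz
    rcases M.chain y hy z hz hne with h | h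
    · exact absurd hyz.2 (not_le.2 h.2)
    · exact absurd hyz.1 (not_le.2 h.1)
  subst this
  rwa [le_antisymm hxz hyx]

lemma leftMult_eq_sum {M : DecMat n} {N : ℕ} {L : ℕ → Fin n × Fin n} (h : IsSlots M N L) {p : ℕ}
    (hp : ∀ i, 0 ≤ (M.shift p).A i i) (Φ : FlagFun n) (c : FiltSpace n) (F : Flag c.K n c.V) (w : c.V) :
    leftMult M Φ c p F w = ∑ S ∈ M.Δ.powerset, (((-1) ^ S.card : ℤ) : ℚ) *
      fillSum N L (slotDim M) (rowEnds N L) (shadow M.Δ \ S) Φ c p (fun y => F.seq (rowAt N L y)) w := by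
  classical
  unfold leftMult fillSum
  rw [fsum_subset (Set.subset_univ
    (posSet (slotDim M) p L (rowEnds N L) fun y => F.seq (rowAt N L y)))]
  · simp only [← fsum_mul_left, ← fsum_sum]
    refine fsum_congr rfl fun F'' hF => ?_
    rw [h.mem_posSet_iff hp] at hF
    have h1 : ∀ S ∈ M.Δ.powerset, (fsum (rowSpan N L (shadow M.Δ \ S) (fun y => F.seq (rowAt N L y)) F'' : Set c.V)
        fun μ => (((-1) ^ S.card : ℤ) : ℚ) * Φ c p F'' (w - μ)) =
        fsum Set.univ fun μ : c.V => (if μ ∈ cellSpan F F'' (shadow M.Δ \ S) then 1 else 0) *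
          ((((-1) ^ S.card : ℤ) : ℚ) * Φ c p F'' (w - μ)) := fun S hS => by
      rw [h.rowSpan_eq_cellSpan hp (isLowerSet_shadow_diff M (Finset.mem_powerset.1 hS)) hF]
      exact (fsum_indicator _ _).symm
    rw [Finset.sum_congr rfl h1, ← fsum_sum]
    refine fsum_congr rfl fun μ _ => ?_
    rw [charFun_eq_sum hF]
    push_cast
    rw [Finset.sum_mul]
    refine Finset.sum_congr rfl fun S _ => ?_
    by_cases hc : μ ∈ cellSpan F F'' (shadow M.Δ \ (S : Set (Fin n × Fin n)))
    · rw [if_pos hc, if_pos (show μ ∈ cellSpan F F'' (shadow (M.shift p).Δ \ S) from hc)]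
      ring
    · rw [if_neg hc, if_neg (show μ ∉ cellSpan F F'' (shadow (M.shift p).Δ \ S) from hc)]
      ring
  · intro F'' _ hF
    rw [h.mem_posSet_iff hp] at hF
    rw [fsum_const (c := 0), mul_zero]
    intro μ _
    rw [charFun, if_neg fun h => hF ((inOrbit_iff _).1 h).1]
    simp

/-- Inclusion-exclusion over the decoration writes the operator as a combination of the sums treated
in `FTame.fillSum`, with signs independent of q and p. -/
lemma FTame.leftMult {𝓕 : Filter ℕ} (hn : 0 < n) {M : DecMat n}
    (hM : ∀ᶠ p : ℕ in 𝓕, ∀ i, 0 ≤ (M.shift p).A i i) {Φ : FlagFun n} (hΦ : FTame 𝓕 Φ) :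
    FTame 𝓕 (leftMult M Φ) := by
  obtain ⟨N, L, h1, h2⟩ := exists_labels hn (slotMult M)
  have h : IsSlots M N L := ⟨h1, h2⟩
  intro ρ m
  -- The row sums of M must match the dimensions of the members of F; otherwise no flag is in the
  -- required position and the value is zero for all p.
  by_cases hro : ∀ i ≤ n, ρ i n = rankSum M.A i n
  · have hδ : ∀ p x, x.1 ≠ x.2 → slotDim M p x = 1 := fun p x hx => if_neg hx
    have hfill : ∀ S : Finset (Fin n × Fin n), ∃ φ, S ∈ M.Δ.powerset → Tm φ ∧ ∀ᶠ p in 𝓕,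
        ∀ (c : FiltSpace n) g w, chainDom N (slotDim M) (rowEnds N L) L c p g →
          Typed (diagPat L) (rowEnds N L) (fun y => ρ (rowAt N L y)) (fun y => m (rowAt N L y)) c p g w →
          Mirabolic.fillSum N L (slotDim M) (rowEnds N L) (shadow M.Δ \ S) Φ c p g w = φ c.q p := fun S => by
      by_cases hS : S ∈ M.Δ.powerset
      · obtain ⟨φ, hφ⟩ := FTame.fillSum (δ := slotDim M) hΦ hδ h.diagOnce h.sorted
          (isLowerSet_shadow_diff M (Finset.mem_powerset.1 hS)) (Finset.Subset.refl _) (fun y hy => by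
            obtain ⟨i, _, rfl⟩ := Finset.mem_image.1 hy
            exact Finset.mem_range.2 (Nat.lt_succ_of_le (cut_le _ _ _)))
          (fun y => ρ (rowAt N L y)) (fun y => m (rowAt N L y))
        exact ⟨φ, fun _ => hφ⟩
      · exact ⟨fun _ _ => 0, fun h => absurd h hS⟩
    choose φ hφ using hfill
    refine ⟨_, Tm.sum M.Δ.powerset fun S hS => (Tm.const ((-1) ^ S.card)).mul (hφ S hS).1, ?_⟩
    filter_upwards [hM, (Filter.eventually_all_finset M.Δ.powerset).2 fun S hS => (hφ S hS).2]
      with p hp h3 c F w ht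
    rw [leftMult_eq_sum h hp]
    refine Finset.sum_congr rfl fun S hS => ?_
    rw [h3 S hS c]
    · refine ⟨fun y hy z hz hyz => ?_, fun y hy => ?_, ?_⟩
      · obtain ⟨i, hi, rfl⟩ := Finset.mem_image.1 hy
        obtain ⟨j, hj, rfl⟩ := Finset.mem_image.1 hz
        have hi : i ≤ n := Nat.lt_succ_iff.1 (Finset.mem_range.1 hi)
        have hj : j ≤ n := Nat.lt_succ_iff.1 (Finset.mem_range.1 hj)
        dsimp only
        rw [h.rowAt_rowCut hi, h.rowAt_rowCut hj]
        by_cases hij : i ≤ j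
        · exact F.seq_mono hij
        · have := le_antisymm hyz (cut_mono N _ (by omega : j ≤ i))
          have h4 := h.rowAt_rowCut hi
          rw [this, h.rowAt_rowCut hj] at h4
          omega
      · obtain ⟨i, hi, rfl⟩ := Finset.mem_image.1 hy
        have hi : i ≤ n := Nat.lt_succ_iff.1 (Finset.mem_range.1 hi)
        have h4 := (ht i hi).finrank_eq c.top
        have hg : (fun y => F.seq (rowAt N L y)) (rowCut N L i) = F.seq i :=
          congrArg F.seq (h.rowAt_rowCut hi)
        rw [hg]
        have h5 := h.sum_slotDim hp i
        rw [hro i hi, ← rankSum_add_diagonal _ _ hi] at h4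
        have : (finrank c.K (F.seq i) : ℤ) = rankSum (M.shift p).A i n := h4
        rw [← h5] at this
        exact_mod_cast this
      · dsimp only
        have := h.rowAt_rowCut le_rfl
        rw [rowCut_last] at this
        rw [this, F.seq_last]
    · intro y hy
      obtain ⟨i, hi, rfl⟩ := Finset.mem_image.1 hy
      have hi : i ≤ n := Nat.lt_succ_iff.1 (Finset.mem_range.1 hi)
      have hg : (fun y => F.seq (rowAt N L y)) (rowCut N L i) = F.seq i :=
        congrArg F.seq (h.rowAt_rowCut hi)
      rw [hg]
      dsimp only
      rw [h.rowAt_rowCut hi]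
      have := ht i hi
      have h4 : ∀ j, diagPat L (rowCut N L i) j = (min i j : ℕ) := fun j =>
        diagPat_cut h.diagOnce (fun x => x.1) (fun _ => rfl) h.sorted.row_le hi j
      simpa only [h4] using this
  · push Not at hro
    obtain ⟨i, hi, hne⟩ := hro
    refine ⟨_, Tm.zero, Filter.Eventually.of_forall fun p c F w ht => ?_⟩
    rw [Mirabolic.leftMult, fsum_const (c := 0), mul_zero]
    intro F'' _
    rw [fsum_const (c := 0), mul_zero]
    intro μ _
    rw [charFun, if_neg, Int.cast_zero, zero_mul]
    intro ho
    have h3 := ((inOrbit_iff _).1 ho).1 i hi n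
    rw [F''.seq_last, inf_top_eq, (ht i hi).finrank_eq c.top] at h3
    change _ = rankSum (M.A + Matrix.diagonal fun _ => (p : ℤ)) i n at h3
    rw [rankSum_add_diagonal _ _ hi] at h3
    exact hne (by linarith)

/-- The term p min(i, j) appears both in the prescribed type and in the shifted matrix, and cancels.
The value is therefore 0 or 1 independently of q and p. -/
lemma fTame_charFun (𝓕 : Filter ℕ) (M : DecMat n) :
    FTame 𝓕 fun c p F w => (charFun (M.shift p) F c.flag w : ℚ) := by
  classical
  intro ρ m
  refine ⟨_, Tm.ite (∀ i ≤ n, (∀ j, ρ i j = rankSum M.A i j) ∧ m i = threshold M.Δ i) Tm.one Tm.zero,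
    Filter.Eventually.of_forall fun p c F w ht => ?_⟩
  dsimp only [charFun]
  have : InOrbit (M.shift p) F c.flag w ↔
      ∀ i ≤ n, (∀ j, ρ i j = rankSum M.A i j) ∧ m i = threshold M.Δ i := by
    rw [inOrbit_iff_hasType]
    refine forall_congr' fun i => forall_congr' fun hi => ?_
    obtain ⟨h1, h2⟩ := ht i hi
    have h3 : ∀ j, rankSum (M.shift p).A i j = rankSum M.A i j + p * (min i j : ℕ) := fun j =>
      rankSum_add_diagonal M.A p hi j
    have h4 : c.flag.seq = c.E := funext c.flag_seq
    rw [h4]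
    constructor
    · rintro ⟨h5, h6⟩
      refine ⟨fun j => ?_, ?_⟩
      · have := h5 j
        rw [h1 j, h3] at this
        linarith
      · exact le_antisymm ((h2 _).1 ((h6 _).2 le_rfl)) ((h6 _).1 ((h2 _).2 le_rfl))
    · rintro ⟨h5, h6⟩
      refine ⟨fun j => ?_, fun j => ?_⟩
      · rw [h1 j, h3, ← h5]
      · rw [h2 j, h6]; rfl
  by_cases hc : InOrbit (M.shift p) F c.flag w
  · rw [if_pos hc, if_pos (this.1 hc)]; simp
  · rw [if_neg hc, if_neg (fun h => hc (this.2 h))]; simp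

end Mirabolic

/-! ### Convolution of two orbits, and the stock of orbits -/

namespace Mirabolic

open Module

variable {n : ℕ}

lemma DecMat.shift_zero (M : DecMat n) : M.shift 0 = M := by
  ext <;> simp [DecMat.shift]

section

variable {K : Type} [Field K] {V : Type} [AddCommGroup V] [Module K V]

/-- A space with the filtration given by a flag. -/
def FiltSpace.ofFlag [Finite K] [Finite V] (F : Flag K n V) : FiltSpace n where
  K := K
  V := V
  E := F.seq
  mono := F.seq_mono
  zero := F.seq_zero
  top := F.seq_last

lemma FiltSpace.flag_ofFlag [Finite K] [Finite V] (F : Flag K n V) : (FiltSpace.ofFlag F).flag = F :=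
  Flag.ext_seq fun i _ => (FiltSpace.ofFlag F).flag_seq i

lemma conv_eq_sum [Fintype (Flag K n V)] [Fintype V] (g h : Flag K n V → Flag K n V → V → ℤ)
    (F F' : Flag K n V) (w : V) : conv g h F F' w = ∑ F'', ∑ μ, g F F'' μ * h F'' F' (w - μ) := by
  rw [conv, finsum_eq_sum_of_fintype, Fintype.sum_prod_type]

lemma fsum_univ {α : Type*} [Fintype α] (f : α → ℚ) : fsum Set.univ f = ∑ a, f a :=
  Finset.sum_congr (by ext; simp) fun _ _ => rfl

lemma conv_eq_leftMult [Finite K] [Finite V] (M N : DecMat n) (p : ℕ) (F F' : Flag K n V) (w : V) :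
    ((conv (charFun (M.shift p)) (charFun (N.shift p)) F F' w : ℤ) : ℚ) =
      leftMult M (fun c p F w => (charFun (N.shift p) F c.flag w : ℚ)) (FiltSpace.ofFlag F') p F w := by
  have : Fintype (Flag K n V) := Fintype.ofFinite _
  have : Fintype V := Fintype.ofFinite _
  rw [conv_eq_sum]
  push_cast
  refine (Eq.trans ?_ (fsum_univ (α := Flag K n V) _).symm)
  refine Finset.sum_congr rfl fun F'' _ => (Eq.trans ?_ (fsum_univ (α := V) _).symm)
  exact Finset.sum_congr rfl fun μ _ => congrArg (fun G : Flag K n V =>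
    ((charFun (M.shift p) F F'' μ : ℤ) : ℚ) * ((charFun (N.shift p) F'' G (w - μ) : ℤ) : ℚ))
    (FiltSpace.flag_ofFlag F').symm

lemma tame_conv (hn : 0 < n) {𝓕 : Filter ℕ} (M N P : DecMat n)
    (hM : ∀ᶠ p : ℕ in 𝓕, ∀ i, 0 ≤ (M.shift p).A i i) :
    ∃ φ, Tm φ ∧ ∀ᶠ p in 𝓕, ∀ (K : Type) [Field K] [Finite K] (V : Type) [AddCommGroup V]
      [Module K V] [Finite V] (F F' : Flag K n V) (w : V), InOrbit (P.shift p) F F' w →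
        ((conv (charFun (M.shift p)) (charFun (N.shift p)) F F' w : ℤ) : ℚ) = φ (Nat.card K) p := by
  obtain ⟨φ, h1, h2⟩ := FTame.leftMult hn hM (fTame_charFun 𝓕 N) (rankSum P.A) (threshold P.Δ)
  refine ⟨φ, h1, ?_⟩
  filter_upwards [h2] with p h2 K _ _ V _ _ _ F F' w ho
  rw [conv_eq_leftMult]
  refine h2 (FiltSpace.ofFlag F') F w fun i hi => ?_
  have h3 := (inOrbit_iff_hasType _).1 ho i hi
  have h4 : rankSum (P.shift p).A i = fun j => rankSum P.A i j + p * (min i j : ℕ) :=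
    funext fun j => rankSum_add_diagonal P.A p hi j
  rw [h4] at h3
  exact h3

end

/-! ### Existence and uniqueness of orbits -/

section

variable {K : Type} [Field K]

/-- The functions vanishing outside `S`. -/
def coordSub (K : Type) [Field K] {d : ℕ} (S : Set (Fin d)) : Submodule K (Fin d → K) :=
  ⨅ t ∈ Sᶜ, LinearMap.ker (LinearMap.proj t : (Fin d → K) →ₗ[K] K)

lemma mem_coordSub {d : ℕ} {S : Set (Fin d)} {f : Fin d → K} : f ∈ coordSub K S ↔ ∀ t ∉ S, f t = 0 := by
  simp [coordSub, Submodule.mem_iInf]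

lemma coordSub_mono {d : ℕ} {S T : Set (Fin d)} (h : S ⊆ T) : coordSub K S ≤ coordSub K T :=
  fun _ hf => mem_coordSub.2 fun t ht => mem_coordSub.1 hf t fun hS => ht (h hS)

lemma coordSub_inter {d : ℕ} (S T : Set (Fin d)) : coordSub K (S ∩ T) = coordSub K S ⊓ coordSub K T := by
  ext f
  rw [Submodule.mem_inf, mem_coordSub, mem_coordSub, mem_coordSub]
  constructor
  · exact fun h => ⟨fun t ht => h t fun h' => ht h'.1, fun t ht => h t fun h' => ht h'.2⟩
  · rintro ⟨h1, h2⟩ t ht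
    by_cases h : t ∈ S
    · exact h2 t fun h' => ht ⟨h, h'⟩
    · exact h1 t h

open Classical in
lemma finrank_coordSub {d : ℕ} (S : Set (Fin d)) :
    finrank K (coordSub K S) = ∑ t : Fin d, if t ∈ S then 1 else 0 := by
  have e : coordSub K S ≃ₗ[K] (S → K) := LinearMap.iInfKerProjEquiv K (fun _ => K)
    disjoint_compl_right (by rw [Set.union_compl_self])
  rw [e.finrank_eq, finrank_pi, ← Finset.card_filter, Fintype.card_subtype]

/-- The coordinate flag with the `t`-th basis vector in step `l t + 1`. -/
def coordFlag (K : Type) [Field K] {d : ℕ} (l : Fin d → Fin n) : Flag K n (Fin d → K) :=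
  Flag.ofSeq (fun i => coordSub K {t | (l t : ℕ) < i})
    (by rw [eq_bot_iff]; exact fun f hf => funext fun t => mem_coordSub.1 hf t (by simp))
    (by rw [eq_top_iff]; exact fun f _ => mem_coordSub.2 fun t ht => absurd (l t).2 ht)
    (fun i j hij _ => coordSub_mono fun t ht => lt_of_lt_of_le ht hij)

lemma coordFlag_seq {d : ℕ} (l : Fin d → Fin n) (i : ℕ) :
    (coordFlag K l).seq i = coordSub K {t | (l t : ℕ) < i} := by
  by_cases hi : i ≤ n
  · exact Flag.ofSeq_seq _ _ _ _ hi
  · rw [Flag.seq_of_le _ (by omega), eq_comm, eq_top_iff]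
    exact fun f _ => mem_coordSub.2 fun t ht => absurd ((l t).2.trans (not_le.1 hi)) ht

/-- Label the d basis vectors by cells, each as often as its entry. The two coordinate flags given
by rows and by columns, and a sum of one basis vector for each cell of Δ, lie in the orbit. -/
lemma exists_inOrbit (hn : 0 < n) {d : ℕ} (M : Xi n d) (K : Type) [Field K] [Finite K] :
    ∃ (F F' : Flag K n (Fin d → K)) (w : Fin d → K), InOrbit M.1 F F' w := by
  classical
  obtain ⟨N, L, -, hsum⟩ := exists_labels hn fun x => (M.1.A x.1 x.2).toNat
  have hcast : ∀ x : Fin n × Fin n, ((M.1.A x.1 x.2).toNat : ℤ) = M.1.A x.1 x.2 := fun x =>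
    Int.toNat_of_nonneg (M.2.nonneg _ _)
  simp only [hcast] at hsum
  have hNd : N = d := by
    have h1 := hsum fun _ => 1
    have h2 : ∑ x : Fin n × Fin n, M.1.A x.1 x.2 = d := by
      rw [Fintype.sum_prod_type]; exact M.2.total
    simp only [Finset.sum_const, Finset.card_range, mul_one, nsmul_eq_mul, h2] at h1
    exact_mod_cast h1
  subst hNd
  let l : Fin N → Fin n × Fin n := fun t => L t
  have hsum' : ∀ G : Fin n × Fin n → ℤ, ∑ t, G (l t) = ∑ x : Fin n × Fin n, M.1.A x.1 x.2 * G x :=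
    fun G => by rw [← hsum, Fin.sum_univ_eq_sum_range fun r => G (L r)]
  have hex : ∀ x, ∃ f : Fin N → K, x ∈ M.1.Δ → ∃ t, l t = x ∧ f = Pi.single t 1 := by
    intro x
    by_cases hx : x ∈ M.1.Δ
    · by_contra! hne
      have h0 : ∀ t, l t ≠ x := fun t ht => (hne (Pi.single t 1)).2 t ht rfl
      have h1 := hsum' fun y => if y = x then 1 else 0
      rw [Finset.sum_eq_zero fun t _ => if_neg (h0 t)] at h1
      simp only [mul_ite, mul_one, mul_zero, Finset.sum_ite_eq', Finset.mem_univ, if_true] at h1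
      have := M.2.pos x hx
      omega
    · exact ⟨0, fun h => absurd h hx⟩
  choose ω hω using hex
  refine ⟨coordFlag K fun t => (l t).1, coordFlag K fun t => (l t).2,
    ∑ x ∈ M.1.Δ, ω x, ?_, ω, fun x hx => ?_, rfl⟩
  · rw [finrank_cell_iff]
    intro i _ j
    rw [coordFlag_seq, coordFlag_seq, ← coordSub_inter, finrank_coordSub, rankSum]
    have := hsum' fun x => if (x.1 : ℕ) < i ∧ (x.2 : ℕ) < j then 1 else 0
    push_cast
    simp only [mul_ite, mul_one, mul_zero] at this
    rw [← this]
    rfl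
  · obtain ⟨t, rfl, ht⟩ := hω x hx
    rw [← cell_inf_sup, cell_eq, coordFlag_seq, coordFlag_seq, coordFlag_seq, coordFlag_seq,
      ← coordSub_inter, ht]
    refine ⟨mem_coordSub.2 fun s hs => Pi.single_eq_of_ne ?_ 1, fun h => ?_⟩
    · rintro rfl
      exact hs ⟨Nat.lt_succ_self _, Nat.lt_succ_self _⟩
    · have h2 : coordSub K {s | ((l s).1 : ℕ) < (l t).1} ⊔ coordSub K {s | ((l s).2 : ℕ) < (l t).2} ≤
          coordSub K {t}ᶜ := by
        refine sup_le (coordSub_mono ?_) (coordSub_mono ?_) <;>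
        · rintro s hs rfl
          simp at hs
      have h3 := mem_coordSub.1 (h2 h.2) t (by simp)
      simp at h3

variable {V : Type} [AddCommGroup V] [Module K V] [Finite V] {F F' : Flag K n V} {w : V}

/-- The matrix is read off from dimensions. The decoration consists of the maximal bad cells, so it
is determined by its shadow. -/
lemma InOrbit.unique {M N : DecMat n} (hM : InOrbit M F F' w) (hN : InOrbit N F F' w) : M = N := by
  have hsub : ∀ {M N : DecMat n}, shadow M.Δ = shadow N.Δ → M.Δ ⊆ N.Δ := by
    intro M N h x hx
    obtain ⟨y, hy, hxy⟩ : x ∈ shadow N.Δ := h ▸ ⟨x, hx, le_rfl⟩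
    obtain ⟨z, hz, hyz⟩ : y ∈ shadow M.Δ := h ▸ ⟨y, hy, le_rfl⟩
    have hxz : x = z := by
      by_contra hne
      have := hxy.trans hyz
      rcases M.chain x hx z hz hne with h | h
      · exact absurd this.2 (not_le.2 h.2)
      · exact absurd this.1 (not_le.2 h.1)
    rwa [le_antisymm hxy (hxz ▸ hyz)]
  have h1 := ((inOrbit_iff _).1 hM).2
  have h2 := ((inOrbit_iff _).1 hN).2
  refine DecMat.ext ?_ (Finset.Subset.antisymm (hsub (h1 ▸ h2)) (hsub (h2 ▸ h1)))
  ext i j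
  have h3 := hM.1 (i, j)
  have h4 := hN.1 (i, j)
  dsimp only at h3 h4
  omega

/-- The decoration has to be the set of maximal bad cells; maximal elements are pairwise
incomparable, which is the required chain condition. -/
lemma exists_inOrbit_of (F F' : Flag K n V) (w : V) :
    ∃ M : Xi n (finrank K V), InOrbit M.1 F F' w := by
  classical
  have : Module.Finite K V := Module.Finite.of_finite
  have hfin := (badCells F F' w).toFinite
  let T : Finset (Fin n × Fin n) := hfin.toFinset
  let Δ : Finset (Fin n × Fin n) := T.filter fun x => ∀ y ∈ T, x ≤ y → y ≤ x
  have hΔ : ∀ x ∈ Δ, ∀ y ∈ Δ, x ≠ y → (x.1 < y.1 ∧ y.2 < x.2) ∨ (y.1 < x.1 ∧ x.2 < y.2) := by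
    intro x hx y hy hne
    simp only [Δ, Finset.mem_filter] at hx hy
    have h1 : ¬ x ≤ y := fun h => hne (le_antisymm h (hx.2 y hy.1 h))
    have h2 : ¬ y ≤ x := fun h => hne (le_antisymm (hy.2 x hx.1 h) h)
    rcases lt_trichotomy x.1 y.1 with h | h | h
    · exact Or.inl ⟨h, not_le.1 fun h' => h1 ⟨h.le, h'⟩⟩
    · rcases le_total x.2 y.2 with h' | h'
      · exact absurd ⟨h.le, h'⟩ h1
      · exact absurd ⟨h.ge, h'⟩ h2
    · exact Or.inr ⟨h, not_le.1 fun h' => h2 ⟨h.le, h'⟩⟩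
  have hsh : badCells F F' w = shadow Δ := by
    refine Set.Subset.antisymm (fun x hx => ?_) ?_
    · obtain ⟨y, hxy, hy⟩ := T.exists_le_maximal (hfin.mem_toFinset.2 hx)
      exact ⟨y, Finset.mem_filter.2 ⟨hy.1, fun z hz hyz => hy.2 hz hyz⟩, hxy⟩
    · rintro x ⟨y, hy, hxy⟩
      exact isLowerSet_badCells hxy (hfin.mem_toFinset.1 (Finset.mem_filter.1 hy).1)
  obtain ⟨ω, hω, hw⟩ := (exists_decomposition_iff hΔ).2 hsh
  let A : Matrix (Fin n) (Fin n) ℤ := fun i j =>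
    (finrank K (cell F F' (i, j)) : ℤ) - finrank K (cellBelow F F' (i, j))
  have hle : ∀ x, cellBelow F F' x ≤ cell F F' x := fun x => by
    rw [← cell_inf_sup]; exact inf_le_left
  have hA : ∀ i j, 0 ≤ A i j := fun i j => by
    have := Submodule.finrank_mono (hle (i, j))
    simp only [A]
    omega
  have hpos : ∀ x ∈ Δ, 0 < A x.1 x.2 := fun ⟨i, j⟩ hx => by
    have := Submodule.finrank_lt_finrank_of_lt (lt_of_le_of_ne (hle (i, j)) fun h =>
      (hω _ hx).2 (h ▸ (hω _ hx).1))
    simp only [A]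
    omega
  let M : DecMat n := ⟨A, Δ, fun i j _ => hA i j, hΔ, fun x hx _ => hpos x hx⟩
  have hM : InOrbit M F F' w := ⟨fun x => by simp [M, A], ω, hω, hw⟩
  refine ⟨⟨M, hA, hpos, ?_⟩, hM⟩
  have h := ((inOrbit_iff _).1 hM).1 n le_rfl n
  rw [F.seq_last, F'.seq_last, inf_top_eq, finrank_top] at h
  rw [h, rankSum, Fintype.sum_prod_type]
  exact Finset.sum_congr rfl fun i _ => Finset.sum_congr rfl fun j _ => by
    rw [if_pos ⟨i.2, j.2⟩]

end

end Mirabolic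

namespace Mirabolic

open Module

variable {n : ℕ}

/-! ### Polynomials determined by their values at primes -/

open Polynomial in
lemma eq_of_eval_prime {f g : ℤ[X]} (h : ∀ q : ℕ, q.Prime → f.eval (q : ℤ) = g.eval (q : ℤ)) : f = g := by
  refine Polynomial.eq_of_infinite_eval_eq f g ?_
  refine Set.Infinite.mono (s := (fun q : ℕ => (q : ℤ)) '' {q | q.Prime}) ?_
    (Nat.infinite_setOfPred_prime.image fun _ _ _ _ h => by exact_mod_cast h)
  rintro _ ⟨q, hq, rfl⟩
  exact h q hq

open Polynomial in
lemma eventually_abs_eval_lt {b r : ℤ[X]} (h : r.degree < b.degree) :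
    ∀ᶠ q : ℕ in Filter.atTop, |r.eval (q : ℤ)| < |b.eval (q : ℤ)| := by
  have hinj : Function.Injective (Int.castRingHom ℝ) := Int.cast_injective
  have h1 : (r.map (Int.castRingHom ℝ)).degree < (b.map (Int.castRingHom ℝ)).degree := by
    rwa [degree_map_eq_of_injective hinj, degree_map_eq_of_injective hinj]
  have h2 := (Polynomial.div_tendsto_atTop_zero_of_degree_lt _ _ h1).comp
    (tendsto_natCast_atTop_atTop (R := ℝ))
  have hb : b ≠ 0 := fun hb => by simp [hb] at h
  have h3 : ∀ᶠ q : ℕ in Filter.atTop, b.eval (q : ℤ) ≠ 0 := by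
    have hfin : {q : ℕ | b.eval (q : ℤ) = 0}.Finite := by
      refine Set.Finite.of_finite_image (f := fun q : ℕ => (q : ℤ)) ?_ fun _ _ _ _ h => by simpa using h
      refine (b.roots.toFinset.finite_toSet).subset ?_
      rintro _ ⟨q, hq, rfl⟩
      simpa [hb] using hq
    rw [← Nat.cofinite_eq_atTop]
    exact hfin.compl_mem_cofinite
  filter_upwards [h2.eventually (Metric.ball_mem_nhds 0 one_pos), h3] with q hq hbq
  have hcast : ∀ f : ℤ[X], (f.map (Int.castRingHom ℝ)).eval (q : ℝ) = ((f.eval (q : ℤ) : ℤ) : ℝ) := by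
    intro f
    simp
  rw [dist_zero_right, Real.norm_eq_abs, Function.comp, hcast, hcast, abs_div] at hq
  rw [div_lt_one (abs_pos.2 (by exact_mod_cast hbq))] at hq
  exact_mod_cast hq

open Polynomial in
-- Divide a by the monic b. At a prime q the remainder is divisible by b(q) since a/b is integral
-- there, but for large q it is smaller than b(q) in absolute value. It thus vanishes at infinitely
-- many points and is zero.
lemma TmBy.exists_poly {φ : ℕ → ℕ → ℚ} {G : 𝔑} (h : TmBy φ G) {p : ℕ}
    (hz : ∀ q : ℕ, q.Prime → ∃ z : ℤ, φ q p = z) :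
    ∃ f : ℤ[X], (∀ q : ℕ, 2 ≤ q → φ q p = (f.eval (q : ℤ) : ℤ)) ∧ evalPow (-(p : ℤ)) G = evSq f := by
  obtain ⟨a, b, hb, hb0, hφ, hG⟩ := h p
  have hdiv := Polynomial.modByMonic_add_div a b
  have hr : a %ₘ b = 0 := by
    refine Polynomial.eq_zero_of_infinite_isRoot _ ?_
    obtain ⟨q₀, hq₀⟩ := Filter.eventually_atTop.1 (eventually_abs_eval_lt (degree_modByMonic_lt a hb))
    have hinf : {q : ℕ | q.Prime ∧ q₀ ≤ q}.Infinite := by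
      rw [Set.infinite_iff_exists_gt]
      intro m
      obtain ⟨q, h1, h2⟩ := Nat.exists_infinite_primes (m + 1 + q₀)
      exact ⟨q, ⟨h2, by omega⟩, by omega⟩
    refine Set.Infinite.mono (s := (fun q : ℕ => (q : ℤ)) '' {q | q.Prime ∧ q₀ ≤ q}) ?_
      (hinf.image fun _ _ _ _ h => by exact_mod_cast h)
    rintro _ ⟨q, ⟨hq, hqq⟩, rfl⟩
    obtain ⟨z, hz⟩ := hz q hq
    have h1 := hφ q hq.two_le
    rw [hz] at h1
    have h2 : z * b.eval (q : ℤ) = a.eval (q : ℤ) := by exact_mod_cast h1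
    have h3 : a.eval (q : ℤ) = (a %ₘ b).eval (q : ℤ) + b.eval (q : ℤ) * (a /ₘ b).eval (q : ℤ) := by
      conv_lhs => rw [← hdiv]
      simp
    have h4 := hq₀ q hqq
    have h5 : (a %ₘ b).eval (q : ℤ) = b.eval (q : ℤ) * (z - (a /ₘ b).eval (q : ℤ)) := by
      linear_combination -h3 - h2
    by_contra h6
    exact absurd (Int.le_of_dvd (abs_pos.2 h6) ((abs_dvd_abs _ _).2 (h5 ▸ dvd_mul_right _ _))) (not_le.2 h4)
  rw [hr, zero_add] at hdiv
  refine ⟨a /ₘ b, fun q hq => ?_, ?_⟩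
  · have h1 := hφ q hq
    have h2 : ((b.eval (q : ℤ) : ℤ) : ℚ) ≠ 0 := by exact_mod_cast hb0 q hq
    refine mul_right_cancel₀ h2 (h1.trans ?_)
    rw [← Int.cast_mul]
    conv_lhs => rw [← hdiv, Polynomial.eval_mul, mul_comm]
  · have h1 : evSq b ≠ 0 := fun h => hb.ne_zero (evSq_injective (h.trans (map_zero _).symm))
    refine mul_right_cancel₀ h1 (hG.trans ?_)
    rw [← map_mul, mul_comm, hdiv]

/-! ### Structure polynomials -/

lemma exists_isStructurePoly (hn : 0 < n) {d : ℕ} (M N P : Xi n d) : ∃ f, IsStructurePoly M N P f := by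
  -- With the filter `pure 0`, "eventually" means p = 0, so the result for families also covers a
  -- single triple of matrices.
  obtain ⟨φ, ⟨G, hG⟩, h⟩ := tame_conv hn (𝓕 := pure 0) M.1 N.1 P.1
    (by simp only [Filter.eventually_pure, DecMat.shift_zero]; exact fun i => M.2.nonneg i i)
  simp only [Filter.eventually_pure, DecMat.shift_zero] at h
  obtain ⟨f, hf, -⟩ := hG.exists_poly (p := 0) fun q hq => by
    have : Fact q.Prime := ⟨hq⟩
    obtain ⟨F, F', w, ho⟩ := exists_inOrbit hn P (ZMod q)
    have := h (ZMod q) _ F F' w ho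
    rw [Nat.card_zmod] at this
    exact ⟨_, this.symm⟩
  refine ⟨f, fun K _ _ F F' w ho => ?_⟩
  have h1 := h K _ F F' w ho
  rw [hf _ two_le_card] at h1
  exact_mod_cast h1

lemma isStructurePoly_structPoly (hn : 0 < n) {d : ℕ} (M N P : Xi n d) :
    IsStructurePoly M N P (structPoly M N P) := by
  have h := exists_isStructurePoly hn M N P
  rw [structPoly, dif_pos h]
  exact h.choose_spec

/-- The tame function and the structure polynomial have the same values at all primes for each large
p, so the polynomial extracted from the tame function is the structure polynomial. -/
lemma exists_stable_structPoly (hn : 0 < n) (M N P : DecMat n) : ∃ G : 𝔑, ∀ᶠ p : ℕ in Filter.atTop,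
    ∀ (d : ℕ) (hM : (M.shift p).IsXi d) (hN : (N.shift p).IsXi d) (hP : (P.shift p).IsXi d),
      evSq (structPoly ⟨_, hM⟩ ⟨_, hN⟩ ⟨_, hP⟩) = evalPow (-(p : ℤ)) G := by
  have hM : ∀ᶠ p : ℕ in Filter.atTop, ∀ i, 0 ≤ (M.shift p).A i i := by
    refine Filter.eventually_all.2 fun i => ?_
    filter_upwards [Filter.eventually_ge_atTop (-M.A i i).toNat] with p hp
    have := M.shift_A p (i, i)
    simp only [if_true] at this
    omega
  obtain ⟨φ, ⟨G, hG⟩, h⟩ := tame_conv hn M N P hM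
  refine ⟨G, ?_⟩
  filter_upwards [h] with p h d hM hN hP
  have hval : ∀ q : ℕ, q.Prime → φ q p =
      ((structPoly ⟨_, hM⟩ ⟨_, hN⟩ ⟨_, hP⟩ : Polynomial ℤ).eval (q : ℤ) : ℤ) := fun q hq => by
    have : Fact q.Prime := ⟨hq⟩
    obtain ⟨F, F', w, ho⟩ := exists_inOrbit hn ⟨_, hP⟩ (ZMod q)
    have h1 := h (ZMod q) _ F F' w ho
    have h2 := isStructurePoly_structPoly hn ⟨_, hM⟩ ⟨_, hN⟩ ⟨_, hP⟩ (ZMod q) F F' w ho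
    rw [Nat.card_zmod] at h1 h2
    rw [← h1, ← h2]
  obtain ⟨f, hf, hfG⟩ := hG.exists_poly (p := p) fun q hq => ⟨_, hval q hq⟩
  rw [hfG]
  congr 1
  refine eq_of_eval_prime fun q hq => ?_
  have := hf q hq.two_le
  rw [hval q hq] at this
  exact_mod_cast this

/-! ### Associativity -/

section

variable {K : Type} [Field K] [Finite K]

lemma exists_inOrbit_fin {d : ℕ} (F F' : Flag K n (Fin d → K)) (w : Fin d → K) :
    ∃ M : Xi n d, InOrbit M.1 F F' w := by
  obtain ⟨⟨M, h⟩, hM⟩ := exists_inOrbit_of F F' w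
  have : finrank K (Fin d → K) = d := finrank_fin_fun K
  rw [this] at h
  exact ⟨⟨M, h⟩, hM⟩

lemma charFun_of_inOrbit {V : Type} [AddCommGroup V] [Module K V] [Finite V] {F F' : Flag K n V}
    {w : V} {M : DecMat n} (hM : InOrbit M F F' w) {d : ℕ} (N : Xi n d) [Decidable (N.1 = M)] :
    charFun N.1 F F' w = if N.1 = M then 1 else 0 := by
  rw [charFun]
  by_cases h : N.1 = M
  · rw [if_pos h, if_pos (h ▸ hM)]
  · rw [if_neg h, if_neg fun h' => h (h'.unique hM)]

lemma conv_assoc {V : Type} [AddCommGroup V] [Module K V] [Finite V] (f g h : Flag K n V → Flag K n V → V → ℤ) :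
    conv (conv f g) h = conv f (conv g h) := by
  have : Fintype (Flag K n V) := Fintype.ofFinite _
  have : Fintype V := Fintype.ofFinite _
  funext F F' w
  simp only [conv_eq_sum, Finset.sum_mul, Finset.mul_sum]
  have h1 : ∀ F₁ : Flag K n V, ∑ μ, ∑ F₂, ∑ ν, f F F₂ ν * g F₂ F₁ (μ - ν) * h F₁ F' (w - μ) =
      ∑ F₂, ∑ ν, ∑ μ, f F F₂ ν * (g F₂ F₁ μ * h F₁ F' (w - ν - μ)) := fun F₁ => by
    rw [Finset.sum_comm]
    refine Finset.sum_congr rfl fun F₂ _ => ?_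
    rw [Finset.sum_comm]
    refine Finset.sum_congr rfl fun ν _ => ?_
    refine Fintype.sum_equiv (Equiv.subRight ν) _ _ fun μ => ?_
    simp only [Equiv.subRight_apply, mul_assoc, sub_sub, add_sub_cancel]
  simp only [h1]
  rw [Finset.sum_comm]
  refine Finset.sum_congr rfl fun F₂ _ => ?_
  rw [Finset.sum_comm]

lemma conv_sum_left {V : Type} [AddCommGroup V] [Module K V] [Finite V] {ι : Type*} (s : Finset ι)
    (a : ι → ℤ) (f : ι → Flag K n V → Flag K n V → V → ℤ) (h : Flag K n V → Flag K n V → V → ℤ) :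
    conv (fun F F' w => ∑ i ∈ s, a i * f i F F' w) h =
      fun F F' w => ∑ i ∈ s, a i * conv (f i) h F F' w := by
  have : Fintype (Flag K n V) := Fintype.ofFinite _
  have : Fintype V := Fintype.ofFinite _
  funext F F' w
  simp only [conv_eq_sum, Finset.sum_mul, Finset.mul_sum]
  refine Eq.trans ?_ Finset.sum_comm
  refine Finset.sum_congr rfl fun F₁ _ => Eq.trans ?_ Finset.sum_comm
  exact Finset.sum_congr rfl fun μ _ => Finset.sum_congr rfl fun i _ => mul_assoc _ _ _

lemma conv_sum_right {V : Type} [AddCommGroup V] [Module K V] [Finite V] {ι : Type*} (s : Finset ι)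
    (a : ι → ℤ) (f : ι → Flag K n V → Flag K n V → V → ℤ) (h : Flag K n V → Flag K n V → V → ℤ) :
    conv h (fun F F' w => ∑ i ∈ s, a i * f i F F' w) =
      fun F F' w => ∑ i ∈ s, a i * conv h (f i) F F' w := by
  have : Fintype (Flag K n V) := Fintype.ofFinite _
  have : Fintype V := Fintype.ofFinite _
  funext F F' w
  simp only [conv_eq_sum, Finset.mul_sum]
  refine Eq.trans ?_ Finset.sum_comm
  refine Finset.sum_congr rfl fun F₁ _ => Eq.trans ?_ Finset.sum_comm
  exact Finset.sum_congr rfl fun μ _ => Finset.sum_congr rfl fun i _ => mul_left_comm _ _ _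

lemma conv_charFun (hn : 0 < n) {d : ℕ} (M N : Xi n d) :
    conv (charFun (K := K) (V := Fin d → K) M.1) (charFun N.1) = fun F F' w =>
      ∑ P : Xi n d, (structPoly M N P).eval (Nat.card K : ℤ) * charFun P.1 F F' w := by
  classical
  funext F F' w
  obtain ⟨Q, hQ⟩ := exists_inOrbit_fin F F' w
  rw [isStructurePoly_structPoly hn M N Q K F F' w hQ]
  simp only [charFun_of_inOrbit hQ, ← Subtype.ext_iff, mul_ite, mul_one, mul_zero]
  rw [Finset.sum_ite_eq' Finset.univ Q, if_pos (Finset.mem_univ _)]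

end

/-- Associativity of convolution evaluated at one point of the orbit of Q over each prime field. -/
lemma structPoly_assoc (hn : 0 < n) {d : ℕ} (M N R Q : Xi n d) :
    ∑ P, structPoly M N P * structPoly P R Q = ∑ P, structPoly N R P * structPoly M P Q := by
  refine eq_of_eval_prime fun q hq => ?_
  have : Fact q.Prime := ⟨hq⟩
  obtain ⟨F, F', w, ho⟩ := exists_inOrbit hn Q (ZMod q)
  have h := congrFun (congrFun (congrFun
    (conv_assoc (K := ZMod q) (V := Fin d → ZMod q) (charFun M.1) (charFun N.1) (charFun R.1)) F) F') w
  rw [conv_charFun hn M N, conv_charFun hn N R, conv_sum_left, conv_sum_right] at h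
  simp only [isStructurePoly_structPoly hn _ _ Q (ZMod q) F F' w ho, Nat.card_zmod] at h
  simpa only [Polynomial.eval_finsetSum, Polynomial.eval_mul] using h

/-! ### Bilinear products on free modules -/

section Bilin

variable {α β R S : Type*} [CommRing R] [CommRing S]

/-- The bilinear product with the given values on the basis. -/
def bilin (c : α → α → α →₀ R) : (α →₀ R) →ₗ[R] (α →₀ R) →ₗ[R] (α →₀ R) :=
  Finsupp.linearCombination R fun M => Finsupp.linearCombination R (c M)

lemma bilin_single (c : α → α → α →₀ R) (M N : α) (a b : R) :
    bilin c (Finsupp.single M a) (Finsupp.single N b) = a • b • c M N := by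
  simp [bilin]

lemma bilin_assoc {c : α → α → α →₀ R}
    (h : ∀ M N P, bilin c (c M N) (Finsupp.single P 1) = bilin c (Finsupp.single M 1) (c N P))
    (x y z : α →₀ R) : bilin c (bilin c x y) z = bilin c x (bilin c y z) := by
  induction x using Finsupp.induction_linear with
  | zero => simp
  | add x x' hx hx' => simp only [map_add, LinearMap.add_apply, hx, hx']
  | single M a =>
    induction y using Finsupp.induction_linear with
    | zero => simp
    | add y y' hy hy' => simp only [map_add, LinearMap.add_apply, hy, hy']
    | single N b =>
      induction z using Finsupp.induction_linear with
      | zero => simp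
      | add z z' hz hz' => simp only [map_add, hz, hz']
      | single P e =>
        have h1 : ∀ (X : α) (r : R), Finsupp.single X r = r • Finsupp.single X 1 := fun X r => by
          rw [Finsupp.smul_single, smul_eq_mul, mul_one]
        rw [bilin_single, bilin_single, h1 P e, h1 M a]
        simp only [map_smul, LinearMap.smul_apply, h]
        rw [smul_comm a b, smul_comm e b]

/-- Compatibility is only required on the supports of x and y. This matters because specialization
at p respects the product of two given basis elements only for p large, with a bound depending on
the pair. -/
lemma map_bilin (σ : R →+* S) (T : (α →₀ R) →+ (β →₀ S)) (hT : ∀ r x, T (r • x) = σ r • T x)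
    {c : α → α → α →₀ R} {c' : β → β → β →₀ S} (x y : α →₀ R)
    (h : ∀ M ∈ x.support, ∀ N ∈ y.support,
      T (c M N) = bilin c' (T (Finsupp.single M 1)) (T (Finsupp.single N 1))) :
    T (bilin c x y) = bilin c' (T x) (T y) := by
  have h1 : ∀ z : α →₀ R, T z = ∑ M ∈ z.support, σ (z M) • T (Finsupp.single M 1) := fun z => by
    conv_lhs => rw [← Finsupp.sum_single z, Finsupp.sum, map_sum]
    refine Finset.sum_congr rfl fun M _ => ?_
    rw [← hT, Finsupp.smul_single, smul_eq_mul, mul_one]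
  have h2 : bilin c x y = ∑ M ∈ x.support, ∑ N ∈ y.support, x M • y N • c M N := by
    conv_lhs => rw [← Finsupp.sum_single x, ← Finsupp.sum_single y, Finsupp.sum, Finsupp.sum]
    simp only [map_sum, LinearMap.sum_apply, bilin_single]
    exact Finset.sum_comm
  rw [h2, h1 x, h1 y]
  simp only [map_sum, LinearMap.sum_apply, map_smul, LinearMap.smul_apply, Finset.smul_sum, hT]
  rw [Finset.sum_comm]
  refine Finset.sum_congr rfl fun N hN => Finset.sum_congr rfl fun M hM => ?_
  rw [h M hM N hN, smul_comm]

end Bilin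

lemma MS.mul_eq_bilin {d : ℕ} (x y : MS n d) : MS.mul x y =
    bilin (fun M N => ∑ P, Finsupp.single P (evSq (structPoly M N P))) x y := by
  simp only [MS.mul, bilin, Finsupp.linearCombination_apply, Finsupp.sum, LinearMap.sum_apply,
    LinearMap.smul_apply, Finset.smul_sum, Finsupp.smul_single, smul_eq_mul, mul_assoc]
  rfl

lemma MS.mul_assoc (hn : 0 < n) {d : ℕ} (x y z : MS n d) :
    MS.mul (MS.mul x y) z = MS.mul x (MS.mul y z) := by
  simp only [MS.mul_eq_bilin]
  refine bilin_assoc (fun M N R => ?_) x y z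
  simp only [map_sum, LinearMap.sum_apply, bilin_single, one_smul, Finset.smul_sum,
    Finsupp.smul_single, smul_eq_mul]
  rw [Finset.sum_comm]
  conv_rhs => rw [Finset.sum_comm]
  refine Finset.sum_congr rfl fun Q _ => ?_
  simp only [← Finsupp.single_finsetSum, ← map_mul, ← map_sum]
  rw [structPoly_assoc hn]

end Mirabolic

namespace Mirabolic

open Module

variable {n : ℕ}

/-! ### Row sums, column sums and off-diagonal entries -/

lemma rankSum_row (M : DecMat n) (i : ℕ) :
    rankSum M.A i n = ∑ a : Fin n, if (a : ℕ) < i then M.ro a else 0 := by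
  rw [rankSum, Fintype.sum_prod_type]
  refine Finset.sum_congr rfl fun a _ => ?_
  split_ifs with h <;> simp [h, DecMat.ro]

lemma rankSum_col (M : DecMat n) (j : ℕ) :
    rankSum M.A n j = ∑ b : Fin n, if (b : ℕ) < j then M.co b else 0 := by
  rw [rankSum, Fintype.sum_prod_type_right]
  refine Finset.sum_congr rfl fun a _ => ?_
  split_ifs with h <;> simp [h, DecMat.co]

lemma eq_of_partial_sums {f g : Fin n → ℤ} (h : ∀ i ≤ n, (∑ a : Fin n, if (a : ℕ) < i then f a else 0) =
    ∑ a : Fin n, if (a : ℕ) < i then g a else 0) : f = g := by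
  have key : ∀ (f : Fin n → ℤ) (b : Fin n), f b = (∑ a : Fin n, if (a : ℕ) < b + 1 then f a else 0) -
      ∑ a : Fin n, if (a : ℕ) < b then f a else 0 := fun f b => by
    rw [← Finset.sum_sub_distrib]
    have : ∀ a : Fin n, ((if (a : ℕ) < b + 1 then f a else 0) - if (a : ℕ) < b then f a else 0) =
        if a = b then f a else 0 := fun a => by
      rcases lt_trichotomy (a : ℕ) b with h | h | h
      · rw [if_pos (by omega), if_pos h, if_neg (by rintro rfl; omega), sub_self]
      · rw [if_pos (by omega), if_neg (by omega), if_pos (Fin.ext h), sub_zero]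
      · rw [if_neg (by omega), if_neg (by omega), if_neg (by rintro rfl; omega), sub_self]
    simp only [this, Finset.sum_ite_eq', Finset.mem_univ, if_true]
  funext b
  rw [key f, key g, h _ b.2, h _ b.2.le]

namespace DecMat

/-- The sum of the off-diagonal entries. -/
def off (M : DecMat n) : ℤ := ∑ x : Fin n × Fin n, if x.1 ≠ x.2 then M.A x.1 x.2 else 0

/-- `(A, Δ) ↦ (A - p I, Δ)`. -/
def unshift (p : ℕ) (M : DecMat n) : DecMat n where
  A := M.A - Matrix.diagonal (fun _ => (p : ℤ))
  Δ := M.Δ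
  offDiag_nonneg := fun i j h => by
    simpa [Matrix.diagonal_apply_ne _ h] using M.offDiag_nonneg i j h
  chain := M.chain
  offDiag_pos := fun x hx h => by
    simpa [Matrix.diagonal_apply_ne _ h] using M.offDiag_pos x hx h

lemma shift_unshift (p : ℕ) (M : DecMat n) : (M.unshift p).shift p = M := by
  ext <;> simp [shift, unshift]

lemma unshift_shift (p : ℕ) (M : DecMat n) : (M.shift p).unshift p = M := by
  ext <;> simp [shift, unshift]

lemma unshift_eq_iff {p : ℕ} {M N : DecMat n} : M.unshift p = N ↔ M = N.shift p :=
  ⟨fun h => by rw [← h, shift_unshift], fun h => by rw [h, unshift_shift]⟩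

lemma ro_shift (p : ℕ) (M : DecMat n) : (M.shift p).ro = fun i => M.ro i + p := by
  funext i
  simp only [ro, fun j => M.shift_A p (i, j), Finset.sum_add_distrib, Finset.sum_ite_eq,
    Finset.mem_univ, if_true]

lemma co_shift (p : ℕ) (M : DecMat n) : (M.shift p).co = fun i => M.co i + p := by
  funext j
  simp only [co, fun i => M.shift_A p (i, j), Finset.sum_add_distrib, Finset.sum_ite_eq',
    Finset.mem_univ, if_true]

lemma shift_A_of_ne (p : ℕ) (M : DecMat n) {i j : Fin n} (h : i ≠ j) : (M.shift p).A i j = M.A i j := by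
  rw [M.shift_A p (i, j), if_neg h, add_zero]

lemma off_shift (p : ℕ) (M : DecMat n) : (M.shift p).off = M.off :=
  Finset.sum_congr rfl fun x _ => by
    split_ifs with h
    · exact M.shift_A_of_ne p h
    · rfl

lemma ro_shift_inj {p : ℕ} {M N : DecMat n} : (M.shift p).ro = (N.shift p).ro ↔ M.ro = N.ro := by
  rw [ro_shift, ro_shift]
  exact ⟨fun h => funext fun i => add_right_cancel (congrFun h i), fun h => by rw [h]⟩

lemma co_shift_inj {p : ℕ} {M N : DecMat n} : (M.shift p).co = (N.shift p).co ↔ M.co = N.co := by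
  rw [co_shift, co_shift]
  exact ⟨fun h => funext fun i => add_right_cancel (congrFun h i), fun h => by rw [h]⟩

lemma co_ro_shift_inj {p : ℕ} {M N : DecMat n} : (M.shift p).co = (N.shift p).ro ↔ M.co = N.ro := by
  rw [co_shift, ro_shift]
  exact ⟨fun h => funext fun i => add_right_cancel (congrFun h i), fun h => by rw [h]⟩

lemma sum_off_le (M : DecMat n) (P : Fin n × Fin n → Prop) [DecidablePred P]
    (hP : ∀ x, P x → x.1 ≠ x.2) : (∑ x : Fin n × Fin n, if P x then M.A x.1 x.2 else 0) ≤ M.off := by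
  refine Finset.sum_le_sum fun x _ => ?_
  by_cases h : P x
  · rw [if_pos h, if_pos (hP x h)]
  · rw [if_neg h]
    split_ifs with h'
    · exact M.offDiag_nonneg _ _ h'
    · rfl

lemma le_sum_off (M : DecMat n) (P : Fin n × Fin n → Prop) [DecidablePred P]
    (hP : ∀ x, P x → x.1 ≠ x.2) {y : Fin n × Fin n} (hy : P y) :
    M.A y.1 y.2 ≤ ∑ x : Fin n × Fin n, if P x then M.A x.1 x.2 else 0 := by
  have := Finset.single_le_sum (f := fun x : Fin n × Fin n => if P x then M.A x.1 x.2 else 0)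
    (fun x _ => by
      split_ifs with h
      · exact M.offDiag_nonneg _ _ (hP x h)
      · rfl) (Finset.mem_univ y)
  rwa [if_pos hy] at this

lemma row_sub_diag (M : DecMat n) (i : ℕ) : rankSum M.A i n - rankSum M.A i i =
    ∑ x : Fin n × Fin n, if (x.1 : ℕ) < i ∧ i ≤ (x.2 : ℕ) then M.A x.1 x.2 else 0 := by
  rw [rankSum, rankSum, ← Finset.sum_sub_distrib]
  refine Finset.sum_congr rfl fun x _ => ?_
  have := x.2.2
  by_cases h1 : (x.1 : ℕ) < i <;> by_cases h2 : (x.2 : ℕ) < i <;> simp [h1, h2, not_le]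

lemma col_sub_diag (M : DecMat n) (i : ℕ) : rankSum M.A n i - rankSum M.A i i =
    ∑ x : Fin n × Fin n, if (x.2 : ℕ) < i ∧ i ≤ (x.1 : ℕ) then M.A x.1 x.2 else 0 := by
  rw [rankSum, rankSum, ← Finset.sum_sub_distrib]
  refine Finset.sum_congr rfl fun x _ => ?_
  have := x.1.2
  by_cases h1 : (x.1 : ℕ) < i <;> by_cases h2 : (x.2 : ℕ) < i <;> simp [h1, h2, not_le]

end DecMat

section

variable {K : Type} [Field K] {V : Type} [AddCommGroup V] [Module K V] [Finite V]
  {F F' F'' : Flag K n V} {M N P : DecMat n}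

lemma InOrbit.finrank_left {w : V} (h : InOrbit M F F' w) {i : ℕ} (hi : i ≤ n) :
    (finrank K (F.seq i) : ℤ) = rankSum M.A i n := by
  rw [← ((inOrbit_iff _).1 h).1 i hi, F'.seq_last, inf_top_eq]

lemma InOrbit.finrank_right {w : V} (h : InOrbit M F F' w) (i : ℕ) :
    (finrank K (F'.seq i) : ℤ) = rankSum M.A n i := by
  rw [← ((inOrbit_iff _).1 h).1 n le_rfl, F.seq_last, top_inf_eq]

lemma InOrbit.ro_eq {w w' : V} (h : InOrbit M F F' w) (h' : InOrbit N F F'' w') : M.ro = N.ro := by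
  refine eq_of_partial_sums fun i hi => ?_
  rw [← rankSum_row, ← rankSum_row, ← h.finrank_left hi, ← h'.finrank_left hi]

lemma InOrbit.co_eq {w w' : V} (h : InOrbit M F F' w) (h' : InOrbit N F'' F' w') : M.co = N.co := by
  refine eq_of_partial_sums fun i hi => ?_
  rw [← rankSum_col, ← rankSum_col, ← h.finrank_right, ← h'.finrank_right]

lemma InOrbit.co_eq_ro {w w' : V} (h : InOrbit M F F' w) (h' : InOrbit N F' F'' w') : M.co = N.ro := by
  refine eq_of_partial_sums fun i hi => ?_
  rw [← rankSum_col, ← rankSum_row, ← h.finrank_right, ← h'.finrank_left hi]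

/-- From dim (F i ∩ F'' i) + dim (F'' i ∩ F' i) ≤ dim F'' i + dim (F i ∩ F' i) it follows that the
sums over an off-diagonal corner block are subadditive under composition. The bound does not change
when all matrices are shifted by pI. -/
lemma InOrbit.off_le {w₁ w₂ w : V} (hM : InOrbit M F F'' w₁) (hN : InOrbit N F'' F' w₂)
    (hP : InOrbit P F F' w) {k l : Fin n} (hkl : k ≠ l) : P.A k l ≤ M.off + N.off := by
  have : Module.Finite K V := Module.Finite.of_finite
  have key : ∀ i ≤ n, rankSum M.A i i + rankSum N.A i i ≤ rankSum P.A i i + finrank K (F''.seq i) := by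
    intro i hi
    rw [← ((inOrbit_iff _).1 hM).1 i hi, ← ((inOrbit_iff _).1 hN).1 i hi, ← ((inOrbit_iff _).1 hP).1 i hi]
    have h1 := Submodule.finrank_sup_add_finrank_inf_eq (F.seq i ⊓ F''.seq i) (F''.seq i ⊓ F'.seq i)
    have h2 := Submodule.finrank_mono (sup_le inf_le_right inf_le_left :
      F.seq i ⊓ F''.seq i ⊔ F''.seq i ⊓ F'.seq i ≤ F''.seq i)
    have h3 := Submodule.finrank_mono (inf_le_inf inf_le_left inf_le_right :
      F.seq i ⊓ F''.seq i ⊓ (F''.seq i ⊓ F'.seq i) ≤ F.seq i ⊓ F'.seq i)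
    omega
  rcases lt_or_gt_of_ne hkl with h | h
  · have hi : (k : ℕ) + 1 ≤ n := k.2
    have hne : ∀ x : Fin n × Fin n, (x.1 : ℕ) < k + 1 ∧ (k : ℕ) + 1 ≤ x.2 → x.1 ≠ x.2 := fun x hx he => by
      rw [he] at hx; omega
    have h1 := P.le_sum_off _ hne (y := (k, l)) ⟨Nat.lt_succ_self _, Fin.lt_def.1 h⟩
    have h2 := M.sum_off_le _ hne
    have h3 := N.sum_off_le _ hne
    rw [← DecMat.row_sub_diag] at h1 h2 h3
    have h4 := key _ hi
    have h5 := hP.finrank_left hi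
    rw [hM.finrank_left hi] at h5
    rw [hN.finrank_left hi] at h4
    dsimp only at h1
    omega
  · have hi : (l : ℕ) + 1 ≤ n := l.2
    have hne : ∀ x : Fin n × Fin n, (x.2 : ℕ) < l + 1 ∧ (l : ℕ) + 1 ≤ x.1 → x.1 ≠ x.2 := fun x hx he => by
      rw [he] at hx; omega
    have h1 := P.le_sum_off _ hne (y := (k, l)) ⟨Nat.lt_succ_self _, Fin.lt_def.1 h⟩
    have h2 := M.sum_off_le _ hne
    have h3 := N.sum_off_le _ hne
    rw [← DecMat.col_sub_diag] at h1 h2 h3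
    have h4 := key _ hi
    have h5 := hP.finrank_right (l + 1)
    rw [hN.finrank_right] at h5
    rw [hM.finrank_right] at h4
    dsimp only at h1
    omega

end

lemma inOrbit_of_charFun_ne_zero {K : Type} [Field K] {V : Type} [AddCommGroup V] [Module K V]
    {F F' : Flag K n V} {M : DecMat n} {w : V} (h : charFun M F F' w ≠ 0) : InOrbit M F F' w := by
  by_contra h'
  exact h (if_neg h')

lemma structPoly_support (hn : 0 < n) {d : ℕ} {M N P : Xi n d} (h : structPoly M N P ≠ 0) :
    M.1.co = N.1.ro ∧ P.1.ro = M.1.ro ∧ P.1.co = N.1.co ∧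
      ∀ i j, i ≠ j → P.1.A i j ≤ M.1.off + N.1.off := by
  by_contra hcon
  refine h (eq_of_eval_prime fun q hq => ?_)
  have : Fact q.Prime := ⟨hq⟩
  obtain ⟨F, F', w, ho⟩ := exists_inOrbit hn P (ZMod q)
  have h1 := isStructurePoly_structPoly hn M N P (ZMod q) F F' w ho
  rw [Nat.card_zmod] at h1
  rw [← h1, Polynomial.eval_zero]
  have : Fintype (Flag (ZMod q) n (Fin d → ZMod q)) := Fintype.ofFinite _
  rw [conv_eq_sum]
  refine Finset.sum_eq_zero fun F'' _ => Finset.sum_eq_zero fun μ _ => ?_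
  by_contra h2
  have hM := inOrbit_of_charFun_ne_zero (left_ne_zero_of_mul h2)
  have hN := inOrbit_of_charFun_ne_zero (right_ne_zero_of_mul h2)
  exact hcon ⟨hM.co_eq_ro hN, ho.ro_eq hM, ho.co_eq hN, fun i j hij => hM.off_le hN ho hij⟩

/-- The matrices that can occur in a product with prescribed factors. -/
def candidates (M N : DecMat n) : Set (DecMat n) :=
  {Z | Z.ro = M.ro ∧ Z.co = N.co ∧ ∀ i j, i ≠ j → Z.A i j ≤ M.off + N.off}

/-- Off-diagonal entries range over a bounded set, and the row sums then determine the diagonal. -/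
lemma finite_candidates (M N : DecMat n) : (candidates M N).Finite := by
  let f : candidates M N → (Fin n → Fin n → Set.Icc (0 : ℤ) (max 0 (M.off + N.off))) ×
      Finset (Fin n × Fin n) := fun Z => (fun i j => if h : i ≠ j then
        ⟨Z.1.A i j, Z.1.offDiag_nonneg i j h, (Z.2.2.2 i j h).trans (le_max_right _ _)⟩ else
        ⟨0, le_rfl, le_max_left _ _⟩, Z.1.Δ)
  have hf : Function.Injective f := fun Z W h => by
    have h1 : ∀ i j, i ≠ j → Z.1.A i j = W.1.A i j := fun i j hij => by
      have := congrArg Subtype.val (congrFun (congrFun (congrArg Prod.fst h) i) j)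
      simpa only [f, dif_pos hij] using this
    refine Subtype.ext (DecMat.ext ?_ (congrArg Prod.snd h))
    ext i j
    by_cases hij : i = j
    · subst hij
      have h2 : Z.1.ro i = W.1.ro i := by rw [Z.2.1, W.2.1]
      rw [DecMat.ro, DecMat.ro, ← Finset.add_sum_erase _ _ (Finset.mem_univ i),
        ← Finset.add_sum_erase _ _ (Finset.mem_univ i),
        Finset.sum_congr rfl fun j hj => h1 i j (Finset.ne_of_mem_erase hj).symm] at h2
      exact add_right_cancel h2
    · exact h1 i j hij
  exact Set.finite_coe_iff.1 (Finite.of_injective f hf)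

/-! ### Exponents -/

/-- The exponent in the definition of `[A]_Δ`. -/
def expo (M : DecMat n) : ℤ := -M.dimOrbit + M.dimProj

lemma expo_eq (M : DecMat n) : expo M =
    -(∑ x : Fin n × Fin n, ∑ y : Fin n × Fin n,
      if y.1 ≤ x.1 ∧ x.2 < y.2 then M.A x.1 x.2 * M.A y.1 y.2 else 0) -
    ∑ x : Fin n × Fin n, if ∃ y ∈ M.Δ, x.1 ≤ y.1 ∧ x.2 ≤ y.2 then M.A x.1 x.2 else 0 := by
  have h : ∀ x y : Fin n × Fin n, (if x.1 < y.1 ∨ x.2 < y.2 then M.A x.1 x.2 * M.A y.1 y.2 else 0) =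
      (if x.1 < y.1 then M.A x.1 x.2 * M.A y.1 y.2 else 0) +
        if y.1 ≤ x.1 ∧ x.2 < y.2 then M.A x.1 x.2 * M.A y.1 y.2 else 0 := fun x y => by
    by_cases h1 : x.1 < y.1
    · simp [h1, not_le.2 h1]
    · simp [h1, not_lt.1 h1]
  rw [expo, DecMat.dimOrbit, DecMat.dimProj]
  simp only [h, Finset.sum_add_distrib]
  ring

/-- The exponent is quadratic in the entries, but two diagonal positions never form a pair with y.1
≤ x.1 and x.2 < y.2. There is accordingly no term p², and the exponent is affine in p. -/
lemma exists_expo_shift (M : DecMat n) : ∃ t : ℤ, ∀ p : ℕ, expo (M.shift p) = expo M + p * t := by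
  refine ⟨-(∑ x : Fin n × Fin n, ∑ y : Fin n × Fin n, if y.1 ≤ x.1 ∧ x.2 < y.2 then
      ((if x.1 = x.2 then 1 else 0) * M.A y.1 y.2 + M.A x.1 x.2 * if y.1 = y.2 then 1 else 0) else 0) -
    ∑ x : Fin n × Fin n, if ∃ y ∈ M.Δ, x.1 ≤ y.1 ∧ x.2 ≤ y.2 then
      (if x.1 = x.2 then 1 else 0) else 0, fun p => ?_⟩
  have h : ∀ x : Fin n × Fin n, (M.shift p).A x.1 x.2 = M.A x.1 x.2 + p * if x.1 = x.2 then 1 else 0 :=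
    fun x => by rw [M.shift_A p x]; split_ifs <;> simp
  have h1 : ∀ x y : Fin n × Fin n, (if y.1 ≤ x.1 ∧ x.2 < y.2 then
      (M.shift p).A x.1 x.2 * (M.shift p).A y.1 y.2 else 0) =
      (if y.1 ≤ x.1 ∧ x.2 < y.2 then M.A x.1 x.2 * M.A y.1 y.2 else 0) + p *
      if y.1 ≤ x.1 ∧ x.2 < y.2 then ((if x.1 = x.2 then 1 else 0) * M.A y.1 y.2 +
        M.A x.1 x.2 * if y.1 = y.2 then 1 else 0) else 0 := fun x y => by
    rw [h x, h y]
    by_cases hxy : y.1 ≤ x.1 ∧ x.2 < y.2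
    · rw [if_pos hxy, if_pos hxy, if_pos hxy]
      have : ¬ (x.1 = x.2 ∧ y.1 = y.2) := fun hd => by
        have := hxy.2
        rw [← hd.1, ← hd.2] at this
        exact absurd hxy.1 (not_le.2 this)
      by_cases hx : x.1 = x.2
      · have hy : y.1 ≠ y.2 := fun hy => this ⟨hx, hy⟩
        rw [if_pos hx, if_neg hy]; ring
      · rw [if_neg hx]; ring
    · rw [if_neg hxy, if_neg hxy, if_neg hxy]; ring
  have h2 : ∀ x : Fin n × Fin n, (if ∃ y ∈ M.Δ, x.1 ≤ y.1 ∧ x.2 ≤ y.2 then (M.shift p).A x.1 x.2 else 0) =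
      (if ∃ y ∈ M.Δ, x.1 ≤ y.1 ∧ x.2 ≤ y.2 then M.A x.1 x.2 else 0) + p *
      if ∃ y ∈ M.Δ, x.1 ≤ y.1 ∧ x.2 ≤ y.2 then (if x.1 = x.2 then 1 else 0) else 0 := fun x => by
    rw [h x]
    by_cases hx : ∃ y ∈ M.Δ, x.1 ≤ y.1 ∧ x.2 ≤ y.2
    · rw [if_pos hx, if_pos hx, if_pos hx]
    · rw [if_neg hx, if_neg hx, if_neg hx]; ring
  rw [expo_eq, expo_eq]
  have h3 : (M.shift p).Δ = M.Δ := rfl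
  simp only [h3, h1, h2, Finset.sum_add_distrib, ← Finset.mul_sum]
  ring

end Mirabolic

namespace Mirabolic

open Module

variable {n : ℕ}

/-! ### Laurent polynomials -/

lemma toQv_T (k : ℤ) : toQv (LaurentPolynomial.T k) = v ^ k := by
  simp [toQv, vUnit]

lemma zpow_mem_range (k : ℤ) : (v : Qv) ^ k ∈ toQv.range := ⟨LaurentPolynomial.T k, toQv_T k⟩

lemma evSq_mem_range (f : Polynomial ℤ) : evSq f ∈ toQv.range := by
  refine ⟨f.eval₂ (Int.castRingHom 𝒜) (LaurentPolynomial.T 2), ?_⟩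
  rw [Polynomial.hom_eval₂, toQv_T, Subsingleton.elim (toQv.comp (Int.castRingHom 𝒜)) (Int.castRingHom Qv)]
  rfl

lemma v_pow_injective : Function.Injective fun p : ℕ => (v : Qv) ^ p := fun p q h => by
  have h1 : algebraMap (Polynomial ℚ) Qv (Polynomial.X ^ p) = algebraMap (Polynomial ℚ) Qv (Polynomial.X ^ q) := by
    rw [map_pow, map_pow, RatFunc.algebraMap_X]; exact h
  have h2 := congrArg Polynomial.natDegree (RatFunc.algebraMap_injective ℚ h1)
  simpa using h2

lemma toQv_injective : Function.Injective toQv := by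
  rw [injective_iff_map_eq_zero]
  intro f hf
  obtain ⟨m, g, hg⟩ := LaurentPolynomial.exists_T_pow f
  have h1 : toQv (Polynomial.toLaurent g) = 0 := by rw [hg, map_mul, hf, zero_mul]
  have h2 : toQv (Polynomial.toLaurent g) = algebraMap (Polynomial ℚ) Qv (g.map (Int.castRingHom ℚ)) := by
    have : (toQv.comp (Polynomial.toLaurent : Polynomial ℤ →+* 𝒜)) =
        (algebraMap (Polynomial ℚ) Qv).comp (Polynomial.mapRingHom (Int.castRingHom ℚ)) := by
      refine Polynomial.ringHom_ext' (Subsingleton.elim _ _) ?_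
      simp only [RingHom.comp_apply, Polynomial.toLaurent_X, toQv_T, zpow_one, Polynomial.coe_mapRingHom,
        Polynomial.map_X, RatFunc.algebraMap_X]
    exact RingHom.congr_fun this g
  rw [h2] at h1
  have h3 : g.map (Int.castRingHom ℚ) = 0 := RatFunc.algebraMap_injective ℚ (h1.trans (map_zero _).symm)
  have h4 : g = 0 := Polynomial.map_injective _ Int.cast_injective ((h3.trans (Polynomial.map_zero _).symm))
  rw [h4, map_zero] at hg
  exact (LaurentPolynomial.isUnit_T (R := ℤ) m).mul_left_eq_zero.1 hg.symm

/-- The powers v^(-p) are pairwise distinct, so after clearing negative powers of v' one has a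
polynomial with infinitely many roots. -/
lemma eq_zero_of_evalPow {G : 𝔑} (h : ∀ᶠ p : ℕ in Filter.atTop, evalPow (-(p : ℤ)) G = 0) : G = 0 := by
  obtain ⟨m, g, hg⟩ := LaurentPolynomial.exists_T_pow G
  have h2 : ∀ a : ℤ, evalPow a (Polynomial.toLaurent g) = g.eval ((v : Qv) ^ a) := fun a => by
    have : ((evalPow a).comp (Polynomial.toLaurent : Polynomial Qv →+* 𝔑)) =
        Polynomial.evalRingHom ((v : Qv) ^ a) := by
      refine Polynomial.ringHom_ext (fun c => ?_) ?_
      · simp only [RingHom.comp_apply, Polynomial.toLaurent_C, evalPow_C, Polynomial.coe_evalRingHom,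
          Polynomial.eval_C]
      · simp only [RingHom.comp_apply, Polynomial.toLaurent_X, evalPow_T, mul_one,
          Polynomial.coe_evalRingHom, Polynomial.eval_X]
    exact RingHom.congr_fun this g
  have h4 : g = 0 := by
    refine Polynomial.eq_zero_of_infinite_isRoot g ?_
    obtain ⟨p₀, hp₀⟩ := Filter.eventually_atTop.1 h
    refine Set.Infinite.mono (s := (fun p : ℕ => (v : Qv) ^ (-(p : ℤ))) '' Set.Ici p₀) ?_
      ((Set.Ici_infinite p₀).image fun p _ q _ hpq => ?_)
    · rintro _ ⟨p, hp, rfl⟩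
      rw [Set.mem_ofPred_eq, Polynomial.IsRoot, ← h2, hg, map_mul, hp₀ p hp, zero_mul]
    · simp only [zpow_neg, zpow_natCast, inv_inj] at hpq
      exact v_pow_injective hpq
  rw [h4, map_zero] at hg
  exact (LaurentPolynomial.isUnit_T (R := Qv) m).mul_left_eq_zero.1 hg.symm

lemma exists_evalPow_eq_sum (G : 𝔑) :
    ∃ c : ℤ →₀ Qv, ∀ a : ℤ, evalPow a G = c.sum fun k x => x * v ^ (a * k) := by
  induction G using LaurentPolynomial.induction_on' with
  | add f g hf hg =>
    obtain ⟨c, hc⟩ := hf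
    obtain ⟨c', hc'⟩ := hg
    refine ⟨c + c', fun a => ?_⟩
    rw [map_add, hc, hc', Finsupp.sum_add_index' (by simp) (by intros; ring)]
  | C_mul_T k x =>
    refine ⟨Finsupp.single k x, fun a => ?_⟩
    rw [map_mul, evalPow_C, evalPow_T, Finsupp.sum_single_index (by simp)]

/-- Write f(p) for the sum. The combination f(p + 1) - v^(-a) f(p) eliminates the exponent a, so by
induction it is integral for every p. Since v is a unit, f(p) is then recovered integrally from f(p
+ 1), and integrality spreads downwards from large p to all integers. -/
lemma sum_zpow_mem_range (s : Finset ℤ) (c : ℤ → Qv) (p₀ : ℤ)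
    (h : ∀ p : ℤ, p₀ ≤ p → ∑ k ∈ s, c k * v ^ (-p * k) ∈ toQv.range) (p : ℤ) :
    ∑ k ∈ s, c k * v ^ (-p * k) ∈ toQv.range := by
  classical
  induction s using Finset.induction_on generalizing c p with
  | empty => simp
  | insert a s ha ih =>
    have hrec : ∀ p : ℤ, ∑ k ∈ insert a s, c k * v ^ (-(p + 1) * k) -
        v ^ (-a) * ∑ k ∈ insert a s, c k * v ^ (-p * k) =
        ∑ k ∈ s, (c k * (v ^ (-k) - v ^ (-a))) * v ^ (-p * k) := fun p => by
      rw [Finset.mul_sum, ← Finset.sum_sub_distrib, Finset.sum_insert ha]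
      have h1 : ∀ k : ℤ, (v : Qv) ^ (-(p + 1) * k) = v ^ (-k) * v ^ (-p * k) := fun k => by
        rw [← zpow_add₀ v_ne_zero]; congr 1; ring
      rw [h1, show c a * (v ^ (-a) * v ^ (-p * a)) - v ^ (-a) * (c a * v ^ (-p * a)) = (0 : Qv) by ring,
        zero_add]
      refine Finset.sum_congr rfl fun k _ => ?_
      rw [h1]; ring
    have hs : ∀ p : ℤ, ∑ k ∈ s, (c k * (v ^ (-k) - v ^ (-a))) * v ^ (-p * k) ∈ toQv.range := fun p =>
      ih _ (fun p hp => by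
        rw [← hrec]
        exact sub_mem (h _ (by omega)) (mul_mem (zpow_mem_range _) (h _ hp))) p
    have hstep : ∀ m : ℕ, ∑ k ∈ insert a s, c k * v ^ (-(p₀ - m) * k) ∈ toQv.range := fun m => by
      induction m with
      | zero => exact h _ (by simp)
      | succ m ihm =>
        have h2 := hrec (p₀ - (m + 1 : ℕ))
        rw [show p₀ - ((m + 1 : ℕ) : ℤ) + 1 = p₀ - m by push_cast; ring] at h2
        have h3 : ∑ k ∈ insert a s, c k * v ^ (-(p₀ - ((m + 1 : ℕ) : ℤ)) * k) =
            v ^ a * (∑ k ∈ insert a s, c k * v ^ (-(p₀ - m) * k) -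
              ∑ k ∈ s, (c k * (v ^ (-k) - v ^ (-a))) * v ^ (-(p₀ - ((m + 1 : ℕ) : ℤ)) * k)) := by
          rw [← h2, sub_sub_cancel, ← mul_assoc, ← zpow_add₀ v_ne_zero, add_neg_cancel, zpow_zero, one_mul]
        rw [h3]
        exact mul_mem (zpow_mem_range _) (sub_mem ihm (hs _))
    by_cases hp : p₀ ≤ p
    · exact h p hp
    · have := hstep (p₀ - p).toNat
      rwa [show p₀ - ((p₀ - p).toNat : ℤ) = p by omega] at this

/-- Specializing v' to 1 is the case p = 0 of the sums in `sum_zpow_mem_range`. -/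
lemma evalPow_zero_mem_range {G : 𝔑} (h : ∀ᶠ p : ℕ in Filter.atTop, evalPow (-(p : ℤ)) G ∈ toQv.range) :
    evalPow 0 G ∈ toQv.range := by
  obtain ⟨c, hc⟩ := exists_evalPow_eq_sum G
  obtain ⟨p₀, hp₀⟩ := Filter.eventually_atTop.1 h
  have := sum_zpow_mem_range c.support c p₀ (fun p hp => by
    have h1 := hp₀ p.toNat (by omega)
    rw [hc, Int.toNat_of_nonneg (by omega)] at h1
    exact h1) 0
  rw [hc]
  simpa [Finsupp.sum] using this

/-! ### Specialization -/

/-- The element `∑ G_i(v, v ^ (-p)) [_pZ_i]`. -/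
def spec (p d : ℕ) : (DecMat n →₀ 𝔑) →+ MS n d where
  toFun X := Finsupp.equivFunOnFinite.symm fun P =>
    evalPow (-(p : ℤ)) (X (P.1.unshift p)) * v ^ expo P.1
  map_zero' := by ext; simp
  map_add' X Y := by ext; simp [add_mul]

lemma spec_apply {p d : ℕ} (X : DecMat n →₀ 𝔑) (P : Xi n d) :
    spec p d X P = evalPow (-(p : ℤ)) (X (P.1.unshift p)) * v ^ expo P.1 := rfl

lemma spec_smul {p d : ℕ} (g : 𝔑) (X : DecMat n →₀ 𝔑) :
    spec p d (g • X) = evalPow (-(p : ℤ)) g • spec p d X := by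
  ext P
  rw [Finsupp.smul_apply, spec_apply, spec_apply, Finsupp.smul_apply, smul_eq_mul, map_mul, smul_eq_mul,
    mul_assoc]

lemma spec_single {p d : ℕ} {M : DecMat n} (h : (M.shift p).IsXi d) (g : 𝔑) :
    spec p d (Finsupp.single M g) = evalPow (-(p : ℤ)) g • br ⟨M.shift p, h⟩ := by
  classical
  ext P
  rw [spec_apply, Finsupp.smul_apply, br, Finsupp.single_apply, Finsupp.single_apply, smul_eq_mul]
  by_cases hP : M = P.1.unshift p
  · have h2 : P = ⟨M.shift p, h⟩ := Subtype.ext (DecMat.unshift_eq_iff.1 hP.symm)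
    rw [if_pos hP, if_pos h2.symm, h2]
    rfl
  · rw [if_neg hP, if_neg, map_zero, zero_mul, mul_zero]
    rintro rfl
    exact hP (DecMat.unshift_shift p M).symm

lemma spec_single_eq_zero {p d : ℕ} {M : DecMat n} (h : ¬ (M.shift p).IsXi d) (g : 𝔑) :
    spec p d (Finsupp.single M g) = 0 := by
  classical
  ext P
  rw [spec_apply, Finsupp.single_apply, if_neg, map_zero, zero_mul, Finsupp.zero_apply]
  intro hP
  exact h (DecMat.unshift_eq_iff.1 hP.symm ▸ P.2)

/-- The diagonal entries of `A + p I` are positive. -/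
def Good (p : ℕ) (M : DecMat n) : Prop := ∀ i, 0 < (M.shift p).A i i

lemma eventually_good (M : DecMat n) : ∀ᶠ p : ℕ in Filter.atTop, Good p M := by
  refine Filter.eventually_all.2 fun i => ?_
  filter_upwards [Filter.eventually_ge_atTop (1 - M.A i i).toNat] with p hp
  have := M.shift_A p (i, i)
  simp only [if_true] at this
  omega

lemma DecMat.IsXi.sum_ro {M : DecMat n} {d : ℕ} (h : M.IsXi d) : ∑ i, M.ro i = d := h.total

lemma DecMat.sum_ro_eq_sum_co (M : DecMat n) : ∑ i, M.ro i = ∑ j, M.co j := Finset.sum_comm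

lemma DecMat.sum_ro_shift (p : ℕ) (M : DecMat n) : ∑ i, (M.shift p).ro i = ∑ i, M.ro i + n * p := by
  rw [ro_shift, Finset.sum_add_distrib]
  simp

lemma Good.isXi {p d : ℕ} {M : DecMat n} (h : Good p M) (hd : ∑ i, M.ro i + n * p = d) :
    (M.shift p).IsXi d where
  nonneg i j := by
    by_cases hij : i = j
    · subst hij; exact (h i).le
    · exact (M.shift p).offDiag_nonneg i j hij
  pos x hx := by
    by_cases hij : x.1 = x.2
    · have := h x.1
      rwa [← hij]
    · exact (M.shift p).offDiag_pos x hx hij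
  total := (M.sum_ro_shift p).trans hd

lemma Good.exists_isXi {p : ℕ} {M : DecMat n} (h : Good p M) :
    ∃ d : ℕ, ∑ i, M.ro i + n * p = d := by
  have : 0 ≤ ∑ i, (M.shift p).ro i := Finset.sum_nonneg fun i _ => Finset.sum_nonneg fun j _ => by
    by_cases hij : i = j
    · subst hij; exact (h i).le
    · exact (M.shift p).offDiag_nonneg i j hij
  rw [M.sum_ro_shift] at this
  exact ⟨(∑ i, M.ro i + n * p).toNat, (Int.toNat_of_nonneg this).symm⟩

lemma DecMat.IsXi.sum_ro_of_shift {p d : ℕ} {M : DecMat n} (h : (M.shift p).IsXi d) :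
    ∑ i, M.ro i + n * p = d := (M.sum_ro_shift p).symm.trans h.sum_ro

/-- Identities with coefficients in ℚ(v)[v', v'⁻¹] may be checked after specialization at all large
p, one coefficient at a time. The total d may vary with p as long as the shifted W has that total.
-/
lemma eq_of_spec {X Y : DecMat n →₀ 𝔑} {W : DecMat n} (h : ∀ᶠ p : ℕ in Filter.atTop, ∃ d : ℕ,
    (W.shift p).IsXi d ∧ spec p d X = spec p d Y) : X W = Y W := by
  rw [← sub_eq_zero]
  refine eq_zero_of_evalPow ?_
  filter_upwards [h] with p ⟨d, hW, h⟩
  have h1 := DFunLike.congr_fun h ⟨W.shift p, hW⟩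
  rw [spec_apply, spec_apply, DecMat.unshift_shift] at h1
  rw [map_sub, sub_eq_zero]
  exact mul_right_cancel₀ (zpow_ne_zero _ v_ne_zero) h1

lemma MS.mul_br_br_apply {d : ℕ} (M N P : Xi n d) :
    MS.mul (br M) (br N) P = v ^ (expo M.1 + expo N.1) * evSq (structPoly M N P) := by
  classical
  rw [MS.mul_eq_bilin, br, br, bilin_single, Finsupp.smul_apply, Finsupp.smul_apply, Finsupp.finsetSum_apply]
  simp only [Finsupp.single_apply, Finset.sum_ite_eq', Finset.mem_univ, if_true, smul_eq_mul]
  rw [zpow_add₀ v_ne_zero (expo M.1), _root_.mul_assoc]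
  rfl

/-- For large p the coefficient of Z is a structure polynomial times v to the difference of the
three exponents; both factors are specializations of fixed Laurent polynomials in v'. Integrality at
v' = 1 comes from integrality of these coefficients for all large p. -/
lemma exists_stableProduct (hn : 0 < n) (M N : DecMat n) : ∃ γ : DecMat n →₀ 𝔑,
    (∀ Z, γ Z ≠ 0 → Z.ro = M.ro ∧ Z.co = N.co) ∧ (M.co ≠ N.ro → γ = 0) ∧
    (∀ᶠ p : ℕ in Filter.atTop, ∀ d, spec p d γ =
      MS.mul (spec p d (Finsupp.single M 1)) (spec p d (Finsupp.single N 1))) ∧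
    ∀ Z, evalPow 0 (γ Z) ∈ toQv.range := by
  classical
  choose G hG using fun Z => exists_stable_structPoly hn M N Z
  choose t ht using fun Z : DecMat n => exists_expo_shift Z
  -- The exponent difference is affine in p; its slope enters with a minus sign because v' stands
  -- for v^(-p).
  let g : DecMat n → 𝔑 := fun Z => LaurentPolynomial.C (v ^ (expo M + expo N - expo Z)) *
    LaurentPolynomial.T (-(t M + t N - t Z)) * G Z
  let γ : DecMat n →₀ 𝔑 := Finsupp.onFinset (finite_candidates M N).toFinset
    (fun Z => if M.co = N.ro ∧ Z ∈ candidates M N then g Z else 0) (fun Z hZ => by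
      rw [Set.Finite.mem_toFinset]
      by_contra h
      exact hZ (if_neg fun h' => h h'.2))
  have hγ : ∀ Z, γ Z = if M.co = N.ro ∧ Z ∈ candidates M N then g Z else 0 := fun Z => rfl
  have hcand : ∀ Z, γ Z ≠ 0 → M.co = N.ro ∧ Z ∈ candidates M N := fun Z hZ => by
    by_contra h
    exact hZ (if_neg h)
  have hg : ∀ Z, ∀ᶠ p : ℕ in Filter.atTop, ∀ (d : ℕ) (hM : (M.shift p).IsXi d)
      (hN : (N.shift p).IsXi d) (hP : (Z.shift p).IsXi d), evalPow (-(p : ℤ)) (g Z) =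
        v ^ (expo (M.shift p) + expo (N.shift p) - expo (Z.shift p)) *
          evSq (structPoly ⟨_, hM⟩ ⟨_, hN⟩ ⟨_, hP⟩) := fun Z => by
    filter_upwards [hG Z] with p hp d hM hN hP
    rw [hp d hM hN hP, map_mul, map_mul, evalPow_C, evalPow_T, ht, ht, ht, ← zpow_add₀ v_ne_zero]
    congr 2
    ring
  have hxi : ∀ Z ∈ candidates M N, M.co = N.ro → ∀ p d, Good p M → Good p N → (Z.shift p).IsXi d →
      (M.shift p).IsXi d ∧ (N.shift p).IsXi d := fun Z hZ hMN p d h1 h2 h3 => by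
    have h4 := h3.sum_ro_of_shift
    rw [hZ.1] at h4
    refine ⟨h1.isXi h4, h2.isXi ?_⟩
    rw [← hMN, ← M.sum_ro_eq_sum_co, h4]
  refine ⟨γ, fun Z hZ => ⟨(hcand Z hZ).2.1, (hcand Z hZ).2.2.1⟩, fun h => ?_, ?_, fun Z => ?_⟩
  · ext1 Z
    by_contra hZ
    exact h (hcand Z hZ).1
  · filter_upwards [eventually_good M, eventually_good N,
      (Filter.eventually_all_finite (finite_candidates M N)).2 fun Z _ => hg Z] with p h1 h2 h3 d
    by_cases hMN : (M.shift p).IsXi d ∧ (N.shift p).IsXi d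
    · rw [spec_single hMN.1, spec_single hMN.2, map_one, one_smul, one_smul]
      ext P
      obtain ⟨Z, hZ⟩ : ∃ Z : DecMat n, P.1 = Z.shift p := ⟨P.1.unshift p, (DecMat.shift_unshift p P.1).symm⟩
      have hZP : (Z.shift p).IsXi d := hZ ▸ P.2
      obtain rfl : P = ⟨Z.shift p, hZP⟩ := Subtype.ext hZ
      rw [MS.mul_br_br_apply, spec_apply, DecMat.unshift_shift, hγ]
      by_cases hc : M.co = N.ro ∧ Z ∈ candidates M N
      · rw [if_pos hc, h3 Z hc.2 d hMN.1 hMN.2 hZP, mul_right_comm, ← zpow_add₀ v_ne_zero, sub_add_cancel]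
      · rw [if_neg hc, map_zero, zero_mul]
        have : structPoly (⟨M.shift p, hMN.1⟩ : Xi n d) ⟨N.shift p, hMN.2⟩ ⟨Z.shift p, hZP⟩ = 0 := by
          by_contra hs
          obtain ⟨s1, s2, s3, s4⟩ := structPoly_support hn hs
          refine hc ⟨DecMat.co_ro_shift_inj.1 s1, DecMat.ro_shift_inj.1 s2, DecMat.co_shift_inj.1 s3,
            fun i j hij => ?_⟩
          have := s4 i j hij
          dsimp only at this
          rwa [DecMat.shift_A_of_ne _ _ hij, DecMat.off_shift, DecMat.off_shift] at this
        rw [this, map_zero, mul_zero]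
    -- If d is not the total of both shifted factors, one of them specializes to zero. The left side
    -- vanishes too, because a Z of total d in the support would force both factors to have total d.
    · have hz : MS.mul (spec p d (Finsupp.single M 1)) (spec p d (Finsupp.single N 1)) = 0 := by
        rw [MS.mul_eq_bilin]
        rcases not_and_or.1 hMN with h | h
        · rw [spec_single_eq_zero h, map_zero, LinearMap.zero_apply]
        · rw [spec_single_eq_zero h, map_zero]
      rw [hz]
      ext P
      rw [spec_apply, Finsupp.zero_apply]
      by_cases hZ : γ (P.1.unshift p) = 0
      · rw [hZ, map_zero, zero_mul]
      · obtain ⟨h4, h5⟩ := hcand _ hZ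
        exact absurd (hxi _ h5 h4 p d h1 h2 ((DecMat.shift_unshift p P.1).symm ▸ P.2)) hMN
  · by_cases hZ : γ Z = 0
    · rw [hZ, map_zero]; exact zero_mem _
    · obtain ⟨h4, h5⟩ := hcand _ hZ
      refine evalPow_zero_mem_range ?_
      filter_upwards [eventually_good M, eventually_good N, eventually_good Z, hg Z] with p h1 h2 h3 h6
      obtain ⟨d, hd⟩ := h3.exists_isXi
      obtain ⟨h7, h8⟩ := hxi Z h5 h4 p d h1 h2 (h3.isXi hd)
      rw [hγ, if_pos ⟨h4, h5⟩, h6 d h7 h8 (h3.isXi hd)]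
      exact mul_mem (zpow_mem_range _) (evSq_mem_range _)

end Mirabolic

namespace Mirabolic

open Module

variable {n : ℕ}

lemma exists_of_bilin_ne_zero {α R : Type*} [CommRing R] {c : α → α → α →₀ R} {x y : α →₀ R} {W : α}
    (h : bilin c x y W ≠ 0) : ∃ M N, x M ≠ 0 ∧ y N ≠ 0 ∧ c M N W ≠ 0 := by
  by_contra! hc
  refine h ?_
  simp only [bilin, Finsupp.linearCombination_apply, Finsupp.sum, LinearMap.sum_apply,
    LinearMap.smul_apply, Finsupp.finsetSum_apply, Finsupp.smul_apply, smul_eq_mul]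
  refine Finset.sum_eq_zero fun M hM => ?_
  rw [Finset.sum_eq_zero fun N hN => ?_, mul_zero]
  rw [hc M N (Finsupp.mem_support_iff.1 hM) (Finsupp.mem_support_iff.1 hN), mul_zero]

lemma map_iterMul {α β : Type} {mul : α → α → α} {mul' : β → β → β} (f : α → β)
    (hf : ∀ x y, f (mul x y) = mul' (f x) (f y)) (k : ℕ) (x : Fin (k + 1) → α) :
    f (iterMul mul k x) = iterMul mul' k fun i => f (x i) := by
  induction k with
  | zero => rfl
  | succ k ih => rw [iterMul, iterMul, hf, ih]

/-! ### The product with coefficients in `ℚ(v)[v', v'⁻¹]` -/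

/-- The coefficients `G_Z(v, v')` of the stable product of two decorated matrices. -/
def stableCoeff (hn : 0 < n) (M N : DecMat n) : DecMat n →₀ 𝔑 := (exists_stableProduct hn M N).choose

lemma stableCoeff_spec (hn : 0 < n) (M N : DecMat n) :
    (∀ Z, stableCoeff hn M N Z ≠ 0 → Z.ro = M.ro ∧ Z.co = N.co) ∧
    (M.co ≠ N.ro → stableCoeff hn M N = 0) ∧
    (∀ᶠ p : ℕ in Filter.atTop, ∀ d, spec p d (stableCoeff hn M N) =
      MS.mul (spec p d (Finsupp.single M 1)) (spec p d (Finsupp.single N 1))) ∧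
    ∀ Z, evalPow 0 (stableCoeff hn M N Z) ∈ toQv.range := (exists_stableProduct hn M N).choose_spec

/-- The bilinear stable product over `ℚ(v)[v', v'⁻¹]`. -/
def stableMul (hn : 0 < n) : (DecMat n →₀ 𝔑) → (DecMat n →₀ 𝔑) → (DecMat n →₀ 𝔑) :=
  fun x y => bilin (stableCoeff hn) x y

lemma spec_stableMul (hn : 0 < n) (x y : DecMat n →₀ 𝔑) : ∀ᶠ p : ℕ in Filter.atTop, ∀ d,
    spec p d (stableMul hn x y) = MS.mul (spec p d x) (spec p d y) := by
  filter_upwards [(Filter.eventually_all_finset x.support).2 fun M _ =>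
    (Filter.eventually_all_finset y.support).2 fun N _ => (stableCoeff_spec hn M N).2.2.1] with p hp d
  rw [MS.mul_eq_bilin]
  refine map_bilin (evalPow (-(p : ℤ))) (spec p d) spec_smul x y fun M hM N hN => ?_
  rw [hp M hM N hN d, MS.mul_eq_bilin]

/-- For each large p both sides specialize to triple products in the algebra of total d, where
associativity is known. -/
lemma stableMul_assoc (hn : 0 < n) (x y z : DecMat n →₀ 𝔑) :
    stableMul hn (stableMul hn x y) z = stableMul hn x (stableMul hn y z) := by
  ext1 W
  refine eq_of_spec ?_
  filter_upwards [eventually_good W, spec_stableMul hn x y, spec_stableMul hn (stableMul hn x y) z,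
    spec_stableMul hn y z, spec_stableMul hn x (stableMul hn y z)] with p hW h1 h2 h3 h4
  obtain ⟨d, hd⟩ := hW.exists_isXi
  exact ⟨d, hW.isXi hd, by rw [h2, h1, h4, h3, MS.mul_assoc hn]⟩

/-- The stable product of a sequence of decorated matrices. -/
def stableProd (hn : 0 < n) (k : ℕ) (A : Fin (k + 1) → DecMat n) : DecMat n →₀ 𝔑 :=
  iterMul (stableMul hn) k fun i => Finsupp.single (A i) 1

lemma spec_iterMul (hn : 0 < n) (k : ℕ) (x : Fin (k + 1) → DecMat n →₀ 𝔑) :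
    ∀ᶠ p : ℕ in Filter.atTop, ∀ d, spec p d (iterMul (stableMul hn) k x) =
      iterMul MS.mul k fun i => spec p d (x i) := by
  induction k with
  | zero => exact Filter.Eventually.of_forall fun p d => rfl
  | succ k ih =>
    filter_upwards [ih fun i => x i.castSucc, spec_stableMul hn
      (iterMul (stableMul hn) k fun i => x i.castSucc) (x (Fin.last (k + 1)))] with p h1 h2 d
    rw [iterMul, iterMul, h2, h1]

lemma stableProd_support (hn : 0 < n) (k : ℕ) (A : Fin (k + 1) → DecMat n) (W : DecMat n)
    (hW : stableProd hn k A W ≠ 0) : Matching A ∧ W.ro = (A 0).ro ∧ W.co = (A (Fin.last k)).co := by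
  classical
  have hs : ∀ M N : DecMat n, (Finsupp.single M (1 : 𝔑)) N ≠ 0 → M = N := fun M N h => by
    by_contra hne
    exact h (Finsupp.single_eq_of_ne' hne)
  induction k generalizing W with
  | zero =>
    obtain rfl := hs _ _ hW
    exact ⟨fun i => i.elim0, rfl, rfl⟩
  | succ k ih =>
    obtain ⟨M, N, hM, hN, hMN⟩ := exists_of_bilin_ne_zero hW
    obtain rfl := hs _ _ hN
    obtain ⟨h1, h2, h3⟩ := ih (fun i => A i.castSucc) M hM
    obtain ⟨h4, h5, -⟩ := stableCoeff_spec hn M (A (Fin.last (k + 1)))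
    have h6 : M.co = (A (Fin.last (k + 1))).ro := by
      by_contra hne
      rw [h5 hne] at hMN
      exact hMN rfl
    refine ⟨fun i => ?_, (h4 W hMN).1.trans h2, (h4 W hMN).2⟩
    induction i using Fin.lastCases with
    | last => exact h3.symm.trans h6
    | cast i => exact h1 i

lemma Matching.sum_ro {k : ℕ} {A : Fin (k + 1) → DecMat n} (h : Matching A) (i : Fin (k + 1)) :
    ∑ j, (A i).ro j = ∑ j, (A 0).ro j := by
  induction i using Fin.induction with
  | zero => rfl
  | succ i ih => rw [← ih, ← h i, ← DecMat.sum_ro_eq_sum_co]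

lemma exists_stableForm (hn : 0 < n) (k : ℕ) (A : Fin (k + 1) → DecMat n) (hA : Matching A) :
    ∃ (m : ℕ) (Z : Fin m → DecMat n) (G : Fin m → 𝔑) (p₀ : ℕ), StableForm A Z G p₀ := by
  classical
  set X := stableProd hn k A with hX
  let e := X.support.equivFin.symm
  obtain ⟨p₀, hp₀⟩ := Filter.eventually_atTop.1 ((spec_iterMul hn k fun i => Finsupp.single (A i) 1).and
    ((Filter.eventually_all.2 fun i => eventually_good (A i)).and
      (Filter.eventually_all.2 fun i => eventually_good (e i).1)))
  refine ⟨X.support.card, fun i => (e i).1, fun i => X (e i).1, p₀, fun p hp => ?_⟩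
  obtain ⟨h1, h2, h3⟩ := hp₀ p hp
  obtain ⟨d, hd⟩ := (h2 0).exists_isXi
  have hA' : ∀ i, ((A i).shift p).IsXi d := fun i => (h2 i).isXi (by rw [hA.sum_ro, hd])
  have hZ' : ∀ i, ((e i).1.shift p).IsXi d := fun i => (h3 i).isXi (by
    rw [(stableProd_support hn k A _ (Finsupp.mem_support_iff.1 (e i).2)).2.1, hd])
  refine ⟨d, hA', hZ', ?_⟩
  have h4 := h1 d
  simp only [spec_single (hA' _), map_one, one_smul] at h4
  rw [← h4]
  change spec p d X = _
  conv_lhs => rw [← Finsupp.sum_single X, Finsupp.sum, map_sum]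
  rw [← Finset.sum_coe_sort, ← e.sum_comp]
  exact Finset.sum_congr rfl fun i _ => spec_single (hZ' i) _

/-- Any two stable forms have the same specializations at all large p, so collecting equal Z gives
the same element. This is the independence of choices in the definition of the stabilized product.
-/
lemma stableProd_eq_of_stableForm (hn : 0 < n) {k m : ℕ} {A : Fin (k + 1) → DecMat n}
    {Z : Fin m → DecMat n} {G : Fin m → 𝔑} {p₀ : ℕ} (h : StableForm A Z G p₀) :
    stableProd hn k A = ∑ i, Finsupp.single (Z i) (G i) := by
  classical
  ext1 W
  -- A W outside both supports is set aside, since nothing ties its total to the d supplied by the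
  -- stable form. For the remaining W the row sums, or membership among the Z i, give the right
  -- total.
  by_cases hW : stableProd hn k A W = 0 ∧ (∑ i, Finsupp.single (Z i) (G i)) W = 0
  · rw [hW.1, hW.2]
  refine eq_of_spec ?_
  filter_upwards [eventually_good W, spec_iterMul hn k fun i => Finsupp.single (A i) 1,
    Filter.eventually_ge_atTop p₀] with p h1 h2 h3
  obtain ⟨d, hA, hZ, h4⟩ := h p h3
  refine ⟨d, ?_, ?_⟩
  · rcases not_and_or.1 hW with hW | hW
    · refine h1.isXi ?_
      rw [(stableProd_support hn k A W hW).2.1]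
      exact (hA 0).sum_ro_of_shift
    · rw [Finsupp.finsetSum_apply] at hW
      obtain ⟨i, -, hi⟩ := Finset.exists_ne_zero_of_sum_ne_zero hW
      have hZW : Z i = W := by
        by_contra hne
        exact hi (Finsupp.single_eq_of_ne' hne)
      exact hZW ▸ hZ i
  · have h5 := h2 d
    simp only [spec_single (hA _), map_one, one_smul] at h5
    rw [h4] at h5
    rw [map_sum]
    refine h5.trans (Finset.sum_congr rfl fun i _ => (spec_single (hZ i) _).symm)

/-! ### Specialization at `v' = 1` -/

/-- The coefficients of the stabilized product. -/
def stabCoeff (hn : 0 < n) (M N : DecMat n) : DecMat n →₀ 𝒜 :=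
  Finsupp.onFinset (stableCoeff hn M N).support
    (fun Z => open Classical in
      if stableCoeff hn M N Z = 0 then 0 else ((stableCoeff_spec hn M N).2.2.2 Z).choose)
    fun _ hZ => Finsupp.mem_support_iff.2 fun h => hZ (if_pos h)

lemma toQv_stabCoeff (hn : 0 < n) (M N Z : DecMat n) :
    toQv (stabCoeff hn M N Z) = evalPow 0 (stableCoeff hn M N Z) := by
  rw [stabCoeff, Finsupp.onFinset_apply]
  split_ifs with h
  · rw [h, map_zero, map_zero]
  · exact ((stableCoeff_spec hn M N).2.2.2 Z).choose_spec

/-- The stabilized product. -/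
def stabMul (hn : 0 < n) : KMod n →ₗ[𝒜] KMod n →ₗ[𝒜] KMod n := bilin (stabCoeff hn)

/-- Coefficientwise application of a ring homomorphism. -/
def mapCoeff {α R S : Type*} [CommRing R] [CommRing S] (σ : R →+* S) : (α →₀ R) →+ (α →₀ S) :=
  Finsupp.mapRange.addMonoidHom (σ : R →+ S)

lemma mapCoeff_apply {α R S : Type*} [CommRing R] [CommRing S] (σ : R →+* S) (x : α →₀ R) (a : α) :
    mapCoeff σ x a = σ (x a) := rfl

lemma mapCoeff_smul {α R S : Type*} [CommRing R] [CommRing S] (σ : R →+* S) (r : R) (x : α →₀ R) :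
    mapCoeff σ (r • x) = σ r • mapCoeff σ x := by
  ext a
  simp [mapCoeff_apply]

lemma mapCoeff_single {α R S : Type*} [CommRing R] [CommRing S] (σ : R →+* S) (a : α) (r : R) :
    mapCoeff σ (Finsupp.single a r) = Finsupp.single a (σ r) :=
  Finsupp.mapRange_single (hf := map_zero σ)

lemma mapCoeff_bilin {α R S : Type*} [CommRing R] [CommRing S] (σ : R →+* S) (c : α → α → α →₀ R)
    (x y : α →₀ R) : mapCoeff σ (bilin c x y) =
      bilin (fun M N => mapCoeff σ (c M N)) (mapCoeff σ x) (mapCoeff σ y) :=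
  map_bilin σ (mapCoeff σ) (mapCoeff_smul σ) x y fun M _ N _ => by
    rw [mapCoeff_single, mapCoeff_single, bilin_single, map_one, one_smul, one_smul]

lemma KMod.toQv_eq_mapCoeff (x : KMod n) : KMod.toQv x = mapCoeff Mirabolic.toQv x := rfl

lemma KMod.toQv_injective : Function.Injective (KMod.toQv (n := n)) :=
  Finsupp.mapRange_injective _ (map_zero _) Mirabolic.toQv_injective

/-- The stabilized product with scalars extended to `ℚ(v)`. -/
def stabMulQv (hn : 0 < n) (x y : DecMat n →₀ Qv) : DecMat n →₀ Qv :=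
  bilin (fun M N => mapCoeff (evalPow 0) (stableCoeff hn M N)) x y

lemma toQv_stabMul (hn : 0 < n) (x y : KMod n) :
    KMod.toQv (stabMul hn x y) = stabMulQv hn (KMod.toQv x) (KMod.toQv y) := by
  have : (fun M N => mapCoeff toQv (stabCoeff hn M N)) =
      fun M N => mapCoeff (evalPow 0) (stableCoeff hn M N) := by
    funext M N
    ext1 Z
    exact toQv_stabCoeff hn M N Z
  rw [stabMulQv, ← this]
  exact mapCoeff_bilin toQv _ x y

lemma evalPow_stableMul (hn : 0 < n) (x y : DecMat n →₀ 𝔑) :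
    mapCoeff (evalPow 0) (stableMul hn x y) =
      stabMulQv hn (mapCoeff (evalPow 0) x) (mapCoeff (evalPow 0) y) :=
  mapCoeff_bilin (evalPow 0) _ x y

lemma stabMulQv_assoc (hn : 0 < n) (x y z : DecMat n →₀ Qv) :
    stabMulQv hn (stabMulQv hn x y) z = stabMulQv hn x (stabMulQv hn y z) := by
  refine bilin_assoc (fun M N P => ?_) x y z
  have h := congrArg (mapCoeff (evalPow 0)) (stableMul_assoc hn (Finsupp.single M 1)
    (Finsupp.single N 1) (Finsupp.single P 1))
  simp only [evalPow_stableMul, mapCoeff_single, map_one] at h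
  simpa only [stabMulQv, bilin_single, one_smul] using h

lemma stabMul_assoc (hn : 0 < n) (x y z : KMod n) :
    stabMul hn (stabMul hn x y) z = stabMul hn x (stabMul hn y z) :=
  KMod.toQv_injective (by simp only [toQv_stabMul, stabMulQv_assoc])

lemma toQv_iterMul_stabMul (hn : 0 < n) (k : ℕ) (A : Fin (k + 1) → DecMat n) :
    KMod.toQv (iterMul (fun x y => stabMul hn x y) k fun i => KMod.br (A i)) =
      mapCoeff (evalPow 0) (stableProd hn k A) := by
  rw [map_iterMul KMod.toQv (toQv_stabMul hn), stableProd,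
    map_iterMul (mapCoeff (evalPow 0)) (evalPow_stableMul hn)]
  simp only [KMod.toQv_eq_mapCoeff, KMod.br, mapCoeff_single, map_one]

lemma isStabilized_stabMul (hn : 0 < n) : IsStabilized (stabMul hn) := by
  refine fun k A => ⟨fun _ m Z G p₀ h => ?_, fun hA => ?_⟩
  · rw [toQv_iterMul_stabMul, stableProd_eq_of_stableForm hn h, map_sum]
    simp only [mapCoeff_single]
  · refine KMod.toQv_injective ?_
    have hX : stableProd hn (k + 1) A = 0 := by
      ext1 W
      by_contra hW
      exact hA (stableProd_support hn _ A W hW).1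
    rw [toQv_iterMul_stabMul, hX, map_zero, KMod.toQv_eq_mapCoeff, map_zero]

/-- The two-factor case determines the product of basis elements, because a stable form exists
whenever the sums match and the product is zero otherwise; bilinearity does the rest. -/
lemma IsStabilized.unique (hn : 0 < n) {mul mul' : KMod n →ₗ[𝒜] KMod n →ₗ[𝒜] KMod n}
    (h : IsStabilized mul) (h' : IsStabilized mul') : mul' = mul := by
  refine Finsupp.lhom_ext' fun M => LinearMap.ext_ring (Finsupp.lhom_ext' fun N => LinearMap.ext_ring ?_)
  change mul' (KMod.br M) (KMod.br N) = mul (KMod.br M) (KMod.br N)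
  by_cases hA : Matching ![M, N]
  · obtain ⟨m, Z, G, p₀, hZ⟩ := exists_stableForm hn 1 ![M, N] hA
    exact KMod.toQv_injective (((h' 0 _).1 hA m Z G p₀ hZ).trans ((h 0 _).1 hA m Z G p₀ hZ).symm)
  · exact ((h' 0 _).2 hA).trans ((h 0 _).2 hA).symm

end Mirabolic

end

theorem proposition5p1p1 (n : ℕ) (hn : 0 < n) :
    (∀ (d : ℕ) (M N P : Mirabolic.Xi n d),
      Mirabolic.IsStructurePoly M N P (Mirabolic.structPoly M N P)) ∧
    (∀ (k : ℕ) (A : Fin (k + 2) → Mirabolic.DecMat n), Mirabolic.Matching A →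
      ∃ (m : ℕ) (Z : Fin m → Mirabolic.DecMat n) (G : Fin m → Mirabolic.𝔑) (p₀ : ℕ),
        Mirabolic.StableForm A Z G p₀) ∧
    ∃ mul : Mirabolic.KMod n →ₗ[Mirabolic.𝒜] Mirabolic.KMod n →ₗ[Mirabolic.𝒜] Mirabolic.KMod n,
      (∀ x y z, mul (mul x y) z = mul x (mul y z)) ∧
      Mirabolic.IsStabilized mul ∧
      ∀ mul', Mirabolic.IsStabilized mul' → mul' = mul :=
  ⟨fun _ M N P => Mirabolic.isStructurePoly_structPoly hn M N P,
    fun k A hA => Mirabolic.exists_stableForm hn (k + 1) A hA,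
    Mirabolic.stabMul hn, Mirabolic.stabMul_assoc hn, Mirabolic.isStabilized_stabMul hn,
    fun _ h => (Mirabolic.isStabilized_stabMul hn).unique hn h⟩
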